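/- Let $L>0$, $\alpha>\tfrac12$ and $\beta<\tfrac12$ be real numbers, and consider real-valued solutions $u=u(x,t)$ of the BBM equation with nonlinear boundary conditions $$ (P)\qquad \begin{cases} u_t-u_{txx}+u_x+uu_x=0, & x\in(0,L),\ t\ge 0,\\ u_{tx}(0,t)=\alpha u(0,t)+\tfrac13u(0,t)^2,\\ u_{tx}(L,t)=\beta u(L,t)+\tfrac13u(L,t)^2,\\ u(x,0)=u_0(x). \end{cases} $$ For $s>\tfrac12$, a solution of $(P)$ on $[0,T]$ in $H^s(0,L)$ means a function $u\in C^1([0,T],H^s(0,L))$ with $u(0)=u_0$ such that, for each $t\in[0,T]$, $v=u_t(t)$ belongs to $C^1([0,L])$ and satisfies $v-v_{xx}=-(u+\tfrac12u^2)_x$ in the sense of distributions on $(0,L)$ together with $v_x(0)=\alpha u(0,t)+\tfrac13u(0,t)^2$ and $v_x(L)=\beta u(L,t)+\tfrac13u(L,t)^2$. **UCP Conjecture** for BBM on $\mathbb T=\mathbb R/2\pi\mathbb Z$: there is $\delta>0$ such that for every $v_0\in H^1(\mathbb T)$ with $\|v_0\|_{H^1(\mathbb T)}<\delta$, if the solution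 $v\in C([0,\infty),H^1(\mathbb T))$ of $v_t-v_{xxt}+v_x+vv_x=0$, $v(\cdot,0)=v_0$, vanishes on $\omega\times(0,T)$ for some nonempty open set $\omega\subset\mathbb T$ and some $T>0$, then $v_0=0$. **Theorem.** 1. Let $s\in(\tfrac12,\tfrac52)$. Then $(P)$ is locally well-posed in $H^s(0,L)$: for every $T>0$ and every $u_0\in H^s(0,L)$ there is at most one solution on $[0,T]$; and for every $\rho\ge0$ there are $T>0$ and $C\ge 0$ such that for every $u_0\in H^s(0,L)$ with $\|u_0\|_{H^s(0,L)}\le\rho$ a solution on $[0,T]$ exists, and any two solutions $u,w$ on $[0,T]$ with such initial data $u_0,w_0$ satisfy $\sup_{t\in[0,T]}\|u(t)-w(t)\|_{H^s(0,L)}\le C\|u_0-w_0\|_{H^s(0,L)}$. 2. For every $u_0\in H^1(0,L)$ the solution $u$ of $(P)$ in $H^1(0,L)$ exists on $[0,T]$ for every $T>0$, and $t\mapsto\|u(t)\|_{H^1(0,L)}$ is nonincreasing on $[0,\infty)$, where $\|u\|_{H^1(0,L)}^2=\int_0^L(u^2+u_x^2)\,dx$. 3. If the UCP Conjecture holds,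 then for every $u_0\in H^1(0,L)$ the solution $u$ of part 2 satisfies, as $t\to+\infty$, $u(t)\to0$ weakly in $H^1(0,L)$ and strongly in $H^s(0,L)$ for every $s<1$. -/

import Mathlib

open MeasureTheory Filter Topology Set
open scoped ENNReal NNReal

namespace BBM

noncomputable section

/-! ### Sobolev spaces `H^s(0,L)` of real-valued functions -/

/-- `φ ∈ C_c^∞(0,L)`. -/
def IsTest (L : ℝ) (φ : ℝ → ℝ) : Prop :=
  ContDiff ℝ (⊤ : ℕ∞) φ ∧ HasCompactSupport φ ∧ tsupport φ ⊆ Ioo 0 L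

/-- `g ∈ L²(0,L)` is the weak derivative of `f` on `(0,L)`. -/
def HasWeakDeriv (L : ℝ) (f g : ℝ → ℝ) : Prop :=
  MemLp g 2 (volume.restrict (Ioo 0 L)) ∧
    ∀ φ : ℝ → ℝ, IsTest L φ →
      ∫ x in Ioo 0 L, f x * deriv φ x = -∫ x in Ioo 0 L, g x * φ x

open Classical in
/-- A representative of the weak derivative of `f` on `(0,L)` if there is one in `L²(0,L)`
(it is then unique almost everywhere), and `0` otherwise. -/
def weakDeriv (L : ℝ) (f : ℝ → ℝ) : ℝ → ℝ :=
  if h : ∃ g, HasWeakDeriv L f g then Classical.choose h else 0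

/-- The square of the Gagliardo-Slobodeckij seminorm of order `σ ∈ (0,1)` on `(0,L)`;
it is `0` by convention for `σ = 0`. -/
def gagliardoSq (L σ : ℝ) (f : ℝ → ℝ) : ℝ≥0∞ :=
  if σ = 0 then 0 else
    ∫⁻ x in Ioo 0 L, ∫⁻ y in Ioo 0 L,
      ‖f x - f y‖ₑ ^ 2 / ENNReal.ofReal (|x - y| ^ (1 + 2 * σ))

/-- `f ∈ H^s(0,L)`, for `s ≥ 0`: with `m` the integer part and `σ` the fractional part of `s`,
`f` and its weak derivatives up to order `m` are in `L²(0,L)`, and the one of order `m` has finite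
Gagliardo seminorm of order `σ`. -/
def MemSobolev (L s : ℝ) (f : ℝ → ℝ) : Prop :=
  MemLp f 2 (volume.restrict (Ioo 0 L)) ∧
    (∀ k < ⌊s⌋₊, ∃ g, HasWeakDeriv L ((weakDeriv L)^[k] f) g) ∧
    gagliardoSq L (Int.fract s) ((weakDeriv L)^[⌊s⌋₊] f) < ∞

/-- The norm of `H^s(0,L)` for `s ≥ 0`. -/
def sobolevNormNonneg (L s : ℝ) (f : ℝ → ℝ) : ℝ≥0∞ :=
  ((∑ k ∈ Finset.range (⌊s⌋₊ + 1), ∫⁻ x in Ioo 0 L, ‖((weakDeriv L)^[k] f) x‖ₑ ^ 2)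
    + gagliardoSq L (Int.fract s) ((weakDeriv L)^[⌊s⌋₊] f)) ^ (1 / 2 : ℝ)

open Classical in
/-- The norm of `H^s(0,L)`; for `s < 0`, `H^s(0,L)` is the dual of `H^{-s}_0(0,L)`, the closure of
`C_c^∞(0,L)` in `H^{-s}(0,L)`, and its norm is the dual norm. -/
def sobolevNorm (L s : ℝ) (f : ℝ → ℝ) : ℝ≥0∞ :=
  if 0 ≤ s then sobolevNormNonneg L s f
  else ⨆ (φ : ℝ → ℝ) (_ : IsTest L φ ∧ sobolevNormNonneg L (-s) φ ≤ 1),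
    ‖∫ x in Ioo 0 L, f x * φ x‖ₑ

/-- `u ∈ C(I, H^s(0,L))`, for a set of times `I`; `u t x` is the value at time `t` and position
`x`. -/
def ContinuousInSobolev (L s : ℝ) (I : Set ℝ) (u : ℝ → ℝ → ℝ) : Prop :=
  ∀ t ∈ I, MemSobolev L s (u t) ∧
    Tendsto (fun τ => sobolevNorm L s (u τ - u t)) (𝓝[I] t) (𝓝 0)

/-- `v t` is the time derivative of `u` at every `t ∈ I`, in the norm of `H^s(0,L)`. -/
def HasTimeDerivInSobolev (L s : ℝ) (I : Set ℝ) (u v : ℝ → ℝ → ℝ) : Prop :=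
  ∀ t ∈ I, Tendsto (fun τ => sobolevNorm L s ((τ - t)⁻¹ • (u τ - u t) - v t))
    (𝓝[I \ {t}] t) (𝓝 0)

/-- Weak convergence `u t ⇀ 0` in the Hilbert space `H^1(0,L)` as `t → +∞`. -/
def WeaklyTendstoZeroH1 (L : ℝ) (u : ℝ → ℝ → ℝ) : Prop :=
  ∀ ψ : ℝ → ℝ, MemSobolev L 1 ψ →
    Tendsto (fun t => (∫ x in Ioo 0 L, u t x * ψ x)
      + ∫ x in Ioo 0 L, weakDeriv L (u t) x * weakDeriv L ψ x) atTop (𝓝 0)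

/-! ### The boundary value problem on `(0,L)` -/

/-- `v` solves `v - v_xx = -(u + u²/2)_x` in the sense of distributions on `(0,L)`, with
`v_x(0) = α u(0) + u(0)²/3` and `v_x(L) = β u(L) + u(L)²/3`. -/
def SolvesElliptic (L α β : ℝ) (u v : ℝ → ℝ) : Prop :=
  ContDiffOn ℝ 1 v (Icc 0 L) ∧
    (∀ φ : ℝ → ℝ, IsTest L φ →
      ∫ x in Ioo 0 L, v x * (φ x - deriv (deriv φ) x)
        = ∫ x in Ioo 0 L, (u x + u x ^ 2 / 2) * deriv φ x) ∧
    derivWithin v (Icc 0 L) 0 = α * u 0 + u 0 ^ 2 / 3 ∧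
    derivWithin v (Icc 0 L) L = β * u L + u L ^ 2 / 3

/-- `u ∈ C([0,T], H^s(0,L))`, `s > 1/2`, solves `u_t - u_txx + u_x + u u_x = 0` on `(0,L)` with
`u_tx(0,t) = α u(0,t) + u(0,t)²/3`, `u_tx(L,t) = β u(L,t) + u(L,t)²/3` and `u(·,0) = u₀`.
Here `u t` is the continuous representative of its class on `[0,L]`, and `v` is `u_t`. -/
def IsSolution (L α β s T : ℝ) (u₀ : ℝ → ℝ) (u : ℝ → ℝ → ℝ) : Prop :=
  u 0 =ᵐ[volume.restrict (Ioo 0 L)] u₀ ∧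
    (∀ t ∈ Icc 0 T, ContinuousOn (u t) (Icc 0 L)) ∧
    ContinuousInSobolev L s (Icc 0 T) u ∧
    ∃ v : ℝ → ℝ → ℝ, ContinuousInSobolev L s (Icc 0 T) v ∧
      HasTimeDerivInSobolev L s (Icc 0 T) u v ∧
      ∀ t ∈ Icc 0 T, SolvesElliptic L α β (u t) (v t)

/-! ### The unique continuation conjecture for BBM on the torus `ℝ/2πℤ` -/

instance factTwoPiPos : Fact (0 < 2 * Real.pi) := ⟨Real.two_pi_pos⟩

/-- The torus `ℝ/2πℤ`. -/
abbrev Torus : Type := AddCircle (2 * Real.pi)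

/-- The coefficient `c_n` in `f(x) = ∑ c_n e^{inx}`, for a real-valued `f`. -/
def torusCoeff (f : Torus → ℝ) (n : ℤ) : ℂ := fourierCoeff (fun x => (f x : ℂ)) n

/-- `f ∈ H^1(𝕋)` (with `f` the continuous representative of its class). -/
def MemTorusH1 (f : Torus → ℝ) : Prop :=
  Continuous f ∧ Summable fun n : ℤ => (1 + (n : ℝ) ^ 2) * ‖torusCoeff f n‖ ^ 2

/-- The norm of `H^1(𝕋)`. -/
def torusH1Norm (f : Torus → ℝ) : ℝ :=
  √(∑' n : ℤ, (1 + (n : ℝ) ^ 2) * ‖torusCoeff f n‖ ^ 2)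

/-- `v ∈ C([0,∞), H^1(𝕋))` solves `v_t - v_txx + v_x + v v_x = 0` on `𝕋` with `v(·,0) = v₀`, that is
`v_t = -(1 - ∂_x²)⁻¹ ∂_x (v + v²/2)`, written on the Fourier coefficients in `x`. -/
def IsTorusSolution (v₀ : Torus → ℝ) (v : ℝ → Torus → ℝ) : Prop :=
  v 0 = v₀ ∧
    (∀ t ∈ Ici (0 : ℝ), MemTorusH1 (v t) ∧
      Tendsto (fun τ => torusH1Norm (v τ - v t)) (𝓝[Ici 0] t) (𝓝 0)) ∧
    ∀ n : ℤ, ∀ t ∈ Ici (0 : ℝ),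
      HasDerivWithinAt (fun τ => torusCoeff (v τ) n)
        (-(Complex.I * n / (1 + (n : ℂ) ^ 2)) * torusCoeff (fun x => v t x + v t x ^ 2 / 2) n)
        (Ici 0) t

/-- The Unique Continuation Property conjecture: a solution of BBM on the torus with small
initial data in `H^1(𝕋)` which vanishes on `O × (0,T)`, for some nonempty open `O` and some `T > 0`,
has zero initial data. -/
def UCPConjecture : Prop :=
  ∃ δ : ℝ, 0 < δ ∧ ∀ v₀ : Torus → ℝ, MemTorusH1 v₀ → torusH1Norm v₀ < δ →
    ∀ v : ℝ → Torus → ℝ, IsTorusSolution v₀ v →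
      (∃ (O : Set Torus) (T : ℝ), IsOpen O ∧ O.Nonempty ∧ 0 < T ∧
        ∀ x ∈ O, ∀ t ∈ Ioo 0 T, v t x = 0) →
      v₀ = 0

end

end BBM

namespace BBM

noncomputable section

/-! ### Function spaces on `[0,L]` -/

/-! At a fixed time put `f = u + u²/2`, `v = u_t` and `g = v_x - f`. The equation and its boundary
conditions say that `g' = v` and `v' = g + f`, with `g(0)` and `g(L)` given by quadratic polynomials
in `u(0)` and `u(L)`. This is the Dirichlet problem `g'' - g = f`; variation of constants solves it
(`gMap`, `vMap`), and uniqueness holds because `∫ (g² + v²)` is a boundary term in the homogeneous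
case (`SolvesElliptic.eqOn`). Hence (P) is the ODE `u' = vMap u`, whose right side is quadratic in
`u` and gains one derivative.

Local well-posedness is then Picard-Lindelöf. No ODE is solved in `H^s` itself: `H^s` is placed
between spaces `Z ⊂ H^s ⊂ Y`, where `(Y, Z)` is `(C, H¹)`, `(H¹, H²)` or `(H², H³)` and the field
maps `Y` to `Z` (`SolutionModel`). The curve is solved in `Y`, and `u(t) - u(0)` is an integral with
values in `Z`, hence in `H^s`. The analytic input is Morrey's embedding of `H^s` in `C` for `s >
1/2` (`exists_inc_eq`) and the bound of Gagliardo seminorms by `H¹` (`gagliardoSq_prim_le`).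

The coefficient `1/3` in the boundary conditions makes the cubic terms cancel in the energy
identity: `½ d/dt ‖u‖²_{H¹} = (β - 1/2) u(L)² - (α - 1/2) u(0)²` (`inner_field`). This gives
monotonicity and global existence.

For the decay, dissipation gives `u(0), u(L) → 0`, and Barbalat's lemma gives `v(0), v(L) → 0`. A
weighted energy whose derivative dominates `‖v‖²` up to boundary terms (`norm_sq_vMap_le`) makes `v`
small at some time in every long window. There `g` is small, then `f`, then `u`, which cannot jump
to the other zero `-2` of the flux. The moments `∫ u` and `∫ x u` have derivatives `o(1)` and `½ ∫
u² + o(1)`. A lower bound on the derivative and smallness in every window force both moments to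
zero, and Barbalat's lemma for the second moment yields `∫ u² → 0`. Boundedness in `H¹` upgrades
this to weak convergence by density, and to strong convergence in `H^s`, `s < 1`, by interpolation.
-/

/-- Lebesgue measure on `(0,L)`. -/
abbrev mu (L : ℝ) : Measure ℝ := volume.restrict (Ioo 0 L)

/-- Continuous functions on `[0,L]`. -/
abbrev ContSpace (L : ℝ) : Type := C(Icc 0 L, ℝ)

/-- The Hilbert space `L²(0,L)`. -/
abbrev LTwo (L : ℝ) : Type := Lp ℝ 2 (mu L)

variable {L : ℝ} [hL : Fact (0 < L)]

/-- The extension of a continuous function on `[0,L]` to `ℝ` by constants. -/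
def ext (u : ContSpace L) : ℝ → ℝ := IccExtend hL.out.le u

omit hL in
lemma ae_mem_Ioo : ∀ᵐ x ∂(mu L), x ∈ Ioo 0 L := ae_restrict_mem measurableSet_Ioo

lemma ext_of_mem (u : ContSpace L) {x : ℝ} (hx : x ∈ Icc 0 L) : ext u x = u ⟨x, hx⟩ :=
  IccExtend_of_mem _ _ hx

lemma continuous_ext (u : ContSpace L) : Continuous (ext u) := u.continuous.Icc_extend'

lemma abs_ext_le (u : ContSpace L) (x : ℝ) : |ext u x| ≤ ‖u‖ := u.norm_coe_le_norm _

@[simp] lemma ext_add (u w : ContSpace L) (x : ℝ) : ext (u + w) x = ext u x + ext w x := rfl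
@[simp] lemma ext_sub (u w : ContSpace L) (x : ℝ) : ext (u - w) x = ext u x - ext w x := rfl
@[simp] lemma ext_mul (u w : ContSpace L) (x : ℝ) : ext (u * w) x = ext u x * ext w x := rfl
@[simp] lemma ext_smul (c : ℝ) (u : ContSpace L) (x : ℝ) : ext (c • u) x = c * ext u x := rfl
@[simp] lemma ext_one (x : ℝ) : ext (1 : ContSpace L) x = 1 := rfl
@[simp] lemma ext_zero (x : ℝ) : ext (0 : ContSpace L) x = 0 := rfl

lemma norm_le_of_ext {u : ContSpace L} {C : ℝ} (hC : 0 ≤ C)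
    (h : ∀ x ∈ Icc 0 L, |ext u x| ≤ C) : ‖u‖ ≤ C := by
  refine (ContinuousMap.norm_le _ hC).2 fun x => ?_
  simpa [ext_of_mem u x.2] using h x x.2

lemma ext_injOn {u w : ContSpace L} (h : ∀ x ∈ Icc 0 L, ext u x = ext w x) : u = w := by
  ext x
  simpa [ext_of_mem _ x.2] using h x x.2

/-- Continuous functions agreeing almost everywhere on `(0,L)` agree on `[0,L]`. -/
lemma eqOn_of_ae_eq {f g : ℝ → ℝ} (hf : ContinuousOn f (Icc 0 L)) (hg : ContinuousOn g (Icc 0 L))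
    (h : f =ᵐ[mu L] g) : EqOn f g (Icc 0 L) :=
  Measure.eqOn_Icc_of_ae_eq volume hL.out.ne
    (by rw [← restrict_Ioo_eq_restrict_Icc]; exact h) hf hg

/-- Restriction of a function which is continuous on `[0,L]`. -/
def restr (f : ℝ → ℝ) (hf : ContinuousOn f (Icc 0 L)) : ContSpace L :=
  ⟨(Icc 0 L).domRestrict f, hf.domRestrict⟩

lemma ext_restr (f : ℝ → ℝ) (hf : ContinuousOn f (Icc 0 L)) {x : ℝ} (hx : x ∈ Icc 0 L) :
    ext (restr f hf) x = f x := ext_of_mem _ hx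

lemma memLp_ext (u : ContSpace L) : MemLp (ext u) 2 (mu L) :=
  MemLp.of_bound (continuous_ext u).aestronglyMeasurable ‖u‖ (ae_of_all _ fun x => abs_ext_le u x)

/-- The inclusion of `C[0,L]` into `L²(0,L)`. -/
def inc : ContSpace L →L[ℝ] LTwo L :=
  LinearMap.mkContinuous
    { toFun := fun u => (memLp_ext u).toLp (ext u)
      map_add' := fun u w => MemLp.toLp_add (memLp_ext u) (memLp_ext w)
      map_smul' := fun c u => MemLp.toLp_const_smul c (memLp_ext u) }
    ((measureUnivNNReal (mu L) : ℝ) ^ ((2 : ℝ≥0∞).toReal)⁻¹) fun u => by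
      refine (Lp.norm_le_of_ae_bound (norm_nonneg u) ?_)
      filter_upwards [(memLp_ext u).coeFn_toLp] with x hx
      exact (congrArg norm hx).trans_le (abs_ext_le u x)

lemma inc_ae (u : ContSpace L) : inc u =ᵐ[mu L] ext u := (memLp_ext u).coeFn_toLp

lemma inc_injective : Function.Injective (inc : ContSpace L → LTwo L) := fun u w h =>
  ext_injOn (eqOn_of_ae_eq (continuous_ext u).continuousOn (continuous_ext w).continuousOn
    ((inc_ae u).symm.trans (h ▸ inc_ae w)))

omit hL in
lemma memLp_coe (p : LTwo L) : MemLp p 2 (mu L) := Lp.memLp p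

omit hL in
lemma integrable_of_memLp {f : ℝ → ℝ} (hf : MemLp f 2 (mu L)) : Integrable f (mu L) :=
  hf.integrable (by norm_num)

lemma intervalIntegrable_of_memLp {f : ℝ → ℝ} (hf : MemLp f 2 (mu L)) :
    IntervalIntegrable f volume 0 L := by
  rw [intervalIntegrable_iff_integrableOn_Ioo_of_le hL.out.le]
  exact integrable_of_memLp hf

lemma intervalIntegrable_sub {f : ℝ → ℝ} (hf : MemLp f 2 (mu L)) {x y : ℝ} (hx : x ∈ Icc 0 L)
    (hy : y ∈ Icc 0 L) : IntervalIntegrable f volume x y :=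
  (intervalIntegrable_of_memLp hf).mono_set (by
    rw [uIcc_of_le hL.out.le]; exact uIcc_subset_Icc hx hy)

/-- `‖f‖_{L¹} ≤ √L ‖f‖_{L²}` on `(0,L)`. -/
lemma integral_abs_le (p : LTwo L) : ∫ x, |p x| ∂(mu L) ≤ √L * ‖p‖ := by
  have h1 := eLpNorm_le_eLpNorm_mul_rpow_measure_univ (p := 1) (q := 2) (μ := mu L)
    (by norm_num) (memLp_coe p).1
  have h2 : ENNReal.ofReal (∫ x, |p x| ∂(mu L)) = eLpNorm p 1 (mu L) := by
    rw [eLpNorm_one_eq_lintegral_enorm]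
    exact ofReal_integral_norm_eq_lintegral_enorm (integrable_of_memLp (memLp_coe p))
  rw [← h2] at h1
  have h3 : eLpNorm p 2 (mu L) * mu L univ ^ (1 / (1:ℝ≥0∞).toReal - 1 / (2:ℝ≥0∞).toReal)
      = ENNReal.ofReal (√L * ‖p‖) := by
    rw [mul_comm (√L), ENNReal.ofReal_mul (norm_nonneg _), ofReal_norm, Lp.enorm_def,
      Real.sqrt_eq_rpow, ← ENNReal.ofReal_rpow_of_pos hL.out]
    congr 1
    simp only [Measure.restrict_apply MeasurableSet.univ, univ_inter, Real.volume_Ioo, sub_zero,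
      ENNReal.toReal_one, ENNReal.toReal_ofNat]
    norm_num
  rw [h3] at h1
  exact (ENNReal.ofReal_le_ofReal_iff (by positivity)).1 h1

lemma abs_intervalIntegral_le (p : LTwo L) {x : ℝ} (hx : x ∈ Icc 0 L) :
    |∫ y in (0:ℝ)..x, p y| ≤ √L * ‖p‖ := by
  refine le_trans ?_ (integral_abs_le p)
  rw [intervalIntegral.integral_of_le hx.1, ← restrict_Ioo_eq_restrict_Ioc]
  refine (abs_integral_le_integral_abs).trans ?_
  exact setIntegral_mono_set (integrable_of_memLp (memLp_coe p)).abs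
    (ae_of_all _ fun _ => abs_nonneg _) (Ioo_subset_Ioo_right hx.2).eventuallyLE

lemma continuousOn_primitive {f : ℝ → ℝ} (hf : MemLp f 2 (mu L)) :
    ContinuousOn (fun x => ∫ y in (0:ℝ)..x, f y) (Icc 0 L) := by
  have := intervalIntegral.continuousOn_primitive_interval'
    (intervalIntegrable_of_memLp hf) left_mem_uIcc
  rwa [uIcc_of_le hL.out.le] at this

/-- The function `x ↦ a + ∫₀ˣ p`. -/
def prim : ℝ × LTwo L →L[ℝ] ContSpace L :=
  LinearMap.mkContinuous
    { toFun := fun e => restr (fun x => e.1 + ∫ y in (0:ℝ)..x, e.2 y)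
        (continuousOn_const.add (continuousOn_primitive (memLp_coe e.2)))
      map_add' := fun e e' => by
        refine ext_injOn fun x hx => ?_
        rw [ext_add, ext_restr _ _ hx, ext_restr _ _ hx, ext_restr _ _ hx]
        have : ∫ y in (0:ℝ)..x, (e + e').2 y = ∫ y in (0:ℝ)..x, (e.2 y + e'.2 y) := by
          rw [intervalIntegral.integral_of_le hx.1, intervalIntegral.integral_of_le hx.1,
            ← restrict_Ioo_eq_restrict_Ioc]
          exact integral_congr_ae (ae_restrict_of_ae_restrict_of_subset
            (Ioo_subset_Ioo_right hx.2) (Lp.coeFn_add e.2 e'.2))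
        rw [this, intervalIntegral.integral_add
          (intervalIntegrable_sub (memLp_coe _) (left_mem_Icc.2 hL.out.le) hx)
          (intervalIntegrable_sub (memLp_coe _) (left_mem_Icc.2 hL.out.le) hx)]
        simp only [Prod.fst_add]; ring
      map_smul' := fun c e => by
        refine ext_injOn fun x hx => ?_
        rw [RingHom.id_apply, ext_smul, ext_restr _ _ hx, ext_restr _ _ hx]
        have : ∫ y in (0:ℝ)..x, (c • e).2 y = ∫ y in (0:ℝ)..x, c * e.2 y := by
          rw [intervalIntegral.integral_of_le hx.1, intervalIntegral.integral_of_le hx.1,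
            ← restrict_Ioo_eq_restrict_Ioc]
          exact integral_congr_ae (ae_restrict_of_ae_restrict_of_subset
            (Ioo_subset_Ioo_right hx.2) (Lp.coeFn_smul c e.2))
        rw [this, intervalIntegral.integral_const_mul]
        simp only [Prod.smul_fst, smul_eq_mul]; ring }
    (1 + √L) fun e => by
      refine norm_le_of_ext (by positivity) fun x hx => ?_
      simp only [LinearMap.coe_mk, AddHom.coe_mk]
      rw [ext_restr _ _ hx, add_mul, one_mul]
      refine (abs_add_le _ _).trans (add_le_add ((Real.norm_eq_abs _).symm.le.trans
        (norm_fst_le e)) ((abs_intervalIntegral_le _ hx).trans ?_))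
      gcongr
      exact norm_snd_le e

lemma ext_prim (e : ℝ × LTwo L) {x : ℝ} (hx : x ∈ Icc 0 L) :
    ext (prim e) x = e.1 + ∫ y in (0:ℝ)..x, e.2 y :=
  ext_restr _ (continuousOn_const.add (continuousOn_primitive (memLp_coe e.2))) hx

lemma ext_prim_zero (e : ℝ × LTwo L) : ext (prim e) 0 = e.1 := by
  simp [ext_prim e (left_mem_Icc.2 hL.out.le)]

lemma memLp_ext_mul (u : ContSpace L) (p : LTwo L) :
    MemLp (fun x => ext u x * p x) 2 (mu L) := by
  refine ((memLp_coe p).const_mul ‖u‖).mono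
    ((continuous_ext u).aestronglyMeasurable.mul (memLp_coe p).1) (ae_of_all _ fun x => ?_)
  simp only [norm_mul, norm_norm]
  gcongr
  exact abs_ext_le u x

/-- Multiplication of an `L²` function by a continuous function. -/
def mulL : ContSpace L →L[ℝ] LTwo L →L[ℝ] LTwo L :=
  LinearMap.mkContinuous₂
    (LinearMap.mk₂ ℝ (fun u p => (memLp_ext_mul u p).toLp _)
      (fun u w p => by
        rw [← MemLp.toLp_add]; congr 1; funext x; simp [add_mul])
      (fun c u p => by
        rw [← MemLp.toLp_const_smul]; congr 1; funext x; simp [mul_assoc])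
      (fun u p q => by
        rw [← MemLp.toLp_add, MemLp.toLp_eq_toLp_iff]
        filter_upwards [Lp.coeFn_add p q] with x hx
        rw [Pi.add_apply, hx, Pi.add_apply, mul_add])
      (fun c u p => by
        rw [← MemLp.toLp_const_smul, MemLp.toLp_eq_toLp_iff]
        filter_upwards [Lp.coeFn_smul c p] with x hx
        rw [Pi.smul_apply, hx, Pi.smul_apply, smul_eq_mul, smul_eq_mul]; ring))
    1 fun u p => by
      rw [one_mul]
      refine Lp.norm_le_mul_norm_of_ae_le_mul ?_
      filter_upwards [(memLp_ext_mul u p).coeFn_toLp] with x hx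
      simp only [LinearMap.mk₂_apply, hx, norm_mul]
      gcongr
      exact abs_ext_le u x

lemma mulL_ae (u : ContSpace L) (p : LTwo L) : mulL u p =ᵐ[mu L] fun x => ext u x * p x :=
  (memLp_ext_mul u p).coeFn_toLp

lemma mulL_inc (u w : ContSpace L) : mulL u (inc w) = inc (u * w) := by
  refine Lp.ext ?_
  filter_upwards [mulL_ae u (inc w), inc_ae w, inc_ae (u * w)] with x h1 h2 h3
  rw [h1, h2, h3, ext_mul]

omit hL in
/-- The integral over `(0,x)` sees only almost everywhere classes. -/
lemma intervalIntegral_congr_ae {f g : ℝ → ℝ} (h : f =ᵐ[mu L] g) {x y : ℝ} (hx : x ∈ Icc 0 L)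
    (hy : y ∈ Icc 0 L) : ∫ z in x..y, f z = ∫ z in x..y, g z := by
  have key : ∀ {x y : ℝ}, x ∈ Icc 0 L → y ∈ Icc 0 L → x ≤ y →
      ∫ z in x..y, f z = ∫ z in x..y, g z := fun {x y} hx hy hxy => by
    rw [intervalIntegral.integral_of_le hxy, intervalIntegral.integral_of_le hxy,
      ← restrict_Ioo_eq_restrict_Ioc]
    exact integral_congr_ae (ae_restrict_of_ae_restrict_of_subset
      (Ioo_subset_Ioo hx.1 hy.2) h)
  rcases le_total x y with hxy | hxy
  · exact key hx hy hxy
  · rw [intervalIntegral.integral_symm, key hy hx hxy, ← intervalIntegral.integral_symm]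

lemma zero_mem : (0:ℝ) ∈ Icc 0 L := left_mem_Icc.2 hL.out.le
lemma L_mem : L ∈ Icc 0 L := right_mem_Icc.2 hL.out.le

lemma integral_mu (f : ℝ → ℝ) : ∫ x, f x ∂(mu L) = ∫ x in (0:ℝ)..L, f x := by
  rw [intervalIntegral.integral_of_le hL.out.le, ← restrict_Ioo_eq_restrict_Ioc]

lemma absolutelyContinuous_prim (e : ℝ × LTwo L) {x : ℝ} (hx : x ∈ Icc 0 L) :
    AbsolutelyContinuousOnInterval (fun x => e.1 + ∫ y in (0:ℝ)..x, e.2 y) 0 x ∧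
    ∀ᵐ y, y ∈ Ioc 0 x →
      HasDerivAt (fun x => e.1 + ∫ y in (0:ℝ)..x, e.2 y) (e.2 y) y := by
  have hi := intervalIntegrable_sub (memLp_coe e.2) zero_mem hx
  constructor
  · have h1 : AbsolutelyContinuousOnInterval (fun _ : ℝ => e.1) 0 x :=
      (LipschitzWith.const e.1).lipschitzOnWith.absolutelyContinuousOnInterval
    exact h1.add (hi.absolutelyContinuousOnInterval_intervalIntegral left_mem_uIcc)
  · filter_upwards [hi.ae_hasDerivAt_integral] with y hy hy'
    refine (hy ?_ 0 left_mem_uIcc).const_add _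
    rw [uIcc_of_le hx.1]; exact Ioc_subset_Icc_self hy'

/-- The product rule for functions with derivatives in `L²`. -/
lemma prim_mul (a b : ℝ) (p q : LTwo L) :
    prim (a, p) * prim (b, q)
      = prim (a * b, mulL (prim (a, p)) q + mulL (prim (b, q)) p) := by
  refine ext_injOn fun x hx => ?_
  obtain ⟨h1, h2⟩ := absolutelyContinuous_prim (a, p) hx
  obtain ⟨h3, h4⟩ := absolutelyContinuous_prim (b, q) hx
  -- Primitives of integrable functions are absolutely continuous, so integration by parts holds for
  -- them, with derivatives that equal `p` and `q` almost everywhere.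
  have key := h1.integral_deriv_mul_eq_sub h3
  simp only [intervalIntegral.integral_same, add_zero] at key
  have hI : ∫ y in (0:ℝ)..x, (mulL (prim (a, p)) q + mulL (prim (b, q)) p) y
      = ∫ y in (0:ℝ)..x, (deriv (fun x => a + ∫ y in (0:ℝ)..x, p y) y * (b + ∫ z in (0:ℝ)..y, q z)
          + (a + ∫ z in (0:ℝ)..y, p z) * deriv (fun x => b + ∫ y in (0:ℝ)..x, q y) y) := by
    refine (intervalIntegral_congr_ae (L := L) (g := fun y => ext (prim (a, p)) y * q y +
      ext (prim (b, q)) y * p y) ?_ zero_mem hx).trans ?_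
    · filter_upwards [Lp.coeFn_add (mulL (prim (a, p)) q) (mulL (prim (b, q)) p),
        mulL_ae (prim (a, p)) q, mulL_ae (prim (b, q)) p] with y h5 h6 h7
      rw [h5, Pi.add_apply, h6, h7]
    · refine intervalIntegral.integral_congr_ae ?_
      filter_upwards [h2, h4] with y h5 h6 hy
      rw [uIoc_of_le hx.1] at hy
      have hy' : y ∈ Icc 0 L := ⟨hy.1.le, hy.2.trans hx.2⟩
      rw [(h5 hy).deriv, (h6 hy).deriv, ext_prim _ hy', ext_prim _ hy']
      ring
  rw [ext_mul, ext_prim _ hx, ext_prim _ hx, ext_prim _ hx, hI, key]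
  ring

/-- A continuously differentiable function on `[0,L]` is the primitive of its derivative. -/
lemma prim_of_hasDerivAt {u : ContSpace L} {p : ContSpace L}
    (h : ∀ x ∈ Ioo 0 L, HasDerivAt (ext u) (ext p x) x) : u = prim (ext u 0, inc p) := by
  refine ext_injOn fun x hx => ?_
  rw [ext_prim _ hx, intervalIntegral_congr_ae (inc_ae p) zero_mem hx,
    intervalIntegral.integral_eq_sub_of_hasDerivAt_of_le hx.1 (continuous_ext u).continuousOn
      (fun y hy => h y ⟨hy.1, hy.2.trans_le hx.2⟩) ((continuous_ext p).intervalIntegrable _ _)]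
  ring

end

noncomputable section

/-! ### Weak derivatives -/

variable {L : ℝ}

lemma HasWeakDeriv.congr_left {f f' g : ℝ → ℝ} (h : HasWeakDeriv L f g) (hf : f =ᵐ[mu L] f') :
    HasWeakDeriv L f' g := by
  refine ⟨h.1, fun φ hφ => ?_⟩
  rw [← h.2 φ hφ]
  exact integral_congr_ae (by filter_upwards [hf] with x hx; rw [hx])

lemma HasWeakDeriv.congr_right {f g g' : ℝ → ℝ} (h : HasWeakDeriv L f g) (hg : g =ᵐ[mu L] g') :
    HasWeakDeriv L f g' := by
  refine ⟨h.1.ae_eq hg, fun φ hφ => ?_⟩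
  rw [h.2 φ hφ]
  congr 1
  exact integral_congr_ae (by filter_upwards [hg] with x hx; rw [hx])

/-- True equality, not only almost everywhere: the representative is chosen from the set of weak
derivatives, and this set depends only on the class of `f`. -/
lemma weakDeriv_congr {f f' : ℝ → ℝ} (hf : f =ᵐ[mu L] f') : weakDeriv L f = weakDeriv L f' := by
  have : HasWeakDeriv L f = HasWeakDeriv L f' := by
    funext g
    exact propext ⟨fun h => h.congr_left hf, fun h => h.congr_left hf.symm⟩
  unfold weakDeriv
  rw [this]

lemma hasWeakDeriv_weakDeriv {f : ℝ → ℝ} (h : ∃ g, HasWeakDeriv L f g) :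
    HasWeakDeriv L f (weakDeriv L f) := by
  unfold weakDeriv
  rw [dif_pos h]
  exact h.choose_spec

lemma IsTest.eq_zero {φ : ℝ → ℝ} (hφ : IsTest L φ) {x : ℝ} (hx : x ∉ Ioo 0 L) : φ x = 0 :=
  image_eq_zero_of_notMem_tsupport fun h => hx (hφ.2.2 h)

lemma IsTest.continuous_deriv {φ : ℝ → ℝ} (hφ : IsTest L φ) : Continuous (deriv φ) :=
  hφ.1.continuous_deriv (by simp)

lemma integrable_mul_of_memLp {f φ : ℝ → ℝ} (hf : MemLp f 2 (mu L)) (hφ : Continuous φ) :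
    Integrable (fun x => f x * φ x) (mu L) := by
  obtain ⟨C, hC⟩ := (isCompact_Icc (a := (0:ℝ)) (b := L)).exists_bound_of_continuousOn
    hφ.continuousOn
  refine (integrable_of_memLp hf).mul_bdd (c := C) hφ.aestronglyMeasurable ?_
  filter_upwards [ae_mem_Ioo] with x hx
  exact hC x (Ioo_subset_Icc_self hx)

lemma ae_eq_zero_of_test {f : ℝ → ℝ} (hf : MemLp f 2 (mu L))
    (h : ∀ φ, IsTest L φ → ∫ x, f x * φ x ∂(mu L) = 0) : f =ᵐ[mu L] 0 := by
  have hi : IntegrableOn f (Ioo 0 L) volume := integrable_of_memLp hf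
  have := isOpen_Ioo.ae_eq_zero_of_integral_contDiff_smul_eq_zero (μ := volume)
    hi.locallyIntegrableOn fun φ h1 h2 h3 => by
      have hφ : IsTest L φ := ⟨h1, h2, h3⟩
      rw [← h φ hφ, setIntegral_eq_integral_of_forall_compl_eq_zero]
      · simp [mul_comm]
      · intro x hx; simp [hφ.eq_zero hx]
  filter_upwards [ae_mem_Ioo, ae_restrict_of_ae this] with x hx h2
  exact h2 hx

lemma HasWeakDeriv.unique {f g g' : ℝ → ℝ} (h : HasWeakDeriv L f g) (h' : HasWeakDeriv L f g') :
    g =ᵐ[mu L] g' := by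
  have := ae_eq_zero_of_test (h.1.sub h'.1) fun φ hφ => by
    simp only [Pi.sub_apply, sub_mul]
    rw [integral_sub (integrable_mul_of_memLp h.1 hφ.1.continuous)
      (integrable_mul_of_memLp h'.1 hφ.1.continuous)]
    have h1 := h.2 φ hφ
    have h2 := h'.2 φ hφ
    linarith
  filter_upwards [this] with x hx
  simpa [sub_eq_zero] using hx

lemma HasWeakDeriv.weakDeriv_ae {f g : ℝ → ℝ} (h : HasWeakDeriv L f g) :
    weakDeriv L f =ᵐ[mu L] g := (hasWeakDeriv_weakDeriv ⟨g, h⟩).unique h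

lemma HasWeakDeriv.add_const_mul {f g f' g' : ℝ → ℝ} (hf : MemLp f 2 (mu L))
    (hf' : MemLp f' 2 (mu L)) (h : HasWeakDeriv L f g) (h' : HasWeakDeriv L f' g') (c : ℝ) :
    HasWeakDeriv L (f + c • f') (g + c • g') := by
  refine ⟨h.1.add (h'.1.const_smul c), fun φ hφ => ?_⟩
  simp only [Pi.add_apply, Pi.smul_apply, smul_eq_mul, add_mul, mul_assoc]
  rw [integral_add (integrable_mul_of_memLp hf hφ.continuous_deriv)
    ((integrable_mul_of_memLp hf' hφ.continuous_deriv).const_mul c),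
    integral_add (integrable_mul_of_memLp h.1 hφ.1.continuous)
    ((integrable_mul_of_memLp h'.1 hφ.1.continuous).const_mul c), integral_const_mul,
    integral_const_mul, h.2 φ hφ, h'.2 φ hφ]
  ring

variable [hL : Fact (0 < L)]

/-- A test function is the primitive of its derivative, so the product rule applies; at `L` the
product vanishes because the test function does. -/
lemma hasWeakDeriv_prim (e : ℝ × LTwo L) : HasWeakDeriv L (ext (prim e)) e.2 := by
  refine ⟨memLp_coe _, fun φ hφ => ?_⟩
  have hφ0 : φ 0 = 0 := hφ.eq_zero (by simp)
  have hφL : φ L = 0 := hφ.eq_zero (by simp)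
  set w : ContSpace L := restr φ hφ.1.continuous.continuousOn with hw
  set w' : ContSpace L := restr (deriv φ) hφ.continuous_deriv.continuousOn with hw'
  have hprim : w = prim (0, inc w') := by
    have := prim_of_hasDerivAt (u := w) (p := w') fun x hx => by
      rw [ext_restr _ _ (Ioo_subset_Icc_self hx)]
      refine (hφ.1.differentiable (by simp)).differentiableAt.hasDerivAt.congr_of_eventuallyEq ?_
      filter_upwards [Ioo_mem_nhds hx.1 hx.2] with y hy
      rw [ext_restr _ _ (Ioo_subset_Icc_self hy)]
    rw [this, ext_restr _ _ zero_mem, hφ0]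
  obtain ⟨a, p⟩ := e
  have key := congrArg (fun u => ext u L) (prim_mul a 0 p (inc w'))
  simp only [ext_mul] at key
  rw [← hprim, ext_restr _ _ L_mem, hφL, mul_zero, ext_prim _ L_mem, mul_zero, zero_add,
    ← integral_mu] at key
  have h1 : ∫ x, (mulL (prim (a, p)) (inc w') + mulL w p) x ∂(mu L)
      = ∫ x, (ext (prim (a, p)) x * deriv φ x + p x * φ x) ∂(mu L) := by
    refine integral_congr_ae ?_
    filter_upwards [Lp.coeFn_add (mulL (prim (a, p)) (inc w')) (mulL w p), mulL_ae w p,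
      mulL_ae (prim (a, p)) (inc w'), inc_ae w', ae_mem_Ioo] with x h1 h2 h3 h4 hx
    rw [h1, Pi.add_apply, h2, h3, h4, ext_restr _ _ (Ioo_subset_Icc_self hx),
      ext_restr _ _ (Ioo_subset_Icc_self hx)]
    ring
  rw [h1, integral_add (integrable_mul_of_memLp (memLp_ext _) hφ.continuous_deriv)
    (integrable_mul_of_memLp (memLp_coe p) hφ.1.continuous)] at key
  simp only
  linarith

lemma hasWeakDeriv_inc_prim (e : ℝ × LTwo L) : HasWeakDeriv L (inc (prim e)) e.2 :=
  (hasWeakDeriv_prim e).congr_left (inc_ae _).symm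

/-- The du Bois-Reymond lemma. -/
lemma ae_const_of_integral_deriv_eq_zero {h : ℝ → ℝ} (hh : MemLp h 2 (mu L))
    (H : ∀ φ, IsTest L φ → ∫ x, h x * deriv φ x ∂(mu L) = 0) :
    ∃ c : ℝ, h =ᵐ[mu L] fun _ => c := by
  have hL0 := hL.out
  let ρ₀ : ContDiffBump (L / 2) := ⟨L / 8, L / 4, by linarith, by linarith⟩
  set ρ : ℝ → ℝ := ρ₀.normed volume with hρdef
  have hts : tsupport ρ = Metric.closedBall (L / 2) (L / 4) := ρ₀.tsupport_normed_eq
  have hρ : IsTest L ρ := by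
    refine ⟨ρ₀.contDiff_normed, ρ₀.hasCompactSupport_normed, ?_⟩
    rw [hts, Real.closedBall_eq_Icc]
    intro x hx
    constructor <;> linarith [hx.1, hx.2]
  have hρ1 : ∫ x, ρ x = 1 := ρ₀.integral_normed
  refine ⟨∫ x, h x * ρ x ∂(mu L), ?_⟩
  set c := ∫ x, h x * ρ x ∂(mu L) with hc
  have key : (fun x => h x - c) =ᵐ[mu L] 0 := by
    refine ae_eq_zero_of_test (hh.sub (memLp_const c)) fun ψ hψ => ?_
    set m := ∫ x, ψ x with hm
    -- `η` has integral zero, so its primitive is again a test function; testing `H` against it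
    -- gives `∫ h ψ = m ∫ h ρ = m c`.
    set η : ℝ → ℝ := fun x => ψ x - m * ρ x with hη
    have hηs : ContDiff ℝ (⊤ : ℕ∞) η := hψ.1.sub (contDiff_const.mul hρ.1)
    set K := tsupport ψ ∪ tsupport ρ with hK
    have hKc : IsCompact K := hψ.2.1.isCompact.union hρ.2.1.isCompact
    have hKne : K.Nonempty := ⟨L / 2, Or.inr (by rw [hts]; exact Metric.mem_closedBall_self (by linarith))⟩
    have hKsub : K ⊆ Ioo 0 L := union_subset hψ.2.2 hρ.2.2
    -- The extreme points of the two supports: the primitive of `η` started at `a` vanishes outside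
    -- `[a,b]`, a compact subset of `(0,L)`.
    obtain ⟨a, haK, ha⟩ := hKc.exists_isLeast hKne
    obtain ⟨b, hbK, hb⟩ := hKc.exists_isGreatest hKne
    have hηz : ∀ x, x ∉ Icc a b → η x = 0 := by
      intro x hx
      have hxK : x ∉ K := fun h => hx ⟨ha h, hb h⟩
      have h1 : ψ x = 0 := image_eq_zero_of_notMem_tsupport fun h => hxK (Or.inl h)
      have h2 : ρ x = 0 := image_eq_zero_of_notMem_tsupport fun h => hxK (Or.inr h)
      simp [hη, h1, h2]
    have hηint : ∫ x, η x = 0 := by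
      simp only [hη]
      rw [integral_sub (hψ.1.continuous.integrable_of_hasCompactSupport hψ.2.1)
        ((hρ.1.continuous.integrable_of_hasCompactSupport hρ.2.1).const_mul m),
        integral_const_mul, hρ1]
      simp [hm]
    set φ : ℝ → ℝ := fun x => ∫ y in a..x, η y with hφdef
    have hφd : ∀ x, HasDerivAt φ (η x) x := fun x =>
      (hηs.continuous.integral_hasStrictDerivAt a x).hasDerivAt
    have hφ' : deriv φ = η := funext fun x => (hφd x).deriv
    have hφz : ∀ x, x ∉ Icc a b → φ x = 0 := by
      intro x hx
      rw [mem_Icc, not_and_or, not_le, not_le] at hx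
      rcases hx with hx | hx
      · simp only [hφdef]
        rw [intervalIntegral.integral_symm, intervalIntegral.integral_of_le hx.le,
          ← restrict_Ioo_eq_restrict_Ioc, setIntegral_eq_zero_of_forall_eq_zero, neg_zero]
        exact fun y hy => hηz y fun h => absurd h.1 (not_le.2 hy.2)
      · simp only [hφdef]
        have hab : a ≤ b := hb haK
        rw [intervalIntegral.integral_of_le (hab.trans hx.le), ← integral_Icc_eq_integral_Ioc,
          setIntegral_eq_integral_of_forall_compl_eq_zero, hηint]
        exact fun y hy => hηz y fun h => hy ⟨h.1, h.2.trans hx.le⟩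
    have hφts : tsupport φ ⊆ Icc a b :=
      closure_minimal (fun x hx => by by_contra h; exact hx (hφz x h)) isClosed_Icc
    have hφ : IsTest L φ := by
      refine ⟨contDiff_infty_iff_deriv.2 ⟨fun x => (hφd x).differentiableAt, hφ' ▸ hηs⟩,
        isCompact_Icc.of_isClosed_subset (isClosed_tsupport _) hφts, fun x hx => ?_⟩
      exact ⟨(hKsub haK).1.trans_le (hφts hx).1, (hφts hx).2.trans_lt (hKsub hbK).2⟩
    have h1 := H φ hφ
    rw [hφ'] at h1
    simp only [hη, mul_sub] at h1
    have h2 : ∀ x, h x * (m * ρ x) = m * (h x * ρ x) := fun x => by ring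
    simp only [h2] at h1
    rw [integral_sub (integrable_mul_of_memLp hh hψ.1.continuous)
      ((integrable_mul_of_memLp hh hρ.1.continuous).const_mul m), integral_const_mul, ← hc] at h1
    have h3 : ∫ x, ψ x ∂(mu L) = m :=
      setIntegral_eq_integral_of_forall_compl_eq_zero fun x hx => hψ.eq_zero hx
    simp only [sub_mul]
    rw [integral_sub (integrable_mul_of_memLp hh hψ.1.continuous)
      ((integrable_mul_of_memLp (memLp_const c) hψ.1.continuous)), integral_const_mul, h3]
    linarith
  filter_upwards [key] with x hx
  simpa [sub_eq_zero] using hx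

/-- Subtracting the primitive of `q` leaves a function with zero weak derivative, hence a constant.
This is what identifies `H¹(0,L)` with `ℝ × L²(0,L)`. -/
lemma exists_prim_of_hasWeakDeriv {f : ℝ → ℝ} {q : LTwo L} (hf : MemLp f 2 (mu L))
    (h : HasWeakDeriv L f q) : ∃ a : ℝ, f =ᵐ[mu L] ext (prim (a, q)) := by
  have hw := hasWeakDeriv_prim (0, q)
  obtain ⟨c, hc⟩ := ae_const_of_integral_deriv_eq_zero (hf.sub (memLp_ext (prim (0, q))))
    fun φ hφ => by
      simp only [Pi.sub_apply, sub_mul]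
      rw [integral_sub (integrable_mul_of_memLp hf hφ.continuous_deriv)
        (integrable_mul_of_memLp (memLp_ext _) hφ.continuous_deriv)]
      exact sub_eq_zero.2 ((h.2 φ hφ).trans (hw.2 φ hφ).symm)
  refine ⟨c, ?_⟩
  filter_upwards [hc, ae_mem_Ioo] with x hx hx'
  simp only [Pi.sub_apply] at hx
  rw [ext_prim _ (Ioo_subset_Icc_self hx')] at hx ⊢
  linarith

end

noncomputable section

/-! ### Sobolev norms of nonnegative order -/

variable {L : ℝ}

/-- The square of the norm of `L²(0,L)`. -/
def normSq (L : ℝ) (f : ℝ → ℝ) : ℝ≥0∞ := ∫⁻ x in Ioo 0 L, ‖f x‖ₑ ^ 2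

/-- The square of the norm of `H^s(0,L)`, `s ≥ 0`. -/
def sobSq (L s : ℝ) (f : ℝ → ℝ) : ℝ≥0∞ :=
  (∑ k ∈ Finset.range (⌊s⌋₊ + 1), ∫⁻ x in Ioo 0 L, ‖((weakDeriv L)^[k] f) x‖ₑ ^ 2)
    + gagliardoSq L (Int.fract s) ((weakDeriv L)^[⌊s⌋₊] f)

lemma sobolevNorm_eq {s : ℝ} (hs : 0 ≤ s) (f : ℝ → ℝ) :
    sobolevNorm L s f = sobSq L s f ^ (1 / 2 : ℝ) := by
  rw [sobolevNorm, if_pos hs]; rfl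

lemma sobolevNorm_sq {s : ℝ} (hs : 0 ≤ s) (f : ℝ → ℝ) :
    sobolevNorm L s f ^ 2 = sobSq L s f := by
  rw [sobolevNorm_eq hs, ← ENNReal.rpow_natCast, ← ENNReal.rpow_mul]
  norm_num

lemma normSq_congr {f g : ℝ → ℝ} (h : f =ᵐ[mu L] g) : normSq L f = normSq L g :=
  lintegral_congr_ae (by filter_upwards [h] with x hx; rw [hx])

lemma eLpNorm_sq {μ : Measure ℝ} (f : ℝ → ℝ) : eLpNorm f 2 μ ^ 2 = ∫⁻ x, ‖f x‖ₑ ^ 2 ∂μ := by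
  have := eLpNorm_nnreal_pow_eq_lintegral (μ := μ) (f := f) (p := 2) (by norm_num)
  simpa only [NNReal.coe_ofNat, ENNReal.coe_ofNat, ENNReal.rpow_two] using this

lemma normSq_eq_enorm_sq (p : LTwo L) : normSq L p = ‖p‖ₑ ^ 2 := by
  rw [Lp.enorm_def, eLpNorm_sq]; rfl

lemma gagliardoSq_congr {f g : ℝ → ℝ} (h : f =ᵐ[mu L] g) (σ : ℝ) :
    gagliardoSq L σ f = gagliardoSq L σ g := by
  unfold gagliardoSq
  split_ifs
  · rfl
  refine lintegral_congr_ae ?_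
  filter_upwards [h] with x hx
  refine lintegral_congr_ae ?_
  filter_upwards [h] with y hy
  rw [hx, hy]

/-- This recursion, with its analogue for membership, reduces statements about all orders to orders
in `[0,1)`. -/
lemma sobSq_add_one {s : ℝ} (hs : 0 ≤ s) (f : ℝ → ℝ) :
    sobSq L (s + 1) f = normSq L f + sobSq L s (weakDeriv L f) := by
  unfold sobSq
  rw [Nat.floor_add_one hs, Int.fract_add_one, Finset.sum_range_succ' _ (⌊s⌋₊ + 1)]
  simp only [Function.iterate_succ, Function.comp_apply, Function.iterate_zero, id]
  rw [add_assoc, add_comm, add_assoc, normSq]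
  ac_rfl

lemma memSobolev_add_one {s : ℝ} (hs : 0 ≤ s) (f : ℝ → ℝ) :
    MemSobolev L (s + 1) f ↔ MemLp f 2 (mu L) ∧ (∃ g, HasWeakDeriv L f g) ∧
      MemSobolev L s (weakDeriv L f) := by
  unfold MemSobolev
  rw [Nat.floor_add_one hs, Int.fract_add_one]
  constructor
  · rintro ⟨h1, h2, h3⟩
    have h4 : ∃ g, HasWeakDeriv L f g := h2 0 (Nat.succ_pos _)
    exact ⟨h1, h4, (hasWeakDeriv_weakDeriv h4).1, fun k hk => h2 (k + 1) (by omega), h3⟩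
  · rintro ⟨h1, h2, _, h4, h5⟩
    refine ⟨h1, fun k hk => ?_, h5⟩
    rcases k with _ | k
    · exact h2
    · exact h4 k (by omega)

lemma sobSq_of_lt_one {s : ℝ} (hs : 0 ≤ s) (hs1 : s < 1) (f : ℝ → ℝ) :
    sobSq L s f = normSq L f + gagliardoSq L s f := by
  unfold sobSq
  rw [Nat.floor_eq_zero.2 hs1, Int.fract_eq_self.2 ⟨hs, hs1⟩]
  simp [normSq]

lemma memSobolev_of_lt_one {s : ℝ} (hs : 0 ≤ s) (hs1 : s < 1) (f : ℝ → ℝ) :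
    MemSobolev L s f ↔ MemLp f 2 (mu L) ∧ gagliardoSq L s f < ∞ := by
  unfold MemSobolev
  rw [Nat.floor_eq_zero.2 hs1, Int.fract_eq_self.2 ⟨hs, hs1⟩]
  simp

/-- Induction on the order of a Sobolev space. -/
lemma order_induction {P : ℝ → Prop} (h0 : ∀ s, 0 ≤ s → s < 1 → P s)
    (h1 : ∀ s, 0 ≤ s → P s → P (s + 1)) {s : ℝ} (hs : 0 ≤ s) : P s := by
  have : ∀ n : ℕ, ∀ s : ℝ, 0 ≤ s → s < n + 1 → P s := by
    intro n
    induction n with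
    | zero => intro s hs hs1; exact h0 s hs (by simpa using hs1)
    | succ n ih =>
      intro s hs hsn
      by_cases h : s < 1
      · exact h0 s hs h
      · have := h1 (s - 1) (by linarith) (ih _ (by linarith) (by push_cast at hsn; linarith))
        rwa [sub_add_cancel] at this
  exact this ⌊s⌋₊ s hs (Nat.lt_floor_add_one s)

lemma sobSq_congr {s : ℝ} (hs : 0 ≤ s) {f g : ℝ → ℝ} (h : f =ᵐ[mu L] g) :
    sobSq L s f = sobSq L s g := by
  by_cases hs1 : s < 1
  · rw [sobSq_of_lt_one hs hs1, sobSq_of_lt_one hs hs1, normSq_congr h, gagliardoSq_congr h]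
  · have := sobSq_add_one (L := L) (s := s - 1) (by linarith)
    rw [sub_add_cancel] at this
    rw [this, this, normSq_congr h, weakDeriv_congr h]

lemma memSobolev_congr {s : ℝ} (hs : 0 ≤ s) {f g : ℝ → ℝ} (h : f =ᵐ[mu L] g)
    (hf : MemSobolev L s f) : MemSobolev L s g := by
  by_cases hs1 : s < 1
  · rw [memSobolev_of_lt_one hs hs1] at hf ⊢
    exact ⟨hf.1.ae_eq h, by rw [← gagliardoSq_congr h]; exact hf.2⟩
  · have := memSobolev_add_one (L := L) (s := s - 1) (by linarith)
    rw [sub_add_cancel] at this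
    rw [this] at hf ⊢
    obtain ⟨h1, ⟨g', h2⟩, h3⟩ := hf
    exact ⟨h1.ae_eq h, ⟨g', h2.congr_left h⟩, weakDeriv_congr h ▸ h3⟩

lemma MemSobolev.memLp {s : ℝ} {f : ℝ → ℝ} (hf : MemSobolev L s f) : MemLp f 2 (mu L) := hf.1

lemma normSq_le_sobSq {s : ℝ} (hs : 0 ≤ s) (f : ℝ → ℝ) : normSq L f ≤ sobSq L s f := by
  by_cases hs1 : s < 1
  · rw [sobSq_of_lt_one hs hs1]; exact le_self_add
  · have := sobSq_add_one (L := L) (s := s - 1) (by linarith) f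
    rw [sub_add_cancel] at this
    rw [this]; exact le_self_add

lemma enorm_add_mul_sq_le (a b c : ℝ) :
    ‖a + c * b‖ₑ ^ 2 ≤ 2 * ‖a‖ₑ ^ 2 + 2 * ‖c‖ₑ ^ 2 * ‖b‖ₑ ^ 2 := by
  have h : ∀ x : ℝ, ‖x‖ₑ ^ 2 = ENNReal.ofReal (x ^ 2) := fun x => by
    rw [Real.enorm_eq_ofReal_abs, ← ENNReal.ofReal_pow (abs_nonneg _), sq_abs]
  have h2 : (2 : ℝ≥0∞) = ENNReal.ofReal 2 := by simp
  rw [h, h, h, h, h2, ← ENNReal.ofReal_mul (by norm_num), ← ENNReal.ofReal_mul (by norm_num),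
    ← ENNReal.ofReal_mul (by positivity), ← ENNReal.ofReal_add (by positivity) (by positivity)]
  exact ENNReal.ofReal_le_ofReal (by nlinarith [sq_nonneg (a - c * b)])

lemma normSq_add_const_mul_le {f g : ℝ → ℝ} (hf : MemLp f 2 (mu L)) (c : ℝ) :
    normSq L (f + c • g) ≤ 2 * normSq L f + 2 * ‖c‖ₑ ^ 2 * normSq L g := by
  have hc : 2 * ‖c‖ₑ ^ 2 ≠ ∞ := by simp [ENNReal.mul_eq_top]
  unfold normSq
  rw [← lintegral_const_mul' _ _ (by norm_num), ← lintegral_const_mul' _ _ hc,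
    ← lintegral_add_left' ((hf.1.enorm.pow_const 2).const_mul 2)]
  exact lintegral_mono fun x => enorm_add_mul_sq_le _ _ _

lemma measurable_gagliardo_integrand {f : ℝ → ℝ} (hf : Measurable f) (σ : ℝ) :
    Measurable fun q : ℝ × ℝ =>
      ‖f q.1 - f q.2‖ₑ ^ 2 / ENNReal.ofReal (|q.1 - q.2| ^ (1 + 2 * σ)) := by
  have h1 : Measurable fun q : ℝ × ℝ => |q.1 - q.2| :=
    (continuous_abs.measurable).comp (measurable_fst.sub measurable_snd)
  exact (((hf.comp measurable_fst).sub (hf.comp measurable_snd)).enorm.pow_const 2).div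
    (h1.pow_const _).ennreal_ofReal

lemma gagliardo_integrand_add_const_mul_le (f g : ℝ → ℝ) (c σ x y : ℝ) :
    ‖(f + c • g) x - (f + c • g) y‖ₑ ^ 2 / ENNReal.ofReal (|x - y| ^ (1 + 2 * σ))
      ≤ 2 * (‖f x - f y‖ₑ ^ 2 / ENNReal.ofReal (|x - y| ^ (1 + 2 * σ)))
        + 2 * ‖c‖ₑ ^ 2 * (‖g x - g y‖ₑ ^ 2 / ENNReal.ofReal (|x - y| ^ (1 + 2 * σ))) := by
  generalize ENNReal.ofReal (|x - y| ^ (1 + 2 * σ)) = D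
  rw [div_eq_mul_inv, div_eq_mul_inv, div_eq_mul_inv, ← mul_assoc, ← mul_assoc, ← add_mul]
  gcongr
  have := enorm_add_mul_sq_le (f x - f y) (g x - g y) c
  refine le_of_eq_of_le ?_ this
  congr 2
  simp only [Pi.add_apply, Pi.smul_apply, smul_eq_mul]
  ring

lemma lintegral_add_le_of_measurable {G F H : ℝ → ℝ≥0∞} {μ : Measure ℝ} {A B : ℝ≥0∞}
    (hA : A ≠ ∞) (hB : B ≠ ∞) (hF : Measurable F) (h : ∀ x, G x ≤ A * F x + B * H x) :
    ∫⁻ x, G x ∂μ ≤ A * ∫⁻ x, F x ∂μ + B * ∫⁻ x, H x ∂μ := by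
  rw [← lintegral_const_mul' _ _ hA, ← lintegral_const_mul' _ _ hB,
    ← lintegral_add_left' (hF.const_mul A).aemeasurable]
  exact lintegral_mono h

lemma gagliardoSq_add_const_mul_le {f g : ℝ → ℝ} (hf : MemLp f 2 (mu L)) (σ : ℝ) (c : ℝ) :
    gagliardoSq L σ (f + c • g) ≤ 2 * gagliardoSq L σ f + 2 * ‖c‖ₑ ^ 2 * gagliardoSq L σ g := by
  have hc : 2 * ‖c‖ₑ ^ 2 ≠ ∞ := ENNReal.mul_ne_top (by norm_num) (ENNReal.pow_ne_top enorm_ne_top)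
  -- Additivity of the lower integral needs only one measurable summand, so a measurable
  -- representative of `f` is enough and `g` stays arbitrary.
  obtain ⟨f', hf', hff'⟩ := hf.1.aemeasurable
  have hsum : f + c • g =ᵐ[mu L] f' + c • g := by
    filter_upwards [hff'] with x hx; simp [hx]
  rw [gagliardoSq_congr hff', gagliardoSq_congr hsum]
  by_cases hσ : σ = 0
  · simp [gagliardoSq, hσ]
  simp only [gagliardoSq, if_neg hσ]
  have hm := measurable_gagliardo_integrand hf' σ
  have hmi : Measurable fun x => ∫⁻ y in Ioo 0 L,
      ‖f' x - f' y‖ₑ ^ 2 / ENNReal.ofReal (|x - y| ^ (1 + 2 * σ)) :=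
    hm.lintegral_prod_right'
  refine lintegral_add_le_of_measurable (by norm_num) hc hmi fun x => ?_
  have hmx : Measurable fun y => ‖f' x - f' y‖ₑ ^ 2 / ENNReal.ofReal (|x - y| ^ (1 + 2 * σ)) :=
    Measurable.comp (f := Prod.mk x) hm measurable_prodMk_left
  exact lintegral_add_le_of_measurable (by norm_num) hc hmx fun y =>
    gagliardo_integrand_add_const_mul_le f' g c σ x y

/-- Linearity and the estimate are proved together so that the induction on the order closes.
Squares with a factor `2` replace Minkowski's inequality; constants are irrelevant later. -/
lemma MemSobolev.add_const_mul_aux {s : ℝ} (hs : 0 ≤ s) : ∀ f g : ℝ → ℝ,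
    MemSobolev L s f → MemSobolev L s g → ∀ c : ℝ, MemSobolev L s (f + c • g) ∧
      sobSq L s (f + c • g) ≤ 2 * sobSq L s f + 2 * ‖c‖ₑ ^ 2 * sobSq L s g := by
  refine order_induction (P := fun s => ∀ f g : ℝ → ℝ,
    MemSobolev L s f → MemSobolev L s g → ∀ c : ℝ, MemSobolev L s (f + c • g) ∧
      sobSq L s (f + c • g) ≤ 2 * sobSq L s f + 2 * ‖c‖ₑ ^ 2 * sobSq L s g)
    (fun s hs hs1 => ?_) (fun s hs ih => ?_) hs
  · intro f g hf hg c
    rw [memSobolev_of_lt_one hs hs1] at hf hg ⊢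
    have h1 := gagliardoSq_add_const_mul_le (L := L) (g := g) hf.1 s c
    refine ⟨⟨hf.1.add (hg.1.const_smul c), h1.trans_lt ?_⟩, ?_⟩
    · exact ENNReal.add_lt_top.2 ⟨ENNReal.mul_lt_top (by norm_num) hf.2,
        ENNReal.mul_lt_top (ENNReal.mul_lt_top (by norm_num) (by simp)) hg.2⟩
    · rw [sobSq_of_lt_one hs hs1, sobSq_of_lt_one hs hs1, sobSq_of_lt_one hs hs1]
      refine (add_le_add (normSq_add_const_mul_le hf.1 c) h1).trans (le_of_eq ?_)
      ring
  · intro f g hf hg c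
    rw [memSobolev_add_one hs] at hf hg ⊢
    have hd := (hasWeakDeriv_weakDeriv hf.2.1).add_const_mul hf.1 hg.1
      (hasWeakDeriv_weakDeriv hg.2.1) c
    obtain ⟨h1, h2⟩ := ih _ _ hf.2.2 hg.2.2 c
    refine ⟨⟨hf.1.add (hg.1.const_smul c), ⟨_, hd⟩,
      memSobolev_congr hs hd.weakDeriv_ae.symm h1⟩, ?_⟩
    rw [sobSq_add_one hs, sobSq_add_one hs, sobSq_add_one hs, sobSq_congr hs hd.weakDeriv_ae]
    refine (add_le_add (normSq_add_const_mul_le hf.1 c) h2).trans (le_of_eq ?_)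
    ring

lemma MemSobolev.add_const_mul {s : ℝ} (hs : 0 ≤ s) {f g : ℝ → ℝ} (hf : MemSobolev L s f)
    (hg : MemSobolev L s g) (c : ℝ) : MemSobolev L s (f + c • g) :=
  (MemSobolev.add_const_mul_aux hs _ _ hf hg c).1

lemma MemSobolev.add {s : ℝ} (hs : 0 ≤ s) {f g : ℝ → ℝ} (hf : MemSobolev L s f)
    (hg : MemSobolev L s g) : MemSobolev L s (f + g) := by
  simpa using hf.add_const_mul hs hg 1

lemma MemSobolev.sub {s : ℝ} (hs : 0 ≤ s) {f g : ℝ → ℝ} (hf : MemSobolev L s f)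
    (hg : MemSobolev L s g) : MemSobolev L s (f - g) := by
  simpa [sub_eq_add_neg] using hf.add_const_mul hs hg (-1)

lemma memSobolev_zero {s : ℝ} (hs : 0 ≤ s) {f : ℝ → ℝ} (hf : MemSobolev L s f) :
    MemSobolev L s 0 := by
  simpa using hf.sub hs hf

lemma MemSobolev.const_mul {s : ℝ} (hs : 0 ≤ s) {f : ℝ → ℝ} (hf : MemSobolev L s f) (c : ℝ) :
    MemSobolev L s (c • f) := by
  simpa using (memSobolev_zero hs hf).add_const_mul hs hf c

lemma sobSq_add_le {s : ℝ} (hs : 0 ≤ s) {f g : ℝ → ℝ} (hf : MemSobolev L s f)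
    (hg : MemSobolev L s g) : sobSq L s (f + g) ≤ 2 * sobSq L s f + 2 * sobSq L s g := by
  simpa using (MemSobolev.add_const_mul_aux hs _ _ hf hg 1).2

/-! ### The Gagliardo seminorm of primitives -/

lemma sq_lintegral_le {μ : Measure ℝ} {h : ℝ → ℝ≥0∞} (hh : AEMeasurable h μ) :
    (∫⁻ x, h x ∂μ) ^ 2 ≤ μ univ * ∫⁻ x, h x ^ 2 ∂μ := by
  have h1 := eLpNorm_le_eLpNorm_mul_rpow_measure_univ (p := 1) (q := 2) (by norm_num)
    hh.aestronglyMeasurable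
  have h2 := eLpNorm_nnreal_pow_eq_lintegral (μ := μ) (f := h) (p := 2) (by norm_num)
  simp only [NNReal.coe_ofNat, ENNReal.coe_ofNat, ENNReal.rpow_two, enorm_eq_self] at h2
  rw [eLpNorm_one_eq_lintegral_enorm] at h1
  simp only [enorm_eq_self] at h1
  refine (pow_le_pow_left₀ (zero_le) h1 2).trans (le_of_eq ?_)
  rw [mul_pow, h2, mul_comm, ← ENNReal.rpow_natCast, ← ENNReal.rpow_mul]
  norm_num

lemma sq_lintegral_enorm_le {μ : Measure ℝ} {f : ℝ → ℝ} (hf : AEStronglyMeasurable f μ) :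
    (∫⁻ x, ‖f x‖ₑ ∂μ) ^ 2 ≤ μ univ * ∫⁻ x, ‖f x‖ₑ ^ 2 ∂μ := sq_lintegral_le hf.enorm

/-- The kernel `|w|^{-σ}`. -/
def kernel (σ w : ℝ) : ℝ≥0∞ := ENNReal.ofReal |w| ^ (-σ)

lemma measurable_kernel (σ : ℝ) : Measurable (kernel σ) :=
  (continuous_abs.measurable.ennreal_ofReal).pow_const _

lemma lintegral_kernel_lt_top {σ : ℝ} (hσ : σ < 1) (L : ℝ) :
    ∫⁻ w in Ioo (-L) L, kernel σ w < ∞ := by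
  by_cases hL : L ≤ 0
  · rw [Ioo_eq_empty (by linarith)]; simp
  push Not at hL
  have h1 : IntervalIntegrable (fun w : ℝ => |w| ^ (-σ)) volume 0 L := by
    refine (intervalIntegral.intervalIntegrable_rpow' (r := -σ) (by linarith)).congr ?_
    intro x hx
    rw [uIoc_of_le hL.le] at hx
    simp only [abs_of_pos hx.1]
  have h2 : IntervalIntegrable (fun w : ℝ => |w| ^ (-σ)) volume (-L) 0 := by
    have := ((IntervalIntegrable.iff_comp_neg).1 h1).symm
    simpa using this
  have h3 := (intervalIntegrable_iff_integrableOn_Ioo_of_le (by linarith)).1 (h2.trans h1)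
  have h4 := h3.2
  rw [HasFiniteIntegral] at h4
  refine lt_of_le_of_lt (le_of_eq (lintegral_congr_ae ?_)) h4
  have h5 : ∀ᵐ w : ℝ, w ≠ 0 := by simp [ae_iff]
  filter_upwards [ae_restrict_of_ae h5] with w hw
  rw [kernel, ENNReal.ofReal_rpow_of_pos (abs_pos.2 hw), Real.enorm_eq_ofReal (by positivity)]

lemma lintegral_kernel_sub_le {σ : ℝ} {z : ℝ} (hz : z ∈ Ioo 0 L) :
    ∫⁻ x in Ioo 0 L, kernel σ (x - z) ≤ ∫⁻ w in Ioo (-L) L, kernel σ w := by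
  rw [← lintegral_indicator measurableSet_Ioo, ← lintegral_indicator measurableSet_Ioo,
    ← lintegral_sub_right_eq_self ((Ioo (-L) L).indicator (kernel σ)) z]
  refine lintegral_mono fun x => ?_
  by_cases hx : x ∈ Ioo 0 L
  · rw [indicator_of_mem hx, indicator_of_mem]
    exact ⟨by linarith [hx.1, hz.2], by linarith [hx.2, hz.1]⟩
  · rw [indicator_of_notMem hx]; exact zero_le

variable [hL : Fact (0 < L)]

/-- Cauchy-Schwarz bounds the quotient by `|x-y|^{-2σ}` times the integral of `|p|²` between `x` and
`y`. For `z` between them `|x-z|` and `|y-z|` are at most `|x-y|`, so `|x-y|^{-2σ}` is at most a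
product of kernels in which `x` and `y` are decoupled. -/
lemma gagliardo_integrand_prim_le {σ : ℝ} (hσ : 0 < σ) (e : ℝ × LTwo L) {x y : ℝ}
    (hx : x ∈ Ioo 0 L) (hy : y ∈ Ioo 0 L) :
    ‖ext (prim e) x - ext (prim e) y‖ₑ ^ 2 / ENNReal.ofReal (|x - y| ^ (1 + 2 * σ))
      ≤ ∫⁻ z in Ioo 0 L, ‖e.2 z‖ₑ ^ 2 * (kernel σ (x - z) * kernel σ (y - z)) := by
  rcases eq_or_ne x y with rfl | hxy
  · simp
  have hx' := Ioo_subset_Icc_self hx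
  have hy' := Ioo_subset_Icc_self hy
  have hS : uIoc y x ⊆ Ioo 0 L := by
    intro z hz
    rw [mem_uIoc] at hz
    rcases hz with hz | hz
    · exact ⟨hy.1.trans hz.1, hz.2.trans_lt hx.2⟩
    · exact ⟨hx.1.trans hz.1, hz.2.trans_lt hy.2⟩
  have hr : 0 < |x - y| := abs_pos.2 (sub_ne_zero.2 hxy)
  set R := ENNReal.ofReal |x - y| with hR
  have hR0 : R ≠ 0 := by simp [hR, sub_ne_zero.2 hxy]
  have hRt : R ≠ ∞ := ENNReal.ofReal_ne_top
  have hdiff : ext (prim e) x - ext (prim e) y = ∫ z in y..x, e.2 z := by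
    rw [ext_prim _ hx', ext_prim _ hy', ← intervalIntegral.integral_interval_sub_left
      (intervalIntegrable_sub (memLp_coe e.2) zero_mem hx')
      (intervalIntegrable_sub (memLp_coe e.2) zero_mem hy')]
    ring
  have hnum : ‖ext (prim e) x - ext (prim e) y‖ₑ ^ 2 ≤ R * ∫⁻ z in uIoc y x, ‖e.2 z‖ₑ ^ 2 := by
    rw [hdiff]
    have h1 : ‖∫ z in y..x, e.2 z‖ₑ ≤ ∫⁻ z in uIoc y x, ‖e.2 z‖ₑ := by
      have : ‖∫ z in y..x, e.2 z‖ₑ = ‖∫ z in uIoc y x, e.2 z‖ₑ := by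
        rw [← ofReal_norm, ← ofReal_norm, intervalIntegral.norm_intervalIntegral_eq]
      rw [this]
      exact enorm_integral_le_lintegral_enorm _
    refine (pow_le_pow_left₀ zero_le h1 2).trans ((sq_lintegral_enorm_le
      ((memLp_coe e.2).1.mono_measure (Measure.restrict_mono hS le_rfl))).trans (le_of_eq ?_))
    congr 1
    rw [Measure.restrict_apply MeasurableSet.univ, univ_inter, uIoc, Real.volume_Ioc,
      max_sub_min_eq_abs, hR, abs_sub_comm]
  have hden : ENNReal.ofReal (|x - y| ^ (1 + 2 * σ)) = R ^ (1 + 2 * σ) := by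
    rw [hR, ENNReal.ofReal_rpow_of_pos hr]
  rw [hden]
  calc _ ≤ (R * ∫⁻ z in uIoc y x, ‖e.2 z‖ₑ ^ 2) / R ^ (1 + 2 * σ) := by gcongr
    _ = (∫⁻ z in uIoc y x, ‖e.2 z‖ₑ ^ 2) * (R ^ (-σ) * R ^ (-σ)) := by
      rw [← ENNReal.rpow_add _ _ hR0 hRt, div_eq_mul_inv, ← ENNReal.rpow_neg, mul_comm R,
        mul_assoc]
      congr 1
      nth_rewrite 1 [← ENNReal.rpow_one R]
      rw [← ENNReal.rpow_add _ _ hR0 hRt]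
      congr 1; ring
    _ = ∫⁻ z in uIoc y x, ‖e.2 z‖ₑ ^ 2 * (R ^ (-σ) * R ^ (-σ)) := by
      rw [lintegral_mul_const]
      exact (Lp.stronglyMeasurable e.2).enorm.pow_const 2
    _ ≤ ∫⁻ z in uIoc y x, ‖e.2 z‖ₑ ^ 2 * (kernel σ (x - z) * kernel σ (y - z)) := by
      refine setLIntegral_mono' measurableSet_uIoc fun z hz => ?_
      have hz' := uIoc_subset_uIcc hz
      have hk : ∀ w, |w| ≤ |x - y| → R ^ (-σ) ≤ kernel σ w := fun w hw => by
        rw [kernel, ENNReal.rpow_neg, ENNReal.rpow_neg]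
        exact ENNReal.inv_le_inv.2 (ENNReal.rpow_le_rpow (ENNReal.ofReal_le_ofReal hw) hσ.le)
      gcongr
      · exact hk _ (abs_sub_right_of_mem_uIcc hz')
      · refine hk _ ?_
        have := abs_sub_left_of_mem_uIcc hz'
        rwa [abs_sub_comm] at this
    _ ≤ _ := lintegral_mono_set hS

/-- By Tonelli, `x` and `y` are integrated out for fixed `z`, and each kernel contributes at most
its integral over `(-L,L)`, which is finite when `σ < 1`. -/
lemma gagliardoSq_prim_le {σ : ℝ} (hσ : 0 < σ) (e : ℝ × LTwo L) :
    gagliardoSq L σ (ext (prim e))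
      ≤ (∫⁻ w in Ioo (-L) L, kernel σ w) ^ 2 * ‖e.2‖ₑ ^ 2 := by
  unfold gagliardoSq
  rw [if_neg hσ.ne']
  set K := ∫⁻ w in Ioo (-L) L, kernel σ w with hK
  have hp : Measurable fun z => ‖e.2 z‖ₑ ^ 2 := (Lp.stronglyMeasurable e.2).enorm.pow_const 2
  have hk := measurable_kernel σ
  have hk2 : Measurable fun q : ℝ × ℝ => kernel σ (q.1 - q.2) :=
    hk.comp (measurable_fst.sub measurable_snd)
  calc _ ≤ ∫⁻ x in Ioo 0 L, ∫⁻ y in Ioo 0 L, ∫⁻ z in Ioo 0 L,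
          ‖e.2 z‖ₑ ^ 2 * (kernel σ (x - z) * kernel σ (y - z)) :=
        setLIntegral_mono' measurableSet_Ioo fun x hx =>
          setLIntegral_mono' measurableSet_Ioo fun y hy => gagliardo_integrand_prim_le hσ e hx hy
    _ = ∫⁻ x in Ioo 0 L, ∫⁻ z in Ioo 0 L, ∫⁻ y in Ioo 0 L,
          ‖e.2 z‖ₑ ^ 2 * (kernel σ (x - z) * kernel σ (y - z)) := by
        refine lintegral_congr fun x => lintegral_lintegral_swap ?_
        exact ((hp.comp measurable_snd).mul
          ((hk.comp (measurable_const.sub measurable_snd)).mul hk2)).aemeasurable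
    _ = ∫⁻ x in Ioo 0 L, ∫⁻ z in Ioo 0 L,
          ‖e.2 z‖ₑ ^ 2 * (kernel σ (x - z) * ∫⁻ y in Ioo 0 L, kernel σ (y - z)) := by
        refine lintegral_congr fun x => lintegral_congr fun z => ?_
        have hm : Measurable fun y => kernel σ (y - z) :=
          hk.comp (measurable_id.sub measurable_const)
        rw [lintegral_const_mul _ (hm.const_mul _), lintegral_const_mul _ hm]
    _ ≤ ∫⁻ x in Ioo 0 L, ∫⁻ z in Ioo 0 L, ‖e.2 z‖ₑ ^ 2 * (kernel σ (x - z) * K) := by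
        refine lintegral_mono fun x => setLIntegral_mono' measurableSet_Ioo fun z hz => ?_
        gcongr
        exact lintegral_kernel_sub_le hz
    _ = ∫⁻ z in Ioo 0 L, ∫⁻ x in Ioo 0 L, ‖e.2 z‖ₑ ^ 2 * (kernel σ (x - z) * K) := by
        refine lintegral_lintegral_swap ?_
        exact ((hp.comp measurable_snd).mul (hk2.mul_const K)).aemeasurable
    _ = ∫⁻ z in Ioo 0 L, ‖e.2 z‖ₑ ^ 2 * ((∫⁻ x in Ioo 0 L, kernel σ (x - z)) * K) := by
        refine lintegral_congr fun z => ?_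
        have hm : Measurable fun y => kernel σ (y - z) :=
          hk.comp (measurable_id.sub measurable_const)
        rw [lintegral_const_mul _ (hm.mul_const _), lintegral_mul_const _ hm]
    _ ≤ ∫⁻ z in Ioo 0 L, ‖e.2 z‖ₑ ^ 2 * (K * K) := by
        refine setLIntegral_mono' measurableSet_Ioo fun z hz => ?_
        gcongr
        exact lintegral_kernel_sub_le hz
    _ = K ^ 2 * ‖e.2‖ₑ ^ 2 := by
        rw [lintegral_mul_const _ hp, ← normSq_eq_enorm_sq, normSq, sq K, mul_comm]

end

noncomputable section

/-! ### Banach spaces modelling Sobolev spaces -/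

variable {L : ℝ} [hL : Fact (0 < L)]

section Models

variable {Z : Type*} [NormedAddCommGroup Z] [NormedSpace ℝ Z]

/-- The function `x ↦ a + ∫₀ˣ j z`. -/
def primOf (j : Z →L[ℝ] LTwo L) : ℝ × Z →L[ℝ] ContSpace L :=
  prim ∘L ((ContinuousLinearMap.id ℝ ℝ).prodMap j)

/-- The class in `L²(0,L)` of `x ↦ a + ∫₀ˣ j z`. -/
def lift (j : Z →L[ℝ] LTwo L) : ℝ × Z →L[ℝ] LTwo L := inc ∘L primOf j

lemma lift_apply (j : Z →L[ℝ] LTwo L) (z : ℝ × Z) : lift j z = inc (prim (z.1, j z.2)) := rfl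

/-- `Z` embeds continuously into `H^s(0,L)`. -/
def EmbedsInto (j : Z →L[ℝ] LTwo L) (s : ℝ) : Prop :=
  ∃ C : ℝ≥0, ∀ z, MemSobolev L s (j z) ∧ sobSq L s (j z) ≤ C * ‖z‖ₑ ^ 2

/-- `H^s(0,L)` embeds continuously into `Z`. -/
def EmbedsFrom (j : Z →L[ℝ] LTwo L) (s : ℝ) : Prop :=
  (∀ f, MemSobolev L s f → ∃ z, j z =ᵐ[mu L] f) ∧
    ∃ C : ℝ≥0, ∀ z, MemSobolev L s (j z) → ‖z‖ₑ ^ 2 ≤ C * sobSq L s (j z)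

lemma enorm_map_sq_le {Z' : Type*} [NormedAddCommGroup Z'] [NormedSpace ℝ Z'] (j : Z →L[ℝ] Z')
    (z : Z) : ‖j z‖ₑ ^ 2 ≤ (‖j‖₊ ^ 2 : ℝ≥0) * ‖z‖ₑ ^ 2 := by
  rw [ENNReal.coe_pow, ← mul_pow]
  gcongr
  simp only [enorm_eq_nnnorm]
  exact_mod_cast j.le_opNNNorm z

lemma weakDeriv_lift (j : Z →L[ℝ] LTwo L) (z : ℝ × Z) :
    HasWeakDeriv L (lift j z) (j z.2) := hasWeakDeriv_inc_prim (z.1, j z.2)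

omit [NormedSpace ℝ Z] in
lemma enorm_snd_le (z : ℝ × Z) : ‖z.2‖ₑ ≤ ‖z‖ₑ := by
  simp only [enorm_eq_nnnorm]
  exact_mod_cast (norm_snd_le z)

lemma EmbedsInto.lift {j : Z →L[ℝ] LTwo L} {s : ℝ} (hs : 0 ≤ s) (h : EmbedsInto j s) :
    EmbedsInto (lift j) (s + 1) := by
  obtain ⟨C, hC⟩ := h
  refine ⟨‖BBM.lift j‖₊ ^ 2 + C, fun z => ?_⟩
  have hd := weakDeriv_lift j z
  refine ⟨(memSobolev_add_one hs _).2 ⟨memLp_coe _, ⟨_, hd⟩,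
    memSobolev_congr hs hd.weakDeriv_ae.symm (hC z.2).1⟩, ?_⟩
  rw [sobSq_add_one hs, sobSq_congr hs hd.weakDeriv_ae, normSq_eq_enorm_sq, ENNReal.coe_add,
    add_mul]
  refine add_le_add (enorm_map_sq_le _ z) ((hC z.2).2.trans ?_)
  gcongr
  exact enorm_snd_le z

/-- The constant function equal to the value at `0` is `f` minus the primitive of `f'`, so its `L²`
norm, a fixed positive multiple of that value, is bounded by the norms of `f` and `f'`. -/
lemma enorm_fst_sq_le (j : Z →L[ℝ] LTwo L) : ∃ C : ℝ≥0, ∀ z : ℝ × Z,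
    ‖z.1‖ₑ ^ 2 ≤ C * (‖lift j z‖ₑ ^ 2 + ‖j z.2‖ₑ ^ 2) := by
  have hL0 := hL.out
  set A := ‖(inc : ContSpace L →L[ℝ] LTwo L)‖ * ‖(prim : ℝ × LTwo L →L[ℝ] ContSpace L)‖ with hA
  have hA0 : 0 ≤ A := by positivity
  have hone : 0 < ‖inc (prim ((1 : ℝ), (0 : LTwo L)))‖ := by
    rw [norm_pos_iff]
    intro h
    have h1 := inc_injective (h.trans (map_zero inc).symm)
    have h2 := congrArg (fun u => ext u 0) h1
    simp [ext_prim_zero] at h2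
  set m := ‖inc (prim ((1 : ℝ), (0 : LTwo L)))‖ with hm
  have key : ∀ z : ℝ × Z, |z.1| ≤ m⁻¹ * (‖lift j z‖ + A * ‖j z.2‖) := fun z => by
    rw [← div_eq_inv_mul, le_div_iff₀ hone]
    have h1 : z.1 • inc (prim ((1 : ℝ), (0 : LTwo L)))
        = lift j z - inc (prim (0, j z.2)) := by
      rw [lift_apply, ← map_smul, ← map_smul, ← map_sub, ← map_sub]
      simp
    rw [hm, ← Real.norm_eq_abs, ← norm_smul, h1]
    refine (norm_sub_le _ _).trans (add_le_add le_rfl ?_)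
    refine (inc.le_opNorm _).trans ?_
    rw [hA, mul_assoc]
    gcongr
    refine (prim.le_opNorm _).trans ?_
    gcongr
    simp [Prod.norm_def]
  refine ⟨(m⁻¹ ^ 2 * (2 + 2 * A ^ 2)).toNNReal, fun z => ?_⟩
  have h : ∀ {E : Type _} [NormedAddCommGroup E] (x : E), ‖x‖ₑ ^ 2 = ENNReal.ofReal (‖x‖ ^ 2) :=
    fun x => by rw [ENNReal.ofReal_pow (norm_nonneg _), ofReal_norm]
  rw [h, h, h, ← ENNReal.ofReal_add (by positivity) (by positivity)]
  change _ ≤ ENNReal.ofReal _ * _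
  rw [← ENNReal.ofReal_mul (by positivity)]
  refine ENNReal.ofReal_le_ofReal ?_
  have h2 := pow_le_pow_left₀ (abs_nonneg z.1) (key z) 2
  rw [Real.norm_eq_abs]
  refine h2.trans ?_
  clear_value A m
  rw [mul_pow, mul_assoc]
  refine mul_le_mul_of_nonneg_left ?_ (by positivity)
  nlinarith [sq_nonneg (‖lift j z‖ - A * ‖j z.2‖), sq_nonneg (A * ‖lift j z‖),
    sq_nonneg (‖j z.2‖)]

lemma EmbedsFrom.lift {j : Z →L[ℝ] LTwo L} {s : ℝ} (hs : 0 ≤ s) (h : EmbedsFrom j s) :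
    EmbedsFrom (lift j) (s + 1) := by
  obtain ⟨h1, C, hC⟩ := h
  obtain ⟨C', hC'⟩ := enorm_fst_sq_le j
  constructor
  · intro f hf
    rw [memSobolev_add_one hs] at hf
    obtain ⟨hf1, hf2, hf3⟩ := hf
    obtain ⟨z, hz⟩ := h1 _ hf3
    obtain ⟨a, ha⟩ := exists_prim_of_hasWeakDeriv hf1
      ((hasWeakDeriv_weakDeriv hf2).congr_right hz.symm)
    exact ⟨(a, z), (inc_ae _).trans ha.symm⟩
  · refine ⟨C' + C, fun z hz => ?_⟩
    rw [memSobolev_add_one hs] at hz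
    have hd := weakDeriv_lift j z
    have h2 := hC z.2 (memSobolev_congr hs hd.weakDeriv_ae hz.2.2)
    have h3 : ‖z‖ₑ ^ 2 ≤ ‖z.1‖ₑ ^ 2 + ‖z.2‖ₑ ^ 2 := by
      have : ‖z‖ₑ = max ‖z.1‖ₑ ‖z.2‖ₑ := by
        simp only [enorm_eq_nnnorm]
        rw [← ENNReal.coe_max]; rfl
      rw [this]
      rcases max_choice ‖z.1‖ₑ ‖z.2‖ₑ with h | h <;> rw [h]
      · exact le_self_add
      · exact le_add_self
    rw [sobSq_add_one hs, sobSq_congr hs hd.weakDeriv_ae, normSq_eq_enorm_sq, ENNReal.coe_add,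
      add_mul]
    refine h3.trans (add_le_add ((hC' z).trans ?_) (h2.trans ?_))
    · gcongr
      rw [← normSq_eq_enorm_sq (j z.2)]
      exact normSq_le_sobSq hs _
    · gcongr
      exact le_add_self

/-- A continuous `u` in `H^s` comes from some `z`, and injectivity of `inc` forces `i z = u`; the
bound on `z` passes to `u`. -/
lemma EmbedsFrom.of_comp_inc {i : Z →L[ℝ] ContSpace L} {s : ℝ} 
    (h : EmbedsFrom (inc ∘L i) s) : EmbedsFrom (inc : ContSpace L →L[ℝ] LTwo L) s := by
  obtain ⟨h1, C, hC⟩ := h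
  refine ⟨fun f hf => ?_, ‖i‖₊ ^ 2 * C, fun u hu => ?_⟩
  · obtain ⟨z, hz⟩ := h1 f hf
    exact ⟨i z, hz⟩
  · obtain ⟨z, hz⟩ := h1 _ hu
    have hz' : i z = u := inc_injective (Lp.ext hz)
    rw [← hz'] at hu ⊢
    refine (enorm_map_sq_le i z).trans ?_
    rw [ENNReal.coe_mul, mul_assoc]
    gcongr
    exact hC z hu

end Models

omit hL in
lemma embedsFrom_id {s : ℝ} (hs : 0 ≤ s) :
    EmbedsFrom (ContinuousLinearMap.id ℝ (LTwo L)) s := by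
  refine ⟨fun f hf => ⟨hf.memLp.toLp f, hf.memLp.coeFn_toLp⟩, 1, fun z _ => ?_⟩
  rw [ENNReal.coe_one, one_mul, ← normSq_eq_enorm_sq]
  exact normSq_le_sobSq hs _

omit hL in
lemma embedsInto_id : EmbedsInto (ContinuousLinearMap.id ℝ (LTwo L)) 0 := by
  refine ⟨1, fun z => ⟨(memSobolev_of_lt_one le_rfl one_pos _).2 ⟨memLp_coe z, ?_⟩, ?_⟩⟩
  · simp [gagliardoSq]
  · rw [sobSq_of_lt_one le_rfl one_pos]
    simp only [gagliardoSq, if_true, add_zero, ENNReal.coe_one, one_mul]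
    exact (normSq_eq_enorm_sq z).le

/-- The space `H^1(0,L)`, as pairs of a value at `0` and a derivative. -/
abbrev HOne (L : ℝ) : Type := ℝ × LTwo L

/-- The space `H^2(0,L)`. -/
abbrev HTwo (L : ℝ) : Type := ℝ × HOne L

/-- The space `H^3(0,L)`. -/
abbrev HThree (L : ℝ) : Type := ℝ × HTwo L

/-- The inclusion of `H^1` into `L²`. -/
def hOne : HOne L →L[ℝ] LTwo L := lift (ContinuousLinearMap.id ℝ (LTwo L))

/-- The inclusion of `H^2` into `L²`. -/
def hTwo : HTwo L →L[ℝ] LTwo L := lift hOne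

/-- The inclusion of `H^3` into `L²`. -/
def hThree : HThree L →L[ℝ] LTwo L := lift hTwo

lemma hOne_apply (e : HOne L) : hOne e = inc (prim e) := rfl

lemma embedsInto_hOne {s : ℝ} (hs : 0 < s) (hs1 : s ≤ 1) :
    EmbedsInto (hOne : HOne L →L[ℝ] LTwo L) s := by
  rcases hs1.lt_or_eq with hs1 | rfl
  · have hK := lintegral_kernel_lt_top hs1 L
    lift ∫⁻ w in Ioo (-L) L, kernel s w to ℝ≥0 using hK.ne with K hKdef
    refine ⟨‖(hOne : HOne L →L[ℝ] LTwo L)‖₊ ^ 2 + K ^ 2, fun z => ?_⟩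
    have hg : gagliardoSq L s (hOne z) ≤ (K ^ 2 : ℝ≥0) * ‖z‖ₑ ^ 2 := by
      rw [hOne_apply, gagliardoSq_congr (inc_ae _)]
      refine (gagliardoSq_prim_le hs z).trans ?_
      rw [← hKdef, ENNReal.coe_pow]
      gcongr
      exact enorm_snd_le z
    rw [memSobolev_of_lt_one hs.le hs1, sobSq_of_lt_one hs.le hs1]
    refine ⟨⟨memLp_coe _, hg.trans_lt ?_⟩, ?_⟩
    · exact ENNReal.mul_lt_top ENNReal.coe_lt_top (ENNReal.pow_lt_top enorm_lt_top)
    · rw [ENNReal.coe_add, add_mul, normSq_eq_enorm_sq]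
      exact add_le_add (enorm_map_sq_le _ z) hg
  · have := (embedsInto_id (L := L)).lift le_rfl
    rwa [zero_add] at this

lemma embedsInto_hTwo {s : ℝ} (hs : 1 < s) (hs1 : s ≤ 2) :
    EmbedsInto (hTwo : HTwo L →L[ℝ] LTwo L) s := by
  have := (embedsInto_hOne (L := L) (s := s - 1) (by linarith) (by linarith)).lift (by linarith)
  rwa [sub_add_cancel] at this

lemma embedsInto_hThree {s : ℝ} (hs : 2 < s) (hs1 : s ≤ 3) :
    EmbedsInto (hThree : HThree L →L[ℝ] LTwo L) s := by
  have := (embedsInto_hTwo (L := L) (s := s - 1) (by linarith) (by linarith)).lift (by linarith)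
  rwa [sub_add_cancel] at this

lemma embedsFrom_hOne {s : ℝ} (hs : 1 ≤ s) :
    EmbedsFrom (hOne : HOne L →L[ℝ] LTwo L) s := by
  have := (embedsFrom_id (L := L) (s := s - 1) (by linarith)).lift (by linarith)
  rwa [sub_add_cancel] at this

lemma embedsFrom_hTwo {s : ℝ} (hs : 2 ≤ s) :
    EmbedsFrom (hTwo : HTwo L →L[ℝ] LTwo L) s := by
  have := (embedsFrom_hOne (L := L) (s := s - 1) (by linarith)).lift (by linarith)
  rwa [sub_add_cancel] at this

/-! ### The embedding of `H^s(0,L)` into `C[0,L]` for `1/2 < s < 1` -/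

omit hL in
-- Cleared of denominators, the difference of the means over nested intervals is the double integral
-- of `f x - f y`. Two uses of Cauchy-Schwarz and `|x-y| ≤ b-a` bring in the Gagliardo seminorm.
lemma lintegral_average_sub_le {σ : ℝ} (hσ : 0 < σ) (f : LTwo L) {a b a' b' : ℝ}
    (ha : 0 ≤ a) (haa' : a ≤ a') (hab' : a' ≤ b') (hb'b : b' ≤ b) (hb : b ≤ L) :
    ENNReal.ofReal (((b' - a') * (∫ x in a..b, f x) - (b - a) * ∫ x in a'..b', f x) ^ 2)
      ≤ ENNReal.ofReal ((b - a) * (b' - a') * (b - a) ^ (1 + 2 * σ)) * gagliardoSq L σ f := by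
  have hab : a ≤ b := haa'.trans (hab'.trans hb'b)
  have hfi : Integrable f (mu L) := integrable_of_memLp (memLp_coe f)
  have hsub : Ioo a b ⊆ Ioo 0 L := Ioo_subset_Ioo ha hb
  have hsub' : Ioo a' b' ⊆ Ioo a b := Ioo_subset_Ioo haa' hb'b
  have hf1 : IntegrableOn f (Ioo a b) := IntegrableOn.mono_set hfi hsub
  have hf2 : IntegrableOn f (Ioo a' b') := hf1.mono_set hsub'
  have hfm : Measurable f := (Lp.stronglyMeasurable f).measurable
  have h1 : (b' - a') * (∫ x in a..b, f x) - (b - a) * ∫ x in a'..b', f x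
      = ∫ x in Ioo a b, ∫ y in Ioo a' b', (f x - f y) := by
    have : ∀ x, ∫ y in Ioo a' b', (f x - f y) = (b' - a') * f x - ∫ y in Ioo a' b', f y := by
      intro x
      rw [integral_sub (integrable_const _) hf2]
      simp [hab']
    simp only [this]
    rw [integral_sub (hf1.const_mul _) (integrable_const _), integral_const_mul,
      intervalIntegral.integral_of_le hab, intervalIntegral.integral_of_le hab',
      ← restrict_Ioo_eq_restrict_Ioc, ← restrict_Ioo_eq_restrict_Ioc]
    simp [hab]
  have hm2 : Measurable fun q : ℝ × ℝ => ‖f q.1 - f q.2‖ₑ :=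
    ((hfm.comp measurable_fst).sub (hfm.comp measurable_snd)).enorm
  have h2 : ENNReal.ofReal ((∫ x in Ioo a b, ∫ y in Ioo a' b', (f x - f y)) ^ 2)
      ≤ (∫⁻ x in Ioo a b, ∫⁻ y in Ioo a' b', ‖f x - f y‖ₑ) ^ 2 := by
    rw [← sq_abs, ENNReal.ofReal_pow (abs_nonneg _), ← Real.enorm_eq_ofReal_abs]
    gcongr
    refine (enorm_integral_le_lintegral_enorm _).trans (lintegral_mono fun x => ?_)
    exact enorm_integral_le_lintegral_enorm _
  have h3 : (∫⁻ x in Ioo a b, ∫⁻ y in Ioo a' b', ‖f x - f y‖ₑ) ^ 2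
      ≤ ENNReal.ofReal (b - a) * ∫⁻ x in Ioo a b, ENNReal.ofReal (b' - a') *
        ∫⁻ y in Ioo a' b', ‖f x - f y‖ₑ ^ 2 := by
    refine (sq_lintegral_le (hm2.lintegral_prod_right').aemeasurable).trans ?_
    rw [Measure.restrict_apply MeasurableSet.univ, univ_inter, Real.volume_Ioo]
    gcongr with x
    refine (sq_lintegral_le (Measurable.comp (f := Prod.mk x) hm2
      measurable_prodMk_left).aemeasurable).trans ?_
    rw [Measure.restrict_apply MeasurableSet.univ, univ_inter, Real.volume_Ioo]
    rfl
  have h4 : ∫⁻ x in Ioo a b, ∫⁻ y in Ioo a' b', ‖f x - f y‖ₑ ^ 2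
      ≤ ENNReal.ofReal ((b - a) ^ (1 + 2 * σ)) * gagliardoSq L σ f := by
    rw [gagliardoSq, if_neg hσ.ne', ← lintegral_const_mul' _ _ ENNReal.ofReal_ne_top]
    refine le_trans ?_ (lintegral_mono_set hsub)
    refine setLIntegral_mono' measurableSet_Ioo fun x hx => ?_
    rw [← lintegral_const_mul' _ _ ENNReal.ofReal_ne_top]
    refine le_trans ?_ (lintegral_mono_set (hsub'.trans hsub))
    refine setLIntegral_mono' measurableSet_Ioo fun y hy => ?_
    rcases eq_or_ne x y with rfl | hxy
    · simp
    have hr : 0 < |x - y| := abs_pos.2 (sub_ne_zero.2 hxy)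
    have hle : |x - y| ≤ b - a := by
      rw [abs_le]; constructor <;> linarith [hx.1, hx.2, (hsub' hy).1, (hsub' hy).2]
    rw [← mul_div_assoc, ENNReal.le_div_iff_mul_le (Or.inl (by
      rw [Ne, ENNReal.ofReal_eq_zero, not_le]; positivity)) (Or.inl ENNReal.ofReal_ne_top), mul_comm]
    exact mul_le_mul_left (ENNReal.ofReal_le_ofReal
      (Real.rpow_le_rpow hr.le hle (by linarith))) _
  rw [h1]
  refine h2.trans (h3.trans ?_)
  rw [lintegral_const_mul' _ _ ENNReal.ofReal_ne_top, ← mul_assoc,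
    ← ENNReal.ofReal_mul (by linarith)]
  refine (mul_le_mul_right h4 _).trans (le_of_eq ?_)
  rw [← mul_assoc, ← ENNReal.ofReal_mul (by nlinarith)]

/-- Difference quotients along shrinking intervals containing a point of differentiability. -/
lemma tendsto_slope_of_straddle {F : ℝ → ℝ} {l x : ℝ} (h : HasDerivAt F l x) {a b : ℕ → ℝ}
    (ha : ∀ n, a n ≤ x) (hb : ∀ n, x ≤ b n) (hab : ∀ n, a n < b n)
    (hlim : Tendsto (fun n => b n - a n) atTop (𝓝 0)) :
    Tendsto (fun n => (F (b n) - F (a n)) / (b n - a n)) atTop (𝓝 l) := by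
  have h1 := hasDerivAt_iff_isLittleO.1 h
  have hta : Tendsto a atTop (𝓝 x) := by
    rw [tendsto_iff_dist_tendsto_zero]
    refine squeeze_zero (fun _ => dist_nonneg) (fun n => ?_) hlim
    rw [Real.dist_eq, abs_le]; constructor <;> linarith [ha n, hb n, hab n]
  have htb : Tendsto b atTop (𝓝 x) := by
    rw [tendsto_iff_dist_tendsto_zero]
    refine squeeze_zero (fun _ => dist_nonneg) (fun n => ?_) hlim
    rw [Real.dist_eq, abs_le]; constructor <;> linarith [ha n, hb n, hab n]
  have h2 := (h1.comp_tendsto htb).trans_isBigO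
    (Asymptotics.IsBigO.of_bound (g := fun n => b n - a n) 1 (Eventually.of_forall fun n => by
      simp only [Function.comp, Real.norm_eq_abs, one_mul]
      rw [abs_of_nonneg (by linarith [hb n]), abs_of_nonneg (by linarith [hab n])]
      linarith [ha n]))
  have h3 := (h1.comp_tendsto hta).trans_isBigO
    (Asymptotics.IsBigO.of_bound (g := fun n => b n - a n) 1 (Eventually.of_forall fun n => by
      simp only [Function.comp, Real.norm_eq_abs, one_mul]
      rw [abs_of_nonpos (by linarith [ha n]), abs_of_nonneg (by linarith [hab n])]
      linarith [hb n]))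
  have h4 := (h2.sub h3).tendsto_div_nhds_zero
  have h5 := h4.add_const l
  rw [zero_add] at h5
  refine h5.congr fun n => ?_
  have : b n - a n ≠ 0 := by linarith [hab n]
  simp only [Function.comp, smul_eq_mul]
  field_simp
  ring

end

noncomputable section

variable {L : ℝ} [hL : Fact (0 < L)]

/-- The average of `f` over the interval `(1-ε)x + ε[0,L]`, as a function of `x`. -/
def shrinkAverage (f : LTwo L) (ε : ℝ) (x : ℝ) : ℝ :=
  ((∫ y in (0:ℝ)..((1 - ε) * x + ε * L), f y) - ∫ y in (0:ℝ)..((1 - ε) * x), f y) / (ε * L)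

lemma shrink_mem {ε x : ℝ} (hε : 0 ≤ ε) (hε1 : ε ≤ 1) (hx : x ∈ Icc 0 L) :
    (1 - ε) * x ∈ Icc 0 L ∧ (1 - ε) * x + ε * L ∈ Icc 0 L := by
  have hL0 := hL.out
  obtain ⟨h1, h2⟩ := hx
  refine ⟨⟨by nlinarith, by nlinarith⟩, ⟨by nlinarith [mul_nonneg hε hL0.le], by nlinarith⟩⟩

lemma continuousOn_shrinkAverage (f : LTwo L) {ε : ℝ} (hε : 0 ≤ ε) (hε1 : ε ≤ 1) :
    ContinuousOn (shrinkAverage f ε) (Icc 0 L) := by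
  have h := continuousOn_primitive (memLp_coe f)
  refine ((h.comp (f := fun x => (1 - ε) * x + ε * L) (by fun_prop)
    fun x hx => (shrink_mem hε hε1 hx).2).sub (h.comp (f := fun x => (1 - ε) * x) (by fun_prop)
    fun x hx => (shrink_mem hε hε1 hx).1)).div_const _

/-- The averaging intervals never leave `[0,L]`, so endpoints need no extension, and they are nested
in `ε`. The previous estimate with lengths `ℓ = εL` and `ℓ/2` gives `2 G ℓ^{2σ-1}` for the square.
-/
lemma abs_shrinkAverage_sub_le {σ : ℝ} (hσ : 0 < σ) {f : LTwo L} {G : ℝ} (hG : 0 ≤ G)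
    (hf : gagliardoSq L σ f ≤ ENNReal.ofReal G) {ε x : ℝ} (hε : 0 < ε) (hε1 : ε ≤ 1)
    (hx : x ∈ Icc 0 L) :
    |shrinkAverage f ε x - shrinkAverage f (ε / 2) x| ≤ √(2 * G * (ε * L) ^ (2 * σ - 1)) := by
  have hL0 := hL.out
  set a := (1 - ε) * x with ha
  set b := (1 - ε) * x + ε * L with hb
  set a' := (1 - ε / 2) * x with ha'
  set b' := (1 - ε / 2) * x + ε / 2 * L with hb'
  obtain ⟨m1, m2⟩ := shrink_mem hε.le hε1 hx
  obtain ⟨m3, m4⟩ := shrink_mem (ε := ε / 2) (by linarith) (by linarith) hx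
  have hℓ : 0 < ε * L := by positivity
  have hba : b - a = ε * L := by rw [hb, ha]; ring
  have hba' : b' - a' = ε * L / 2 := by rw [hb', ha']; ring
  have key := lintegral_average_sub_le hσ f (a := a) (b := b) (a' := a') (b' := b') m1.1
    (by rw [ha, ha']; nlinarith [mul_nonneg hε.le hx.1]) (by linarith)
    (by rw [hb, hb']; nlinarith [mul_nonneg hε.le (sub_nonneg.2 hx.2)]) m2.2
  rw [hba, hba'] at key
  have key2 := key.trans (mul_le_mul_right hf _)
  rw [← ENNReal.ofReal_mul (by positivity), ENNReal.ofReal_le_ofReal_iff (by positivity)] at key2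
  have hfi : ∀ {y}, y ∈ Icc 0 L → IntervalIntegrable f volume 0 y :=
    fun hy => intervalIntegrable_sub (memLp_coe f) zero_mem hy
  have hdiff : shrinkAverage f ε x - shrinkAverage f (ε / 2) x
      = (ε * L / 2 * (∫ x in a..b, f x) - ε * L * ∫ x in a'..b', f x) / (ε * L * (ε * L / 2)) := by
    unfold shrinkAverage
    rw [intervalIntegral.integral_interval_sub_left (hfi m2) (hfi m1),
      intervalIntegral.integral_interval_sub_left (hfi m4) (hfi m3)]
    change (∫ x in a..b, f x) / (ε * L) - (∫ x in a'..b', f x) / (ε / 2 * L) = _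
    generalize (∫ x in a..b, f x) = I
    generalize (∫ x in a'..b', f x) = I'
    field_simp
  refine Real.abs_le_sqrt ?_
  rw [hdiff, div_pow, div_le_iff₀ (by positivity)]
  refine key2.trans (le_of_eq ?_)
  have : (ε * L) ^ (1 + 2 * σ) = (ε * L) ^ (2 * σ - 1) * (ε * L) ^ 2 := by
    rw [← Real.rpow_natCast, ← Real.rpow_add hℓ]
    congr 1; push_cast; ring
  rw [this]
  ring

/-- Morrey's embedding of `H^σ(0,L)` into `C[0,L]` for `σ > 1/2`. -/
lemma exists_inc_eq {σ : ℝ} (hσ : 1 / 2 < σ) : ∃ C : ℝ, 0 ≤ C ∧ ∀ (f : LTwo L) (G : ℝ), 0 ≤ G →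
    gagliardoSq L σ f ≤ ENNReal.ofReal G →
      ∃ u : ContSpace L, inc u = f ∧ ‖u‖ ≤ C * (‖f‖ + √G) := by
  have hL0 := hL.out
  -- Successive dyadic averages differ by a geometric sequence of ratio `√r`, which is below `1`
  -- exactly because `σ > 1/2`; `D` comes from summing the series.
  set r : ℝ := (1 / 2) ^ (2 * σ - 1) with hr
  have hr0 : 0 < r := by positivity
  have hr1 : r < 1 := Real.rpow_lt_one (by norm_num) (by norm_num) (by linarith)
  have hq1 : √r < 1 := by rw [Real.sqrt_lt' one_pos]; simpa using hr1
  set D : ℝ := √(2 * L ^ (2 * σ - 1)) / (1 - √r) with hD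
  have hD0 : 0 ≤ D := div_nonneg (Real.sqrt_nonneg _) (by linarith)
  refine ⟨√L / L + D, by positivity, fun f G hG hf => ?_⟩
  have hε : ∀ n : ℕ, 0 < ((1:ℝ) / 2) ^ n := fun n => by positivity
  have hε1 : ∀ n : ℕ, ((1:ℝ) / 2) ^ n ≤ 1 := fun n => pow_le_one₀ (by norm_num) (by norm_num)
  set U : ℕ → ContSpace L := fun n =>
    restr (shrinkAverage f ((1 / 2) ^ n)) (continuousOn_shrinkAverage f (hε n).le (hε1 n)) with hU
  have hUx : ∀ n, ∀ x ∈ Icc 0 L, ext (U n) x = shrinkAverage f ((1 / 2) ^ n) x :=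
    fun n x hx => ext_restr _ _ hx
  have hgeo : ∀ n, dist (U n) (U (n + 1)) ≤ (√(2 * L ^ (2 * σ - 1)) * √G) * √r ^ n := by
    intro n
    rw [dist_eq_norm]
    refine norm_le_of_ext (by positivity) fun x hx => ?_
    rw [ext_sub, hUx n x hx, hUx (n + 1) x hx, pow_succ, mul_one_div]
    refine (abs_shrinkAverage_sub_le (by linarith) hG hf (hε n) (hε1 n) hx).trans (le_of_eq ?_)
    have hpow : √r ^ n = √(r ^ n) :=
      ((Real.sqrt_eq_iff_eq_sq (by positivity) (by positivity)).2 (by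
        rw [← pow_mul, mul_comm, pow_mul, Real.sq_sqrt hr0.le])).symm
    rw [hpow, ← Real.sqrt_mul (by positivity), ← Real.sqrt_mul (by positivity),
      Real.mul_rpow (hε n).le hL0.le, ← Real.rpow_natCast, ← Real.rpow_mul (by norm_num),
      mul_comm (n : ℝ), Real.rpow_mul (by norm_num), Real.rpow_natCast, ← hr]
    congr 1; ring
  obtain ⟨u, hu⟩ := cauchySeq_tendsto_of_complete (cauchySeq_of_le_geometric _ _ hq1 hgeo)
  refine ⟨u, ?_, ?_⟩
  · refine Lp.ext ?_
    -- Lebesgue differentiation identifies the uniform limit with `f` almost everywhere.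
    have hd := (intervalIntegrable_of_memLp (memLp_coe f)).ae_hasDerivAt_integral
    filter_upwards [inc_ae u, ae_restrict_of_ae hd, ae_mem_Ioo] with x h1 h2 hx
    have hx' := Ioo_subset_Icc_self hx
    rw [h1]
    have h3 := h2 (by rwa [uIcc_of_le hL0.le]) 0 left_mem_uIcc
    have h4 : Tendsto (fun n : ℕ => ((1:ℝ) / 2) ^ n * L) atTop (𝓝 0) := by
      simpa using (tendsto_pow_atTop_nhds_zero_of_lt_one (r := (1:ℝ) / 2) (by norm_num)
        (by norm_num)).mul_const L
    have h5 := tendsto_slope_of_straddle h3 (a := fun n => (1 - (1 / 2) ^ n) * x)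
      (b := fun n => (1 - (1 / 2) ^ n) * x + (1 / 2) ^ n * L)
      (fun n => by nlinarith [mul_pos (hε n) hx.1])
      (fun n => by nlinarith [mul_pos (hε n) (sub_pos.2 hx.2)])
      (fun n => by linarith [mul_pos (hε n) hL0]) (by simpa using h4)
    have h6 : Tendsto (fun n => ext (U n) x) atTop (𝓝 (f x)) := by
      refine h5.congr fun n => ?_
      rw [hUx n x hx', shrinkAverage]
      congr 1; ring
    have h7 : Tendsto (fun n => ext (U n) x) atTop (𝓝 (ext u x)) := by
      simp only [ext_of_mem _ hx']
      exact ((continuous_eval_const (⟨x, hx'⟩ : Icc 0 L)).tendsto u).comp hu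
    exact tendsto_nhds_unique h7 h6
  · have h1 := dist_le_of_le_geometric_of_tendsto₀ _ _ hq1 hgeo hu
    have h2 : ‖U 0‖ ≤ √L / L * ‖f‖ := by
      refine norm_le_of_ext (by positivity) fun x hx => ?_
      rw [hUx 0 x hx, shrinkAverage]
      simp only [pow_zero, sub_self, zero_mul, zero_add, one_mul, intervalIntegral.integral_same,
        sub_zero]
      rw [abs_div, abs_of_pos hL0, div_mul_eq_mul_div]
      gcongr
      exact abs_intervalIntegral_le f L_mem
    have h3 : ‖u‖ ≤ ‖U 0‖ + dist (U 0) u := by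
      rw [dist_eq_norm]
      calc ‖u‖ = ‖U 0 - (U 0 - u)‖ := by rw [sub_sub_cancel]
        _ ≤ _ := norm_sub_le _ _
    have h4 : √(2 * L ^ (2 * σ - 1)) * √G / (1 - √r) = D * √G := by rw [hD]; ring
    rw [h4] at h1
    have h5 : 0 ≤ √L / L * √G := by positivity
    have h6 : 0 ≤ D * ‖f‖ := by positivity
    nlinarith

/-- Morrey's estimate is needed only for `s < 1`; from order `1` on, the embedding factors through
`H¹`. -/
lemma embedsFrom_inc {s : ℝ} (hs : 1 / 2 < s) :
    EmbedsFrom (inc : ContSpace L →L[ℝ] LTwo L) s := by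
  by_cases hs1 : 1 ≤ s
  · exact EmbedsFrom.of_comp_inc (i := prim) (embedsFrom_hOne hs1)
  push Not at hs1
  obtain ⟨C, hC0, hC⟩ := exists_inc_eq (L := L) hs
  have hs0 : 0 ≤ s := by linarith
  constructor
  · intro f hf
    have hf1 := memSobolev_congr hs0 hf.memLp.coeFn_toLp.symm hf
    rw [memSobolev_of_lt_one hs0 hs1] at hf1
    obtain ⟨u, hu, -⟩ := hC (hf.memLp.toLp f) _ ENNReal.toReal_nonneg
      (ENNReal.ofReal_toReal hf1.2.ne).ge
    exact ⟨u, hu ▸ hf.memLp.coeFn_toLp⟩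
  · refine ⟨(2 * C ^ 2).toNNReal, fun u hu => ?_⟩
    rw [memSobolev_of_lt_one hs0 hs1] at hu
    set G := (gagliardoSq L s (inc u)).toReal with hG
    have hG' : ENNReal.ofReal G = gagliardoSq L s (inc u) := ENNReal.ofReal_toReal hu.2.ne
    obtain ⟨w, hw, hw2⟩ := hC (inc u) G ENNReal.toReal_nonneg hG'.ge
    rw [inc_injective hw] at hw2
    rw [sobSq_of_lt_one hs0 hs1, normSq_eq_enorm_sq, ← hG', ← ofReal_norm, ← ofReal_norm,
      ← ENNReal.ofReal_pow (norm_nonneg _), ← ENNReal.ofReal_pow (norm_nonneg _),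
      ← ENNReal.ofReal_add (by positivity) ENNReal.toReal_nonneg]
    change _ ≤ ENNReal.ofReal _ * _
    rw [← ENNReal.ofReal_mul (by positivity)]
    refine ENNReal.ofReal_le_ofReal ((pow_le_pow_left₀ (norm_nonneg _) hw2 2).trans ?_)
    rw [mul_pow, mul_assoc, mul_comm 2, mul_assoc]
    refine mul_le_mul_of_nonneg_left ?_ (by positivity)
    nlinarith [sq_nonneg (‖inc u‖ - √G), Real.sq_sqrt (ENNReal.toReal_nonneg : 0 ≤ G)]

end

noncomputable section

/-! ### Maps which are Lipschitz on bounded sets -/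

section LipBdd

variable {V W Z U : Type*} [NormedAddCommGroup V] [NormedSpace ℝ V] [NormedAddCommGroup W]
  [NormedSpace ℝ W] [NormedAddCommGroup Z] [NormedSpace ℝ Z] [NormedAddCommGroup U]
  [NormedSpace ℝ U]

/-- `F` is Lipschitz on bounded sets. -/
def LipBdd (F : V → W) : Prop :=
  ∀ R : ℝ, ∃ C : ℝ, 0 ≤ C ∧ ∀ x y, ‖x‖ ≤ R → ‖y‖ ≤ R → ‖F x - F y‖ ≤ C * ‖x - y‖

omit [NormedSpace ℝ V] [NormedSpace ℝ W] in
lemma LipBdd.bounded {F : V → W} (hF : LipBdd F) (R : ℝ) :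
    ∃ M : ℝ, 0 ≤ M ∧ ∀ x, ‖x‖ ≤ R → ‖F x‖ ≤ M := by
  obtain ⟨C, hC, h⟩ := hF R
  by_cases hR : 0 ≤ R
  · refine ⟨‖F 0‖ + C * R, by positivity, fun x hx => ?_⟩
    have h1 := h x 0 hx (by simpa using hR)
    rw [sub_zero] at h1
    calc ‖F x‖ = ‖F 0 + (F x - F 0)‖ := by rw [add_sub_cancel]
      _ ≤ ‖F 0‖ + ‖F x - F 0‖ := norm_add_le _ _
      _ ≤ _ := by gcongr; exact h1.trans (by gcongr)
  · exact ⟨0, le_rfl, fun x hx => absurd ((norm_nonneg x).trans hx) hR⟩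

omit [NormedSpace ℝ V] [NormedSpace ℝ W] in
lemma lipBdd_const (w : W) : LipBdd fun _ : V => w :=
  fun _ => ⟨0, le_rfl, fun x y _ _ => by simp⟩

lemma lipBdd_clm (T : V →L[ℝ] W) : LipBdd T :=
  fun _ => ⟨‖T‖, norm_nonneg _, fun x y _ _ => by rw [← map_sub]; exact T.le_opNorm _⟩

omit [NormedSpace ℝ V] [NormedSpace ℝ W] in
lemma LipBdd.add {F G : V → W} (hF : LipBdd F) (hG : LipBdd G) : LipBdd fun x => F x + G x := by
  intro R
  obtain ⟨C, hC, h⟩ := hF R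
  obtain ⟨C', hC', h'⟩ := hG R
  refine ⟨C + C', by positivity, fun x y hx hy => ?_⟩
  rw [add_sub_add_comm, add_mul]
  exact (norm_add_le _ _).trans (add_le_add (h x y hx hy) (h' x y hx hy))

omit [NormedSpace ℝ V] [NormedSpace ℝ W] [NormedSpace ℝ Z] in
lemma LipBdd.comp {G : W → Z} {F : V → W} (hG : LipBdd G) (hF : LipBdd F) :
    LipBdd fun x => G (F x) := by
  intro R
  obtain ⟨C, hC, h⟩ := hF R
  obtain ⟨M, hM, hb⟩ := hF.bounded R
  obtain ⟨C', hC', h'⟩ := hG M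
  refine ⟨C' * C, by positivity, fun x y hx hy => ?_⟩
  rw [mul_assoc]
  exact (h' _ _ (hb x hx) (hb y hy)).trans (by gcongr; exact h x y hx hy)

omit [NormedSpace ℝ V] in
lemma LipBdd.clm {F : V → W} (hF : LipBdd F) (T : W →L[ℝ] Z) : LipBdd fun x => T (F x) :=
  (lipBdd_clm T).comp hF

omit [NormedSpace ℝ V] [NormedSpace ℝ W] [NormedSpace ℝ Z] in
lemma LipBdd.prodMk {F : V → W} {G : V → Z} (hF : LipBdd F) (hG : LipBdd G) :
    LipBdd fun x => (F x, G x) := by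
  intro R
  obtain ⟨C, hC, h⟩ := hF R
  obtain ⟨C', hC', h'⟩ := hG R
  refine ⟨max C C', by positivity, fun x y hx hy => ?_⟩
  rw [Prod.mk_sub_mk, Prod.norm_mk]
  refine max_le ((h x y hx hy).trans ?_) ((h' x y hx hy).trans ?_)
  · gcongr; exact le_max_left _ _
  · gcongr; exact le_max_right _ _

omit [NormedSpace ℝ V] in
-- Telescope the difference of the two values. With sums, constants and compositions, this makes the
-- Lipschitz bounds for all the polynomial vector fields below automatic.
lemma LipBdd.bilin {F : V → W} {G : V → Z} (hF : LipBdd F) (hG : LipBdd G)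
    (B : W →L[ℝ] Z →L[ℝ] U) : LipBdd fun x => B (F x) (G x) := by
  intro R
  obtain ⟨C, hC, h⟩ := hF R
  obtain ⟨C', hC', h'⟩ := hG R
  obtain ⟨M, hM, hb⟩ := hF.bounded R
  obtain ⟨M', hM', hb'⟩ := hG.bounded R
  refine ⟨‖B‖ * (C * M' + M * C'), by positivity, fun x y hx hy => ?_⟩
  have h1 : B (F x) (G x) - B (F y) (G y) = B (F x - F y) (G x) + B (F y) (G x - G y) := by
    simp
  rw [h1]
  calc _ ≤ ‖B (F x - F y) (G x)‖ + ‖B (F y) (G x - G y)‖ := norm_add_le _ _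
    _ ≤ ‖B‖ * ‖F x - F y‖ * ‖G x‖ + ‖B‖ * ‖F y‖ * ‖G x - G y‖ :=
        add_le_add (B.le_opNorm₂ _ _) (B.le_opNorm₂ _ _)
    _ ≤ ‖B‖ * (C * ‖x - y‖) * M' + ‖B‖ * M * (C' * ‖x - y‖) := by
        gcongr
        exacts [h x y hx hy, hb' x hx, hb y hy, h' x y hx hy]
    _ = _ := by ring

end LipBdd

/-! ### The elliptic problem -/

variable {L : ℝ} [hL : Fact (0 < L)]

omit hL in
lemma LipBdd.mul {V : Type*} [NormedAddCommGroup V] {F G : V → ContSpace L}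
    (hF : LipBdd F) (hG : LipBdd G) : LipBdd fun x => F x * G x :=
  hF.bilin hG (ContinuousLinearMap.mul ℝ (ContSpace L))

lemma LipBdd.smul {V W : Type*} [NormedAddCommGroup V] [NormedAddCommGroup W] [NormedSpace ℝ W]
    {F : V → ℝ} {G : V → W} (hF : LipBdd F) (hG : LipBdd G) : LipBdd fun x => F x • G x :=
  hF.bilin hG (ContinuousLinearMap.lsmul ℝ ℝ)

lemma LipBdd.const_smul {V W : Type*} [NormedAddCommGroup V] [NormedAddCommGroup W]
    [NormedSpace ℝ W] {G : V → W} (c : ℝ) (hG : LipBdd G) : LipBdd fun x => c • G x :=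
  (lipBdd_const c).smul hG

/-- Evaluation at a point. -/
def evalAt (x : ℝ) : ContSpace L →L[ℝ] ℝ := ContinuousMap.evalCLM ℝ (projIcc 0 L hL.out.le x)

lemma evalAt_apply (x : ℝ) (u : ContSpace L) : evalAt x u = ext u x := rfl

lemma LipBdd.eval {V : Type*} [NormedAddCommGroup V] {F : V → ContSpace L} (hF : LipBdd F)
    (x : ℝ) : LipBdd fun y => ext (F y) x :=
  hF.bilin (lipBdd_const (1 : ℝ)) ((ContinuousLinearMap.lsmul ℝ ℝ).comp (evalAt x)) |> fun h => by
    simpa [evalAt_apply] using h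

/-- The hyperbolic cosine on `[0,L]`. -/
def coshC : ContSpace L := restr Real.cosh Real.continuous_cosh.continuousOn

/-- The hyperbolic sine on `[0,L]`. -/
def sinhC : ContSpace L := restr Real.sinh Real.continuous_sinh.continuousOn

/-- The primitive of a continuous function which vanishes at `0`. -/
def primC : ContSpace L →L[ℝ] ContSpace L := prim ∘L ContinuousLinearMap.inr ℝ ℝ (LTwo L) ∘L inc

lemma primC_apply (w : ContSpace L) : primC w = prim (0, inc w) := rfl

/-- The flux `u + u²/2` of the BBM equation. -/
def flux (u : ContSpace L) : ContSpace L := u + (1 / 2 : ℝ) • (u * u)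

lemma ext_flux (u : ContSpace L) (x : ℝ) : ext (flux u) x = ext u x + ext u x ^ 2 / 2 := by
  simp [flux]; ring

/-- A particular solution of `g'' - g = f`. -/
def partSol (f : ContSpace L) : ContSpace L :=
  sinhC * primC (coshC * f) + (-1 : ℝ) • (coshC * primC (sinhC * f))

/-- The derivative of `partSol`. -/
def partSol' (f : ContSpace L) : ContSpace L :=
  coshC * primC (coshC * f) + (-1 : ℝ) • (sinhC * primC (sinhC * f))

/-- The boundary value of `u_tx - u - u²/2`, when `u_tx = α u + u²/3`. -/
def bdry (α z : ℝ) : ℝ := (α - 1) * z + (-1 / 6) * (z * z)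

/-- The coefficient of `sinh` in `gMap`. -/
def sinhCoeff (α β : ℝ) (u : ContSpace L) : ℝ :=
  (Real.sinh L)⁻¹ * (bdry β (ext u L) + (-Real.cosh L) * bdry α (ext u 0)
    + (-1) * ext (partSol (flux u)) L)

/-- The function `u_tx - u - u²/2`, as a function of `u`. -/
def gMap (α β : ℝ) (u : ContSpace L) : ContSpace L :=
  bdry α (ext u 0) • coshC + sinhCoeff α β u • sinhC + partSol (flux u)

/-- The function `u_t`, as a function of `u`. -/
def vMap (α β : ℝ) (u : ContSpace L) : ContSpace L :=
  bdry α (ext u 0) • sinhC + sinhCoeff α β u • coshC + partSol' (flux u)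

lemma ext_coshC {x : ℝ} (hx : x ∈ Icc 0 L) : ext (coshC (L := L)) x = Real.cosh x :=
  ext_restr _ _ hx

lemma ext_sinhC {x : ℝ} (hx : x ∈ Icc 0 L) : ext (sinhC (L := L)) x = Real.sinh x :=
  ext_restr _ _ hx

lemma coshC_eq : (coshC : ContSpace L) = prim (1, inc sinhC) := by
  have := prim_of_hasDerivAt (u := (coshC : ContSpace L)) (p := sinhC) fun x hx => by
    rw [ext_sinhC (Ioo_subset_Icc_self hx)]
    refine (Real.hasDerivAt_cosh x).congr_of_eventuallyEq ?_
    filter_upwards [Ioo_mem_nhds hx.1 hx.2] with y hy using ext_coshC (Ioo_subset_Icc_self hy)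
  rw [this, ext_coshC zero_mem, Real.cosh_zero]

lemma sinhC_eq : (sinhC : ContSpace L) = prim (0, inc coshC) := by
  have := prim_of_hasDerivAt (u := (sinhC : ContSpace L)) (p := coshC) fun x hx => by
    rw [ext_coshC (Ioo_subset_Icc_self hx)]
    refine (Real.hasDerivAt_sinh x).congr_of_eventuallyEq ?_
    filter_upwards [Ioo_mem_nhds hx.1 hx.2] with y hy using ext_sinhC (Ioo_subset_Icc_self hy)
  rw [this, ext_sinhC zero_mem, Real.sinh_zero]

/-- The product rule for continuously differentiable functions. -/
lemma mul_eq_prim {u u' w w' : ContSpace L} {a b : ℝ} (hu : u = prim (a, inc u'))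
    (hw : w = prim (b, inc w')) : u * w = prim (a * b, inc (u * w' + w * u')) := by
  rw [map_add, ← mulL_inc, ← mulL_inc]
  conv_rhs => rw [hu, hw]
  conv_lhs => rw [hu, hw]
  exact prim_mul _ _ _ _

lemma cosh_sq_sub_sinh_sq : (coshC : ContSpace L) * coshC - sinhC * sinhC = 1 := by
  refine ext_injOn fun x hx => ?_
  simp only [ext_sub, ext_mul, ext_one, ext_coshC hx, ext_sinhC hx]
  nlinarith [Real.cosh_sq x]

/-- In the derivative of `sinh ∫ cosh f - cosh ∫ sinh f` the two terms `sinh cosh f` cancel. -/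
lemma partSol_eq (f : ContSpace L) : partSol f = prim (0, inc (partSol' f)) := by
  have h1 := mul_eq_prim sinhC_eq (primC_apply (coshC * f))
  have h2 := mul_eq_prim coshC_eq (primC_apply (sinhC * f))
  rw [partSol, h1, h2, ← map_smul, ← map_add]
  congr 1
  ext1
  · simp
  · simp only [Prod.snd_add, Prod.smul_snd, ← map_smul, ← map_add]
    congr 1
    rw [partSol']
    simp only [smul_add, neg_smul, one_smul]
    ring

/-- Here the terms without an integral add up to `(cosh² - sinh²) f = f`. -/
lemma partSol'_eq (f : ContSpace L) : partSol' f = prim (0, inc (partSol f + f)) := by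
  have h1 := mul_eq_prim coshC_eq (primC_apply (coshC * f))
  have h2 := mul_eq_prim sinhC_eq (primC_apply (sinhC * f))
  rw [partSol', h1, h2, ← map_smul, ← map_add]
  congr 1
  ext1
  · simp
  · simp only [Prod.snd_add, Prod.smul_snd, ← map_smul, ← map_add]
    congr 1
    rw [partSol]
    simp only [smul_add, neg_smul, one_smul]
    have := cosh_sq_sub_sinh_sq (L := L)
    linear_combination f * this

lemma gMap_zero (α β : ℝ) (u : ContSpace L) : ext (gMap α β u) 0 = bdry α (ext u 0) := by
  simp only [gMap, ext_add, ext_smul, ext_coshC zero_mem, ext_sinhC zero_mem, Real.cosh_zero,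
    Real.sinh_zero]
  rw [partSol_eq, ext_prim_zero]
  simp

/-- `sinhCoeff` is the solution of this equation; `sinh L` is invertible because `L > 0`. -/
lemma gMap_L (α β : ℝ) (u : ContSpace L) : ext (gMap α β u) L = bdry β (ext u L) := by
  have : Real.sinh L ≠ 0 := (Real.sinh_pos_iff.2 hL.out).ne'
  simp only [gMap, ext_add, ext_smul, ext_coshC L_mem, ext_sinhC L_mem, sinhCoeff]
  field_simp
  ring

/-- With `vMap_eq` this is the system `g' = v`, `v' = g + flux u`. Since `u` is only continuous,
`flux u` need not be differentiable; working with `g = v' - flux u` avoids its derivative. -/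
lemma gMap_eq (α β : ℝ) (u : ContSpace L) :
    gMap α β u = prim (bdry α (ext u 0), inc (vMap α β u)) := by
  rw [gMap, partSol_eq, coshC_eq, sinhC_eq, ← map_smul, ← map_smul, ← map_add, ← map_add]
  congr 1
  ext1
  · simp
  · simp only [Prod.snd_add, Prod.smul_snd, ← map_smul, ← map_add, ← sinhC_eq]
    rfl

lemma vMap_eq (α β : ℝ) (u : ContSpace L) :
    vMap α β u = prim (ext (vMap α β u) 0, inc (gMap α β u + flux u)) := by
  have h : ext (vMap α β u) 0 = sinhCoeff α β u := by
    simp only [vMap, ext_add, ext_smul, ext_coshC zero_mem, ext_sinhC zero_mem, Real.cosh_zero,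
      Real.sinh_zero]
    rw [partSol'_eq, ext_prim_zero]
    simp
  rw [h, vMap, partSol'_eq, coshC_eq, sinhC_eq, ← map_smul, ← map_smul, ← map_add, ← map_add]
  congr 1
  ext1
  · simp
  · simp only [Prod.snd_add, Prod.smul_snd, ← map_smul, ← map_add, ← sinhC_eq]
    congr 1
    rw [gMap]
    ring

lemma gMap_add_flux_zero (α β : ℝ) (u : ContSpace L) :
    ext (gMap α β u + flux u) 0 = α * ext u 0 + ext u 0 ^ 2 / 3 := by
  rw [ext_add, gMap_zero, ext_flux, bdry]; ring

lemma gMap_add_flux_L (α β : ℝ) (u : ContSpace L) :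
    ext (gMap α β u + flux u) L = β * ext u L + ext u L ^ 2 / 3 := by
  rw [ext_add, gMap_L, ext_flux, bdry]; ring

lemma lipBdd_id {V : Type*} [NormedAddCommGroup V] : LipBdd fun u : V => u :=
  fun _ => ⟨1, zero_le_one, fun x y _ _ => by simp⟩

omit hL in
lemma lipBdd_flux : LipBdd (flux (L := L)) :=
  lipBdd_id.add ((lipBdd_id.mul lipBdd_id).const_smul _)

lemma lipBdd_partSol : LipBdd (partSol (L := L)) :=
  ((lipBdd_const _).mul (((lipBdd_const _).mul lipBdd_id).clm primC)).add
    (((lipBdd_const _).mul (((lipBdd_const _).mul lipBdd_id).clm primC)).const_smul _)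

lemma lipBdd_partSol' : LipBdd (partSol' (L := L)) :=
  ((lipBdd_const _).mul (((lipBdd_const _).mul lipBdd_id).clm primC)).add
    (((lipBdd_const _).mul (((lipBdd_const _).mul lipBdd_id).clm primC)).const_smul _)

lemma lipBdd_bdry (α x : ℝ) : LipBdd fun u : ContSpace L => bdry α (ext u x) :=
  ((lipBdd_const _).smul (lipBdd_id.eval x)).add
    ((lipBdd_const _).smul ((lipBdd_id.eval x).smul (lipBdd_id.eval x)))

lemma lipBdd_sinhCoeff (α β : ℝ) : LipBdd (sinhCoeff (L := L) α β) :=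
  (lipBdd_const _).smul (((lipBdd_bdry β L).add ((lipBdd_const _).smul (lipBdd_bdry α 0))).add
    ((lipBdd_const _).smul ((lipBdd_partSol.comp lipBdd_flux).eval L)))

lemma lipBdd_gMap (α β : ℝ) : LipBdd (gMap (L := L) α β) :=
  (((lipBdd_bdry α 0).smul (lipBdd_const _)).add
    ((lipBdd_sinhCoeff α β).smul (lipBdd_const _))).add (lipBdd_partSol.comp lipBdd_flux)

lemma lipBdd_vMap (α β : ℝ) : LipBdd (vMap (L := L) α β) :=
  (((lipBdd_bdry α 0).smul (lipBdd_const _)).add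
    ((lipBdd_sinhCoeff α β).smul (lipBdd_const _))).add (lipBdd_partSol'.comp lipBdd_flux)

/-! ### Pairings -/

lemma inner_inc_left (u : ContSpace L) (p : LTwo L) :
    inner ℝ (inc u) p = ∫ x, ext u x * p x ∂(mu L) := by
  rw [L2.inner_def]
  refine integral_congr_ae ?_
  filter_upwards [inc_ae u] with x hx
  simp [hx, mul_comm]

lemma inner_inc_inc (u w : ContSpace L) :
    inner ℝ (inc u) (inc w) = ∫ x in (0:ℝ)..L, ext u x * ext w x := by
  rw [inner_inc_left, ← integral_mu]
  refine integral_congr_ae ?_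
  filter_upwards [inc_ae w] with x hx
  rw [hx]

lemma inner_mulL (u : ContSpace L) (p q : LTwo L) :
    inner ℝ (mulL u p) q = inner ℝ p (mulL u q) := by
  rw [L2.inner_def, L2.inner_def]
  refine integral_congr_ae ?_
  filter_upwards [mulL_ae u p, mulL_ae u q] with x h1 h2
  simp only [h1, h2, RCLike.inner_apply, conj_trivial]
  ring

/-- Integration by parts. -/
lemma prim_pairing {u w : ContSpace L} {a b : ℝ} {p q : LTwo L} (hu : u = prim (a, p))
    (hw : w = prim (b, q)) :
    ext u L * ext w L - ext u 0 * ext w 0 = inner ℝ (inc u) q + inner ℝ (inc w) p := by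
  have h := congrArg (fun u => ext u L) (prim_mul a b p q)
  simp only [ext_mul] at h
  rw [← hu, ← hw, ext_prim _ L_mem, ← integral_mu] at h
  have h0 : ext u 0 * ext w 0 = a * b := by rw [hu, hw, ext_prim_zero, ext_prim_zero]
  have h1 : ∫ x, (mulL u q + mulL w p) x ∂(mu L)
      = ∫ x, (ext u x * q x + ext w x * p x) ∂(mu L) := by
    refine integral_congr_ae ?_
    filter_upwards [Lp.coeFn_add (mulL u q) (mulL w p), mulL_ae u q, mulL_ae w p] with x h2 h3 h4
    rw [h2, Pi.add_apply, h3, h4]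
  rw [h, h0, h1, integral_add (integrable_of_memLp (memLp_ext_mul u q))
    (integrable_of_memLp (memLp_ext_mul w p)), inner_inc_left, inner_inc_left]
  ring

/-- The integral of `(u w)' = u² + w²` is a boundary term, and `u` vanishes at both ends. -/
lemma eq_zero_of_elliptic {u w : ContSpace L} {a b : ℝ} (hu : u = prim (a, inc w))
    (hw : w = prim (b, inc u)) (h0 : ext u 0 = 0) (hL : ext u L = 0) : u = 0 ∧ w = 0 := by
  have h := prim_pairing hu hw
  rw [h0, hL, real_inner_self_eq_norm_sq, real_inner_self_eq_norm_sq] at h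
  have h1 : ‖inc u‖ = 0 := by nlinarith [norm_nonneg (inc u), norm_nonneg (inc w)]
  have h2 : ‖inc w‖ = 0 := by nlinarith [norm_nonneg (inc u), norm_nonneg (inc w)]
  rw [norm_eq_zero] at h1 h2
  exact ⟨inc_injective (h1.trans (map_zero inc).symm), inc_injective (h2.trans (map_zero inc).symm)⟩

/-! ### Equivalence of the elliptic problem with the explicit formula -/

lemma ext_prim_inc_eqOn (a : ℝ) (h : ContSpace L) :
    EqOn (ext (prim (a, inc h))) (fun x => a + ∫ y in (0:ℝ)..x, ext h y) (Icc 0 L) := fun x hx => by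
  rw [ext_prim _ hx, intervalIntegral_congr_ae (inc_ae h) zero_mem hx]

lemma hasDerivAt_primitive_ext (a : ℝ) (h : ContSpace L) (x : ℝ) :
    HasDerivAt (fun x => a + ∫ y in (0:ℝ)..x, ext h y) (ext h x) x :=
  ((continuous_ext h).integral_hasStrictDerivAt 0 x).hasDerivAt.const_add a

lemma contDiffOn_prim_inc (a : ℝ) (h : ContSpace L) :
    ContDiffOn ℝ 1 (ext (prim (a, inc h))) (Icc 0 L) := by
  refine ContDiffOn.congr ?_ (ext_prim_inc_eqOn a h)
  refine ContDiff.contDiffOn (contDiff_one_iff_deriv.2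
    ⟨fun x => (hasDerivAt_primitive_ext a h x).differentiableAt, ?_⟩)
  have : deriv (fun x => a + ∫ y in (0:ℝ)..x, ext h y) = ext h :=
    funext fun x => (hasDerivAt_primitive_ext a h x).deriv
  rw [this]
  exact continuous_ext h

lemma hasDerivWithinAt_prim_inc (a : ℝ) (h : ContSpace L) {x : ℝ} (hx : x ∈ Icc 0 L) :
    HasDerivWithinAt (ext (prim (a, inc h))) (ext h x) (Icc 0 L) x :=
  (hasDerivAt_primitive_ext a h x).hasDerivWithinAt.congr (ext_prim_inc_eqOn a h)
    (ext_prim_inc_eqOn a h hx)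

omit hL in
lemma IsTest.deriv {φ : ℝ → ℝ} (hφ : IsTest L φ) : IsTest L (deriv φ) :=
  ⟨(contDiff_infty_iff_deriv.1 hφ.1).2, hφ.2.1.deriv,
    (closure_mono (support_deriv_subset)).trans ((isClosed_tsupport φ).closure_subset.trans hφ.2.2)⟩

lemma integral_prim_inc_mul {a : ℝ} {u h : ContSpace L} (hu : u = prim (a, inc h)) {φ : ℝ → ℝ}
    (hφ : IsTest L φ) :
    ∫ x in Ioo 0 L, ext u x * deriv φ x = -∫ x in Ioo 0 L, ext h x * φ x := by
  rw [hu]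
  exact ((hasWeakDeriv_prim (a, inc h)).congr_right (inc_ae h)).2 φ hφ

lemma solvesElliptic_vMap (α β : ℝ) (u : ContSpace L) :
    SolvesElliptic L α β (ext u) (ext (vMap α β u)) := by
  have hv := vMap_eq α β u
  have hd : ∀ x ∈ Icc 0 L, derivWithin (ext (vMap α β u)) (Icc 0 L) x
      = ext (gMap α β u + flux u) x := fun x hx => by
    rw [hv]
    exact (hasDerivWithinAt_prim_inc _ _ hx).derivWithin (uniqueDiffOn_Icc hL.out x hx)
  refine ⟨?_, fun φ hφ => ?_, ?_, ?_⟩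
  · rw [hv]; exact contDiffOn_prim_inc _ _
  · have h1 := integral_prim_inc_mul hv hφ.deriv
    have h2 := integral_prim_inc_mul (gMap_eq α β u) hφ
    have i1 := integrable_mul_of_memLp (memLp_ext (vMap α β u)) hφ.1.continuous
    have i2 := integrable_mul_of_memLp (memLp_ext (vMap α β u)) hφ.deriv.continuous_deriv
    have i3 := integrable_mul_of_memLp (memLp_ext (gMap α β u)) hφ.continuous_deriv
    have i4 := integrable_mul_of_memLp (memLp_ext (flux u)) hφ.continuous_deriv
    simp only [mul_sub, ← ext_flux]
    rw [integral_sub i1 i2, h1]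
    simp only [ext_add, add_mul]
    rw [integral_add i3 i4, h2]
    ring
  · rw [hd 0 zero_mem, gMap_add_flux_zero]
  · rw [hd L L_mem, gMap_add_flux_L]

/-- The distributional equation says that `v' - flux u` has weak derivative `v`, hence is a
primitive of it. So `(v' - flux u, v)` solves the same first-order system with the same Dirichlet
data as `(gMap, vMap)`, and the difference vanishes. -/
lemma SolvesElliptic.eqOn {α β : ℝ} {u : ContSpace L} {v : ℝ → ℝ}
    (h : SolvesElliptic L α β (ext u) v) : EqOn v (ext (vMap α β u)) (Icc 0 L) := by
  obtain ⟨h1, h2, h3, h4⟩ := h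
  have hud := uniqueDiffOn_Icc hL.out
  set V : ContSpace L := restr v h1.continuousOn with hV
  set W : ContSpace L := restr (derivWithin v (Icc 0 L))
    (h1.continuousOn_derivWithin hud le_rfl) with hW
  have hVW : V = prim (ext V 0, inc W) := by
    refine prim_of_hasDerivAt fun x hx => ?_
    have hx' := Ioo_subset_Icc_self hx
    rw [hW, ext_restr _ _ hx']
    have hnhds := Icc_mem_nhds hx.1 hx.2
    refine (((h1.differentiableOn (by norm_num)) x hx').hasDerivWithinAt.hasDerivAt
      hnhds).congr_of_eventuallyEq ?_
    filter_upwards [hnhds] with y hy using ext_restr _ _ hy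
  have hweak : HasWeakDeriv L (ext (W - flux u)) (inc V) := by
    refine HasWeakDeriv.congr_right ⟨memLp_ext V, fun φ hφ => ?_⟩ (inc_ae V).symm
    have k1 := integral_prim_inc_mul hVW hφ.deriv
    have k2 := h2 φ hφ
    have k3 : ∫ x in Ioo 0 L, v x * (φ x - deriv (deriv φ) x)
        = ∫ x in Ioo 0 L, ext V x * (φ x - deriv (deriv φ) x) :=
      setIntegral_congr_fun measurableSet_Ioo fun x hx => by
        simp only [hV, ext_restr _ _ (Ioo_subset_Icc_self hx)]
    have i1 := integrable_mul_of_memLp (memLp_ext V) hφ.1.continuous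
    have i2 := integrable_mul_of_memLp (memLp_ext V) hφ.deriv.continuous_deriv
    have i3 := integrable_mul_of_memLp (memLp_ext W) hφ.continuous_deriv
    have i4 := integrable_mul_of_memLp (memLp_ext (flux u)) hφ.continuous_deriv
    rw [k3] at k2
    simp only [mul_sub, ← ext_flux] at k2
    rw [integral_sub i1 i2, k1] at k2
    simp only [ext_sub, sub_mul]
    rw [integral_sub i3 i4]
    linarith
  obtain ⟨c, hc⟩ := exists_prim_of_hasWeakDeriv (memLp_ext _) hweak
  have hG : W - flux u = prim (c, inc V) :=
    ext_injOn (eqOn_of_ae_eq (continuous_ext _).continuousOn (continuous_ext _).continuousOn hc)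
  have hW0 : ext W 0 = α * ext u 0 + ext u 0 ^ 2 / 3 := by rw [hW, ext_restr _ _ zero_mem, h3]
  have hWL : ext W L = β * ext u L + ext u L ^ 2 / 3 := by rw [hW, ext_restr _ _ L_mem, h4]
  have e1 : W - flux u - gMap α β u = prim (c - bdry α (ext u 0), inc (V - vMap α β u)) := by
    rw [hG, gMap_eq, ← map_sub, map_sub inc]; rfl
  have e2 : V - vMap α β u
      = prim (ext V 0 - ext (vMap α β u) 0, inc (W - flux u - gMap α β u)) := by
    have : W - flux u - gMap α β u = W - (gMap α β u + flux u) := by ring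
    rw [this, map_sub inc]
    conv_lhs => rw [hVW, vMap_eq, ← map_sub]
    rfl
  obtain ⟨-, e3⟩ := eq_zero_of_elliptic e1 e2
    (by rw [ext_sub, ext_sub, gMap_zero, ext_flux, hW0, bdry]; ring)
    (by rw [ext_sub, ext_sub, gMap_L, ext_flux, hWL, bdry]; ring)
  intro x hx
  rw [← sub_eq_zero.1 e3, hV, ext_restr _ _ hx]

/-! ### The vector fields -/

/-- The vector field `u ↦ u_t`, from `C[0,L]` to `H^1(0,L)`. -/
def fieldOne (α β : ℝ) (u : ContSpace L) : HOne L :=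
  (ext (vMap α β u) 0, inc (gMap α β u + flux u))

lemma prim_fieldOne (α β : ℝ) (u : ContSpace L) : prim (fieldOne α β u) = vMap α β u :=
  (vMap_eq α β u).symm

lemma lipBdd_fieldOne (α β : ℝ) : LipBdd (fieldOne (L := L) α β) :=
  ((lipBdd_vMap α β).eval 0).prodMk (((lipBdd_gMap α β).add lipBdd_flux).clm inc)

lemma flux_prim (a : ℝ) (p : LTwo L) :
    flux (prim (a, p)) = prim (a + a ^ 2 / 2, p + mulL (prim (a, p)) p) := by
  rw [flux, prim_mul, ← map_smul, ← map_add]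
  congr 1
  ext1
  · simp; ring
  · simp only [Prod.snd_add, Prod.smul_snd]
    rw [← two_smul ℝ, smul_smul]
    norm_num

/-- The inclusion of `H^2` into `H^1`. -/
def twoToOne : HTwo L →L[ℝ] HOne L := (ContinuousLinearMap.id ℝ ℝ).prodMap hOne

/-- The inclusion of `H^3` into `H^2`. -/
def threeToTwo : HThree L →L[ℝ] HTwo L := (ContinuousLinearMap.id ℝ ℝ).prodMap twoToOne

/-- The vector field `u ↦ u_t`, from `H^1(0,L)` to `H^2(0,L)`. -/
def fieldTwo (α β : ℝ) (e : HOne L) : HTwo L :=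
  (ext (vMap α β (prim e)) 0, (ext (gMap α β (prim e) + flux (prim e)) 0,
    inc (vMap α β (prim e)) + (e.2 + mulL (prim e) e.2)))

/-- `fieldTwo` records `v(0)`, `v'(0)` and `v'' = v + u' + u u'`, obtained by differentiating `v' =
g + flux u`; its image in `H¹` must be the old field. -/
lemma twoToOne_fieldTwo (α β : ℝ) (e : HOne L) :
    twoToOne (fieldTwo α β e) = fieldOne α β (prim e) := by
  refine Prod.ext rfl ?_
  change inc (prim (ext (gMap α β (prim e) + flux (prim e)) 0,
    inc (vMap α β (prim e)) + (e.2 + mulL (prim e) e.2))) = inc (gMap α β (prim e) + flux (prim e))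
  congr 1
  have h1 := gMap_eq α β (prim e)
  have h2 := flux_prim e.1 e.2
  have h3 : gMap α β (prim e) + flux (prim e)
      = prim (bdry α (ext (prim e) 0) + (e.1 + e.1 ^ 2 / 2),
        inc (vMap α β (prim e)) + (e.2 + mulL (prim e) e.2)) := by
    conv_lhs => rw [h1]
    rw [show flux (prim e) = _ from h2, ← map_add]
    rfl
  have h4 : ext (gMap α β (prim e) + flux (prim e)) 0
      = bdry α (ext (prim e) 0) + (e.1 + e.1 ^ 2 / 2) := by
    rw [h3, ext_prim_zero]
  rw [h4, h3]

lemma lipBdd_fieldTwo (α β : ℝ) : LipBdd (fieldTwo (L := L) α β) := by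
  have hp := lipBdd_clm (prim (L := L))
  have h2 : LipBdd fun e : HOne L => e.2 :=
    lipBdd_clm (ContinuousLinearMap.snd ℝ ℝ (LTwo L))
  have hv := (lipBdd_vMap (L := L) α β).comp hp
  have hg := ((lipBdd_gMap (L := L) α β).comp hp).add (lipBdd_flux.comp hp)
  exact (hv.eval 0).prodMk ((hg.eval 0).prodMk ((hv.clm inc).add (h2.add (hp.bilin h2 mulL))))

/-- The vector field `u ↦ u_t`, from `H^2(0,L)` to `H^3(0,L)`. -/
def fieldThree (α β : ℝ) (e : HTwo L) : HThree L :=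
  (ext (vMap α β (prim (twoToOne e))) 0,
    (ext (gMap α β (prim (twoToOne e)) + flux (prim (twoToOne e))) 0,
      (ext (vMap α β (prim (twoToOne e)) + (prim e.2 + prim (twoToOne e) * prim e.2)) 0,
        inc (gMap α β (prim (twoToOne e)) + flux (prim (twoToOne e)))
          + (e.2.2 + (mulL (prim (twoToOne e)) e.2.2 + inc (prim e.2 * prim e.2))))))

/-- One more derivative: the last entry is `v''' = v' + u'' + u u'' + (u')²`, where `v' = g + flux
u`. -/
lemma threeToTwo_fieldThree (α β : ℝ) (e : HTwo L) :
    threeToTwo (fieldThree α β e) = fieldTwo α β (twoToOne e) := by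
  refine Prod.ext rfl (Prod.ext rfl ?_)
  set u := prim (twoToOne e) with hu
  have hu' : u = prim (e.1, inc (prim e.2)) := rfl
  change inc (prim (ext (vMap α β u + (prim e.2 + u * prim e.2)) 0,
    inc (gMap α β u + flux u) + (e.2.2 + (mulL u e.2.2 + inc (prim e.2 * prim e.2)))))
    = inc (vMap α β u) + (inc (prim e.2) + mulL u (inc (prim e.2)))
  rw [mulL_inc, ← map_add, ← map_add]
  congr 1
  have h1 := vMap_eq α β u
  have h2 : u * prim e.2 = prim (e.1 * e.2.1, mulL u e.2.2 + inc (prim e.2 * prim e.2)) := by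
    rw [← mulL_inc]
    have := prim_mul e.1 e.2.1 (inc (prim e.2)) e.2.2
    rwa [← hu'] at this
  have h3 : vMap α β u + (prim e.2 + u * prim e.2)
      = prim (ext (vMap α β u) 0 + (e.2.1 + e.1 * e.2.1),
        inc (gMap α β u + flux u) + (e.2.2 + (mulL u e.2.2 + inc (prim e.2 * prim e.2)))) := by
    conv_lhs => rw [h1]
    rw [h2, ← map_add, ← map_add]
    rfl
  have h4 : ext (vMap α β u + (prim e.2 + u * prim e.2)) 0
      = ext (vMap α β u) 0 + (e.2.1 + e.1 * e.2.1) := by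
    rw [h3, ext_prim_zero]
  rw [h4, h3]

lemma lipBdd_fieldThree (α β : ℝ) : LipBdd (fieldThree (L := L) α β) := by
  have hp := lipBdd_clm (prim ∘L twoToOne (L := L))
  have h2 : LipBdd fun e : HTwo L => prim e.2 :=
    lipBdd_clm (prim ∘L ContinuousLinearMap.snd ℝ ℝ (HOne L))
  have h22 : LipBdd fun e : HTwo L => e.2.2 :=
    lipBdd_clm
      (ContinuousLinearMap.snd ℝ ℝ (LTwo L) ∘L ContinuousLinearMap.snd ℝ ℝ (HOne L))
  have hv := (lipBdd_vMap (L := L) α β).comp hp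
  have hg := ((lipBdd_gMap (L := L) α β).comp hp).add (lipBdd_flux.comp hp)
  exact (hv.eval 0).prodMk ((hg.eval 0).prodMk (((hv.add (h2.add (hp.mul h2))).eval 0).prodMk
    ((hg.clm inc).add (h22.add ((hp.bilin h22 mulL).add ((h2.mul h2).clm inc))))))

end

noncomputable section

/-! ### Ordinary differential equations in Banach spaces -/

section ODE

variable {V W : Type*} [NormedAddCommGroup V] [NormedSpace ℝ V] [NormedAddCommGroup W]
  [NormedSpace ℝ W]

omit [NormedSpace ℝ V] [NormedSpace ℝ W] in
lemma LipBdd.lipschitzOnWith {F : V → W} (hF : LipBdd F) (R : ℝ) :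
    ∃ K : ℝ≥0, LipschitzOnWith K F (Metric.closedBall 0 R) := by
  obtain ⟨C, hC, h⟩ := hF R
  refine ⟨C.toNNReal, LipschitzOnWith.of_dist_le_mul fun x hx y hy => ?_⟩
  rw [Real.coe_toNNReal _ hC, dist_eq_norm, dist_eq_norm]
  exact h x y (by simpa using hx) (by simpa using hy)

omit [NormedSpace ℝ V] [NormedSpace ℝ W] in
lemma LipBdd.continuous {F : V → W} (hF : LipBdd F) : Continuous F := by
  refine continuous_iff_continuousAt.2 fun x => ?_
  obtain ⟨K, hK⟩ := hF.lipschitzOnWith (‖x‖ + 1)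
  refine hK.continuousOn.continuousAt (Metric.closedBall_mem_nhds_of_mem ?_)
  simp

/-- The vector field `F` multiplied by a function of the norm which is `1` on the ball of radius
`R` and `0` outside of the ball of radius `R + 1`. -/
def cutoff (R : ℝ) (F : V → W) (y : V) : W := max 0 (min 1 (R + 1 - ‖y‖)) • F y

omit [NormedSpace ℝ V] in
lemma cutoff_eq {R : ℝ} {F : V → W} {y : V} (hy : ‖y‖ ≤ R) : cutoff R F y = F y := by
  rw [cutoff, min_eq_left (by linarith), max_eq_right zero_le_one, one_smul]

lemma abs_bump_sub_le (R a b : ℝ) :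
    |max 0 (min 1 (R + 1 - a)) - max 0 (min 1 (R + 1 - b))| ≤ |a - b| := by
  refine (abs_max_sub_max_le_max _ _ _ _).trans ?_
  rw [sub_self, abs_zero, max_eq_right (abs_nonneg _)]
  refine (abs_min_sub_min_le_max _ _ _ _).trans ?_
  rw [sub_self, abs_zero, max_eq_right (abs_nonneg _), abs_sub_comm]
  exact le_of_eq (congrArg abs (by ring))

lemma bump_le_one (R a : ℝ) : max 0 (min 1 (R + 1 - a)) ≤ 1 :=
  max_le zero_le_one (min_le_left _ _)

omit [NormedSpace ℝ V] in
-- The cutoff turns a locally Lipschitz field into a bounded, globally Lipschitz one with the same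
-- trajectories inside the ball of radius `R`. When just one point lies outside radius `R + 1`, the
-- field vanishes there and the variation of the cutoff factor carries the estimate.
lemma LipBdd.cutoff {F : V → W} (hF : LipBdd F) (R : ℝ) :
    ∃ K M : ℝ≥0, LipschitzWith K (cutoff R F) ∧ ∀ y, ‖BBM.cutoff R F y‖ ≤ M := by
  obtain ⟨C, hC, h⟩ := hF (R + 1)
  obtain ⟨M, hM, hb⟩ := hF.bounded (R + 1)
  have hz : ∀ y, R + 1 < ‖y‖ → BBM.cutoff R F y = 0 := fun y hy => by
    rw [BBM.cutoff, max_eq_left ((min_le_right _ _).trans (by linarith)), zero_smul]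
  have hone : ∀ x y, ‖x‖ ≤ R + 1 → R + 1 < ‖y‖ → ‖BBM.cutoff R F x‖ ≤ M * ‖x - y‖ := by
    intro x y hx hy
    rw [BBM.cutoff, norm_smul, Real.norm_eq_abs, mul_comm]
    refine mul_le_mul (hb x hx) ?_ (abs_nonneg _) hM
    have h1 := abs_bump_sub_le R ‖x‖ ‖y‖
    rw [max_eq_left ((min_le_right _ _).trans (by linarith : R + 1 - ‖y‖ ≤ 0)), sub_zero] at h1
    exact h1.trans (abs_norm_sub_norm_le x y)
  refine ⟨(C + M).toNNReal, M.toNNReal, LipschitzWith.of_dist_le_mul fun x y => ?_, fun y => ?_⟩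
  · rw [Real.coe_toNNReal _ (by positivity), dist_eq_norm, dist_eq_norm]
    have hxy := norm_nonneg (x - y)
    rcases le_or_gt ‖x‖ (R + 1) with hx | hx <;> rcases le_or_gt ‖y‖ (R + 1) with hy | hy
    · have h1 : BBM.cutoff R F x - BBM.cutoff R F y
          = max 0 (min 1 (R + 1 - ‖x‖)) • (F x - F y)
            + (max 0 (min 1 (R + 1 - ‖x‖)) - max 0 (min 1 (R + 1 - ‖y‖))) • F y := by
        simp only [BBM.cutoff, smul_sub, sub_smul]; abel
      rw [h1, add_mul]
      refine (norm_add_le _ _).trans (add_le_add ?_ ?_)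
      · rw [norm_smul, Real.norm_eq_abs, abs_of_nonneg (le_max_left _ _)]
        calc _ ≤ 1 * ‖F x - F y‖ := by gcongr; exact bump_le_one _ _
          _ ≤ _ := by rw [one_mul]; exact h x y hx hy
      · rw [norm_smul, Real.norm_eq_abs, mul_comm M]
        refine mul_le_mul ?_ (hb y hy) (norm_nonneg _) hxy
        exact (abs_bump_sub_le _ _ _).trans (abs_norm_sub_norm_le x y)
    · rw [hz y hy, sub_zero, add_mul]
      have := hone x y hx hy
      nlinarith
    · rw [hz x hx, zero_sub, norm_neg, add_mul, norm_sub_rev x y]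
      have := hone y x hy hx
      rw [norm_sub_rev] at hxy
      nlinarith
    · rw [hz x hx, hz y hy, sub_zero, norm_zero]
      positivity
  · rw [Real.coe_toNNReal _ hM]
    rcases le_or_gt ‖y‖ (R + 1) with hy | hy
    · rw [BBM.cutoff, norm_smul, Real.norm_eq_abs, abs_of_nonneg (le_max_left _ _)]
      calc _ ≤ 1 * ‖F y‖ := by gcongr; exact bump_le_one _ _
        _ ≤ M := by rw [one_mul]; exact hb y hy
    · rw [hz y hy, norm_zero]; exact hM

/-- Global existence for bounded Lipschitz vector fields. -/
lemma exists_global_solution [CompleteSpace V] {G : V → V} {K M : ℝ≥0} (hK : LipschitzWith K G)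
    (hM : ∀ y, ‖G y‖ ≤ M) (y₀ : V) :
    ∃ y : ℝ → V, y 0 = y₀ ∧ ∀ t, HasDerivAt y (G (y t)) t := by
  have hloc : ∀ n : ℕ, ∃ y : ℝ → V, y 0 = y₀ ∧
      ∀ t ∈ Ioo (-(n + 1 : ℝ)) (n + 1), HasDerivAt y (G (y t)) t := by
    intro n
    have hn : (0 : ℝ) < n + 1 := by positivity
    -- A field bounded by `M` cannot leave the ball of radius `M (n+1)` within time `n+1`, so the
    -- interval is not shortened.
    have hpl : IsPicardLindelof (fun _ => G) (tmin := -(n + 1 : ℝ)) (tmax := n + 1)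
        ⟨0, by constructor <;> linarith⟩ y₀ (M * (n + 1)) 0 M K := by
      refine ⟨fun t _ => hK.lipschitzOnWith, fun x _ => continuousOn_const, fun t _ x _ => hM x, ?_⟩
      push_cast
      simp
    obtain ⟨y, hy0, hy⟩ := hpl.exists_eq_forall_mem_Icc_hasDerivWithinAt₀
    exact ⟨y, hy0, fun t ht => (hy t (Ioo_subset_Icc_self ht)).hasDerivAt (Icc_mem_nhds ht.1 ht.2)⟩
  choose a ha0 ha using hloc
  have hagree : ∀ m n : ℕ, m ≤ n → EqOn (a m) (a n) (Ioo (-(m + 1 : ℝ)) (m + 1)) := by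
    intro m n hmn
    have hmn' : (m : ℝ) ≤ n := by exact_mod_cast hmn
    have hm : (0 : ℝ) < m + 1 := by positivity
    refine ODE_solution_unique_of_mem_Ioo (v := fun _ => G) (s := fun _ => univ) (K := K)
      (t₀ := 0) (fun _ _ => hK.lipschitzOnWith) (by constructor <;> linarith)
      (fun t ht => ⟨ha m t ht, mem_univ _⟩)
      (fun t ht => ⟨ha n t ⟨by linarith [ht.1], by linarith [ht.2]⟩, mem_univ _⟩)
      ((ha0 m).trans (ha0 n).symm)
  have hmem : ∀ t : ℝ, ∀ n : ℕ, |t| ≤ n → t ∈ Ioo (-(n + 1 : ℝ)) (n + 1) := fun t n h => by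
    rw [abs_le] at h; constructor <;> linarith [h.1, h.2]
  -- The index is chosen so that `t` lies in the interior of the interval of its solution; near `t`
  -- the glued curve agrees with a single `a N`.
  refine ⟨fun t => a ⌈|t|⌉₊ t, by simpa using ha0 0, fun t => ?_⟩
  set N := ⌈|t|⌉₊ + 1 with hN
  have htN : |t| ≤ (N : ℝ) := (Nat.le_ceil _).trans (by rw [hN]; push_cast; linarith)
  have h1 : (fun t => a ⌈|t|⌉₊ t) =ᶠ[𝓝 t] a N := by
    have : ∀ᶠ s : ℝ in 𝓝 t, |s| < (N : ℝ) := by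
      refine (continuous_abs.tendsto t).eventually_lt_const ?_
      exact (Nat.le_ceil _).trans_lt (by rw [hN]; push_cast; linarith)
    filter_upwards [this] with s hs
    exact hagree _ _ (Nat.ceil_le.2 hs.le) (hmem s _ (Nat.le_ceil _))
  have h2 := (ha N t (hmem t N htN)).congr_of_eventuallyEq h1
  have h3 : a N t = a ⌈|t|⌉₊ t := h1.eq_of_nhds.symm
  rwa [h3] at h2

lemma hasDerivWithinAt_Ici {y : ℝ → V} {y' : V} {a b t : ℝ} (h : HasDerivWithinAt y y' (Icc a b) t)
    (ht : t ∈ Ico a b) : HasDerivWithinAt y y' (Ici t) t :=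
  h.mono_of_mem_nhdsWithin (Icc_mem_nhdsGE_of_mem ht)

/-- Uniqueness for vector fields which are Lipschitz on bounded sets. -/
lemma eqOn_of_hasDerivWithinAt {F : V → V} (hF : LipBdd F) {T : ℝ} {x y : ℝ → V}
    (hx : ∀ t ∈ Icc 0 T, HasDerivWithinAt x (F (x t)) (Icc 0 T) t)
    (hy : ∀ t ∈ Icc 0 T, HasDerivWithinAt y (F (y t)) (Icc 0 T) t) (h0 : x 0 = y 0) :
    EqOn x y (Icc 0 T) := by
  have hxc : ContinuousOn x (Icc 0 T) := fun t ht => (hx t ht).continuousWithinAt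
  have hyc : ContinuousOn y (Icc 0 T) := fun t ht => (hy t ht).continuousWithinAt
  obtain ⟨A, hA⟩ := isCompact_Icc.exists_bound_of_continuousOn hxc
  obtain ⟨B, hB⟩ := isCompact_Icc.exists_bound_of_continuousOn hyc
  obtain ⟨K, hK⟩ := hF.lipschitzOnWith (max A B)
  refine ODE_solution_unique_of_mem_Icc_right (v := fun _ => F)
    (s := fun _ => Metric.closedBall 0 (max A B)) (fun _ _ => hK) hxc
    (fun t ht => hasDerivWithinAt_Ici (hx t (Ico_subset_Icc_self ht)) ht) (fun t ht => ?_) hyc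
    (fun t ht => hasDerivWithinAt_Ici (hy t (Ico_subset_Icc_self ht)) ht) (fun t ht => ?_) h0
  · simpa using Or.inl (hA t (Ico_subset_Icc_self ht))
  · simpa using Or.inr (hB t (Ico_subset_Icc_self ht))

/-- Local existence, on an interval which depends only on the norm of the initial value. -/
lemma exists_local_solution [CompleteSpace V] {F : V → V} (hF : LipBdd F) (R : ℝ) :
    ∃ T : ℝ, 0 < T ∧ ∀ y₀ : V, ‖y₀‖ ≤ R → ∃ y : ℝ → V, y 0 = y₀ ∧
      ∀ t ∈ Icc 0 T, ‖y t‖ ≤ R + 1 ∧ HasDerivWithinAt y (F (y t)) (Icc 0 T) t := by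
  obtain ⟨K, M, hK, hM⟩ := hF.cutoff (R + 1)
  -- At speed at most `M` the curve moves by at most `1` in this time, so it stays within radius `R
  -- + 1`, where the cutoff is inactive.
  refine ⟨1 / (M + 1), by positivity, fun y₀ hy₀ => ?_⟩
  obtain ⟨y, hy0, hy⟩ := exists_global_solution hK hM y₀
  have hb : ∀ t ∈ Icc (0:ℝ) (1 / (M + 1)), ‖y t‖ ≤ R + 1 := by
    intro t ht
    have h1 := norm_image_sub_le_of_norm_deriv_le_segment' (f := y) (a := 0) (b := t) (C := M)
      (fun s _ => (hy s).hasDerivWithinAt) (fun s _ => hM _) t (right_mem_Icc.2 ht.1)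
    rw [hy0, sub_zero] at h1
    have h2 : (M : ℝ) * t ≤ 1 := by
      have h3 := ht.2
      rw [le_div_iff₀ (by positivity)] at h3
      nlinarith [ht.1, M.2]
    calc ‖y t‖ = ‖(y t - y₀) + y₀‖ := by rw [sub_add_cancel]
      _ ≤ ‖y t - y₀‖ + ‖y₀‖ := norm_add_le _ _
      _ ≤ R + 1 := by linarith
  refine ⟨y, hy0, fun t ht => ⟨hb t ht, ?_⟩⟩
  rw [← cutoff_eq (F := F) (hb t ht)]
  exact (hy t).hasDerivWithinAt

/-- Lipschitz dependence on the initial value. -/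
lemma norm_sub_le_of_hasDerivWithinAt {F : V → V} {R T : ℝ} {K : ℝ≥0}
    (hK : LipschitzOnWith K F (Metric.closedBall 0 R)) {x y : ℝ → V}
    (hx : ∀ t ∈ Icc 0 T, ‖x t‖ ≤ R ∧ HasDerivWithinAt x (F (x t)) (Icc 0 T) t)
    (hy : ∀ t ∈ Icc 0 T, ‖y t‖ ≤ R ∧ HasDerivWithinAt y (F (y t)) (Icc 0 T) t) {t : ℝ}
    (ht : t ∈ Icc 0 T) : ‖x t - y t‖ ≤ ‖x 0 - y 0‖ * Real.exp (K * t) := by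
  have h := dist_le_of_trajectories_ODE_of_mem (v := fun _ => F)
    (s := fun _ => Metric.closedBall 0 R) (K := K) (a := 0) (b := T) (f := x) (g := y)
    (fun _ _ => hK) (fun t ht => (hx t ht).2.continuousWithinAt)
    (fun t ht => hasDerivWithinAt_Ici (hx t (Ico_subset_Icc_self ht)).2 ht)
    (fun t ht => by simpa using (hx t (Ico_subset_Icc_self ht)).1)
    (fun t ht => (hy t ht).2.continuousWithinAt)
    (fun t ht => hasDerivWithinAt_Ici (hy t (Ico_subset_Icc_self ht)).2 ht)
    (fun t ht => by simpa using (hy t (Ico_subset_Icc_self ht)).1) le_rfl t ht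
  simpa [dist_eq_norm] using h

/-- The integral form of `y' = T (c t)`. -/
lemma eq_add_integral [CompleteSpace V] [CompleteSpace W] (k : W →L[ℝ] V) {c : ℝ → W}
    (hc : Continuous c) {T : ℝ} {y : ℝ → V}
    (hy : ∀ t ∈ Icc 0 T, HasDerivWithinAt y (k (c t)) (Icc 0 T) t) {t : ℝ} (ht : t ∈ Icc 0 T) :
    y t = y 0 + k (∫ τ in (0:ℝ)..t, c τ) := by
  rw [← k.intervalIntegral_comp_comm (hc.intervalIntegrable _ _),
    intervalIntegral.integral_eq_sub_of_hasDerivAt_of_le ht.1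
      (f := y) (fun s hs => ((hy s ⟨hs.1, hs.2.trans ht.2⟩).continuousWithinAt).mono
        (Icc_subset_Icc_right ht.2))
      (fun s hs => (hy s ⟨hs.1.le, (hs.2.trans_le ht.2).le⟩).hasDerivAt
        (Icc_mem_nhds hs.1 (hs.2.trans_le ht.2)))
      ((k.continuous.comp hc).intervalIntegrable _ _)]
  abel

end ODE

end

noncomputable section

/-! ### Local well-posedness -/

variable {L : ℝ} [hL : Fact (0 < L)]

section Limits

variable {Z ι : Type*} [NormedAddCommGroup Z] [NormedSpace ℝ Z]

omit hL in
lemma sobolevNorm_congr {s : ℝ} (hs : 0 ≤ s) {f g : ℝ → ℝ} (h : f =ᵐ[mu L] g) :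
    sobolevNorm L s f = sobolevNorm L s g := by
  rw [sobolevNorm_eq hs, sobolevNorm_eq hs, sobSq_congr hs h]

lemma tendsto_zero_of_sq {l : Filter ι} {a : ι → ℝ≥0∞}
    (h : Tendsto (fun i => a i ^ 2) l (𝓝 0)) : Tendsto a l (𝓝 0) := by
  have := (ENNReal.continuous_rpow_const (y := (1/2 : ℝ))).tendsto 0 |>.comp h
  rw [ENNReal.zero_rpow_of_pos (by norm_num)] at this
  refine this.congr fun i => ?_
  simp only [Function.comp]
  rw [← ENNReal.rpow_natCast, ← ENNReal.rpow_mul]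
  norm_num

lemma tendsto_sq_zero {l : Filter ι} {a : ι → ℝ≥0∞} (h : Tendsto a l (𝓝 0)) :
    Tendsto (fun i => a i ^ 2) l (𝓝 0) := by
  simpa using ENNReal.Tendsto.pow (n := 2) h

lemma tendsto_zero_of_le_mul {l : Filter ι} {a b : ι → ℝ≥0∞} {C : ℝ≥0}
    (hab : ∀ᶠ i in l, a i ≤ C * b i) (h : Tendsto b l (𝓝 0)) : Tendsto a l (𝓝 0) := by
  have h1 := ENNReal.Tendsto.const_mul h (Or.inr (ENNReal.coe_ne_top (r := C)))
  rw [mul_zero] at h1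
  exact tendsto_of_tendsto_of_tendsto_of_le_of_le' tendsto_const_nhds h1
    (Eventually.of_forall fun _ => zero_le) hab

omit hL in
lemma EmbedsInto.tendsto {j : Z →L[ℝ] LTwo L} {s : ℝ} (hs : 0 ≤ s) (hj : EmbedsInto j s)
    {l : Filter ι} {z : ι → Z} (hz : Tendsto z l (𝓝 0)) {f : ι → ℝ → ℝ}
    (hf : ∀ᶠ i in l, f i =ᵐ[mu L] j (z i)) :
    Tendsto (fun i => sobolevNorm L s (f i)) l (𝓝 0) := by
  obtain ⟨C, hC⟩ := hj
  refine tendsto_zero_of_sq (tendsto_zero_of_le_mul (C := C) (b := fun i => ‖z i‖ₑ ^ 2) ?_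
    (tendsto_sq_zero ?_))
  · filter_upwards [hf] with i hi
    rw [sobolevNorm_sq hs, sobSq_congr hs hi]
    exact (hC (z i)).2
  · simpa [Function.comp_def] using (continuous_enorm.tendsto (0 : Z)).comp hz

omit hL in
lemma EmbedsFrom.tendsto {j : Z →L[ℝ] LTwo L} {s : ℝ} (hs : 0 ≤ s) (hj : EmbedsFrom j s)
    {l : Filter ι} {z : ι → Z} {f : ι → ℝ → ℝ}
    (hf : ∀ᶠ i in l, MemSobolev L s (f i) ∧ f i =ᵐ[mu L] j (z i))
    (h : Tendsto (fun i => sobolevNorm L s (f i)) l (𝓝 0)) : Tendsto z l (𝓝 0) := by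
  obtain ⟨-, C, hC⟩ := hj
  have h1 : Tendsto (fun i => ‖z i‖ₑ) l (𝓝 0) := by
    refine tendsto_zero_of_sq (tendsto_zero_of_le_mul (C := C) ?_ (tendsto_sq_zero h))
    filter_upwards [hf] with i hi
    rw [sobolevNorm_sq hs, sobSq_congr hs hi.2]
    exact hC _ (memSobolev_congr hs hi.2 hi.1)
  rw [tendsto_zero_iff_norm_tendsto_zero]
  have h2 := (ENNReal.tendsto_toReal ENNReal.zero_ne_top).comp h1
  simpa [Function.comp_def] using h2

end Limits

omit hL in
lemma SolvesElliptic.congr {α β : ℝ} {u w v : ℝ → ℝ} (h : SolvesElliptic L α β u v)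
    (huw : EqOn u w (Icc 0 L)) (h0 : (0:ℝ) ∈ Icc 0 L) (hL' : L ∈ Icc 0 L) :
    SolvesElliptic L α β w v := by
  obtain ⟨h1, h2, h3, h4⟩ := h
  refine ⟨h1, fun φ hφ => (h2 φ hφ).trans (setIntegral_congr_fun measurableSet_Ioo fun x hx => ?_),
    by rw [h3, huw h0], by rw [h4, huw hL']⟩
  simp only [huw (Ioo_subset_Icc_self hx)]

omit hL in
lemma ae_eq_of_eqOn {f g : ℝ → ℝ} (h : EqOn f g (Icc 0 L)) : f =ᵐ[mu L] g := by
  filter_upwards [ae_mem_Ioo] with x hx using h (Ioo_subset_Icc_self hx)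

/-- Solutions of the boundary value problem are integral curves in `C[0,L]`. -/
lemma IsSolution.exists_curve {α β s T : ℝ} (hs : 1 / 2 < s) {u₀ : ℝ → ℝ} {u : ℝ → ℝ → ℝ}
    (h : IsSolution L α β s T u₀ u) : ∃ X : ℝ → ContSpace L,
      (∀ t ∈ Icc 0 T, EqOn (u t) (ext (X t)) (Icc 0 L)) ∧
      ∀ t ∈ Icc 0 T, HasDerivWithinAt X (vMap α β (X t)) (Icc 0 T) t := by
  classical
  obtain ⟨-, h1, h2, v, h3, h4, h5⟩ := h
  have hs0 : 0 ≤ s := by linarith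
  let X : ℝ → ContSpace L := fun t =>
    -- The default `0` is never used for times in `[0,T]`.
    if h : ContinuousOn (u t) (Icc 0 L) then restr (u t) h else 0
  have hX : ∀ t ∈ Icc 0 T, EqOn (u t) (ext (X t)) (Icc 0 L) := fun t ht x hx => by
    simp only [X, dif_pos (h1 t ht)]
    rw [ext_restr _ _ hx]
  refine ⟨X, hX, fun t ht => ?_⟩
  have hv := (((h5 t ht).congr (hX t ht) zero_mem L_mem)).eqOn
  -- Convergence of difference quotients in `H^s` becomes uniform convergence because `s > 1/2`.
  rw [hasDerivWithinAt_iff_tendsto_slope, ← tendsto_sub_nhds_zero_iff]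
  refine (embedsFrom_inc hs).tendsto hs0 ?_ (h4 t ht)
  filter_upwards [self_mem_nhdsWithin] with τ hτ
  refine ⟨(MemSobolev.const_mul hs0 (((h2 τ hτ.1).1.sub hs0 (h2 t ht).1)) _).sub hs0 (h3 t ht).1,
    EventuallyEq.trans (ae_eq_of_eqOn fun x hx => ?_) (inc_ae _).symm⟩
  simp only [slope_def_module, ext_sub, ext_smul, Pi.sub_apply, Pi.smul_apply, smul_eq_mul,
    hX τ hτ.1 hx, hX t ht hx, hv hx]

/-- For every `s > 1/2`, uniqueness is that of the ODE in `C[0,L]`, where `vMap` is Lipschitz on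
bounded sets. -/
lemma IsSolution.eqOn {α β s T : ℝ} (hs : 1 / 2 < s) (hT : 0 < T) {u₀ : ℝ → ℝ} {u w : ℝ → ℝ → ℝ}
    (hu : IsSolution L α β s T u₀ u) (hw : IsSolution L α β s T u₀ w) {t : ℝ} (ht : t ∈ Icc 0 T) :
    EqOn (u t) (w t) (Icc 0 L) := by
  obtain ⟨X, hX, hX'⟩ := hu.exists_curve hs
  obtain ⟨X₂, hX₂, hX₂'⟩ := hw.exists_curve hs
  have h0 : (0 : ℝ) ∈ Icc 0 T := ⟨le_rfl, hT.le⟩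
  have h : EqOn X X₂ (Icc 0 T) := by
    refine eqOn_of_hasDerivWithinAt (lipBdd_vMap α β) hX' hX₂' (ext_injOn ?_)
    intro x hx
    rw [← hX 0 h0 hx, ← hX₂ 0 h0 hx]
    exact eqOn_of_ae_eq (hu.2.1 0 h0) (hw.2.1 0 h0) (hu.1.trans hw.1.symm) hx
  intro x hx
  rw [hX t ht hx, hX₂ t ht hx, h ht]

/-- A Banach space `Y` of continuous functions which contains `H^s(0,L)`, such that
`u ↦ u_t` maps `Y` to a space `Z` which is contained in `H^s(0,L)`. -/
structure SolutionModel (L α β s : ℝ) [Fact (0 < L)] (Y Z : Type*) [NormedAddCommGroup Y]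
    [NormedSpace ℝ Y] [NormedAddCommGroup Z] [NormedSpace ℝ Z] where
  /-- The inclusion of `Y` into the continuous functions. -/
  i : Y →L[ℝ] ContSpace L
  /-- The inclusion of `Z` into `Y`. -/
  k : Z →L[ℝ] Y
  /-- The vector field `u ↦ u_t`. -/
  F : Y → Z
  lipBdd : LipBdd F
  i_k_F : ∀ y, i (k (F y)) = vMap α β (i y)
  embedsFrom : EmbedsFrom (inc ∘L i) s
  embedsInto : EmbedsInto (inc ∘L i ∘L k) s

namespace SolutionModel

variable {α β s : ℝ} {Y Z : Type*} [NormedAddCommGroup Y]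
    [NormedSpace ℝ Y] [NormedAddCommGroup Z] [NormedSpace ℝ Z] [CompleteSpace Y] [CompleteSpace Z]

/-- Write `y t = y 0 + k (w t)` with `w` a continuously differentiable curve in `Z`. The initial
value is in `H^s` by assumption, and all increments come from `Z`, so continuity and
differentiability in `H^s` are inherited from `w`. -/
lemma isSolution (M : SolutionModel L α β s Y Z) (hs : 0 ≤ s) {T : ℝ} (hT : 0 < T) {u₀ : ℝ → ℝ}
    (hu₀ : MemSobolev L s u₀) {y : ℝ → Y} (hy0 : ext (M.i (y 0)) =ᵐ[mu L] u₀)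
    (hy : ∀ t ∈ Icc 0 T, HasDerivWithinAt y (M.k (M.F (y t))) (Icc 0 T) t) :
    IsSolution L α β s T u₀ fun t => ext (M.i (y t)) := by
  -- Freezing time outside `[0,T]` makes `c` continuous on the whole line, so that its primitive is
  -- differentiable at the endpoints too.
  set c : ℝ → Z := fun t => M.F (y (projIcc 0 T hT.le t)) with hc
  have hyc : ContinuousOn y (Icc 0 T) := fun t ht => (hy t ht).continuousWithinAt
  have hcc : Continuous c :=
    M.lipBdd.continuous.comp (hyc.comp_continuous (by fun_prop) fun t => (projIcc 0 T hT.le t).2)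
  have hcF : ∀ t ∈ Icc 0 T, c t = M.F (y t) := fun t ht => by rw [hc]; simp [projIcc_of_mem _ ht]
  set w : ℝ → Z := fun t => ∫ τ in (0:ℝ)..t, c τ with hw
  have hwd : ∀ t, HasDerivAt w (c t) t := fun t => (hcc.integral_hasStrictDerivAt 0 t).hasDerivAt
  have hyw : ∀ t ∈ Icc 0 T, y t = y 0 + M.k (w t) := fun t ht =>
    eq_add_integral M.k hcc (fun t ht => by rw [hcF t ht]; exact hy t ht) ht
  obtain ⟨C, hC⟩ := M.embedsInto
  have hmem : ∀ z : Z, MemSobolev L s (ext (M.i (M.k z))) := fun z =>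
    memSobolev_congr hs (inc_ae _) (hC z).1
  refine ⟨hy0, fun t _ => (continuous_ext _).continuousOn, fun t ht => ⟨?_, ?_⟩,
    fun t => ext (M.i (M.k (c t))), fun t ht => ⟨hmem _, ?_⟩, fun t ht => ?_, fun t ht => ?_⟩
  · have : ext (M.i (y t)) = ext (M.i (y 0)) + ext (M.i (M.k (w t))) := by
      rw [hyw t ht, map_add]; rfl
    beta_reduce
    rw [this]
    exact (memSobolev_congr hs hy0.symm hu₀).add hs (hmem _)
  · refine M.embedsInto.tendsto hs (z := fun τ => w τ - w t) ?_ ?_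
    · rw [← sub_self (w t)]
      exact ((hwd t).continuousAt.continuousWithinAt.tendsto.sub tendsto_const_nhds)
    · filter_upwards [self_mem_nhdsWithin] with τ hτ
      refine EventuallyEq.trans (Eventually.of_forall fun x => ?_) (inc_ae (M.i (M.k (w τ - w t)))).symm
      simp only [hyw t ht, hyw τ hτ, map_add, map_sub, Pi.sub_apply, ext_add, ext_sub]
      ring
  · refine M.embedsInto.tendsto hs (z := fun τ => c τ - c t) ?_ ?_
    · rw [← sub_self (c t)]
      exact (hcc.continuousWithinAt.tendsto.sub tendsto_const_nhds)
    · filter_upwards [self_mem_nhdsWithin] with τ hτ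
      refine EventuallyEq.trans (Eventually.of_forall fun x => ?_) (inc_ae (M.i (M.k (c τ - c t)))).symm
      simp only [map_sub, Pi.sub_apply, ext_sub]
  · refine M.embedsInto.tendsto hs (z := fun τ => slope w t τ - c t) ?_ ?_
    · rw [← sub_self (c t)]
      exact (hasDerivWithinAt_iff_tendsto_slope.1 (hwd t).hasDerivWithinAt).sub tendsto_const_nhds
    · filter_upwards [self_mem_nhdsWithin] with τ hτ
      refine EventuallyEq.trans (Eventually.of_forall fun x => ?_) (inc_ae (M.i (M.k (slope w t τ - c t)))).symm
      simp only [slope_def_module, hyw t ht, hyw τ hτ.1, map_add, map_sub, map_smul, Pi.sub_apply,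
        Pi.smul_apply, smul_eq_mul, ext_add, ext_sub, ext_smul]
      ring
  · simp only [hcF t ht, M.i_k_F]
    exact solvesElliptic_vMap _ _ _

omit [CompleteSpace Y] [CompleteSpace Z] in
lemma exists_initial (M : SolutionModel L α β s Y Z) (hs : 0 ≤ s) (ρ : ℝ≥0) :
    ∃ R : ℝ, ∀ u₀, MemSobolev L s u₀ → sobolevNorm L s u₀ ≤ ρ →
      ∃ y₀ : Y, ‖y₀‖ ≤ R ∧ ext (M.i y₀) =ᵐ[mu L] u₀ := by
  obtain ⟨h1, C, hC⟩ := M.embedsFrom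
  -- `C + 1` avoids a square root: `C ≤ (C + 1)²`.
  refine ⟨(C + 1) * ρ, fun u₀ hu hρ => ?_⟩
  obtain ⟨y₀, hy₀⟩ := h1 u₀ hu
  refine ⟨y₀, ?_, (inc_ae _).symm.trans hy₀⟩
  have h2 := hC y₀ (memSobolev_congr hs hy₀.symm hu)
  rw [sobSq_congr hs hy₀, ← sobolevNorm_sq hs] at h2
  have h3 : ‖y₀‖ₑ ^ 2 ≤ C * (ρ : ℝ≥0∞) ^ 2 := h2.trans (by gcongr)
  have h4 : ‖y₀‖ ^ 2 ≤ C * (ρ : ℝ) ^ 2 := by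
    rw [enorm_eq_nnnorm] at h3
    exact_mod_cast h3
  refine abs_le_of_sq_le_sq' (h4.trans ?_) (by positivity) |>.2
  rw [mul_pow]
  gcongr
  nlinarith [C.2]

/-- Two solutions differ by `(u₀ - w₀) + k z` with `z` in `Z` the integral of the difference of the
fields. Gronwall in `Y` bounds `z` by the initial difference in `Y`, which the norm of `H^s`
controls. -/
lemma wellPosed (M : SolutionModel L α β s Y Z) (hs : 1 / 2 < s) (ρ : ℝ≥0) :
    ∃ T : ℝ, 0 < T ∧ ∃ C : ℝ≥0,
      (∀ u₀ : ℝ → ℝ, MemSobolev L s u₀ → sobolevNorm L s u₀ ≤ ρ →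
        ∃ u : ℝ → ℝ → ℝ, IsSolution L α β s T u₀ u) ∧
      (∀ (u₀ w₀ : ℝ → ℝ) (u w : ℝ → ℝ → ℝ),
        MemSobolev L s u₀ → sobolevNorm L s u₀ ≤ ρ →
        MemSobolev L s w₀ → sobolevNorm L s w₀ ≤ ρ →
        IsSolution L α β s T u₀ u → IsSolution L α β s T w₀ w →
          ∀ t ∈ Icc 0 T, sobolevNorm L s (u t - w t) ≤ C * sobolevNorm L s (u₀ - w₀)) := by
  have hs0 : 0 ≤ s := by linarith
  obtain ⟨R, hR⟩ := M.exists_initial hs0 ρ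
  obtain ⟨T, hT, hex⟩ := exists_local_solution (M.lipBdd.clm M.k) R
  obtain ⟨K, hK⟩ := (M.lipBdd.clm M.k).lipschitzOnWith (R + 1)
  obtain ⟨K', hK'⟩ := M.lipBdd.lipschitzOnWith (R + 1)
  obtain ⟨-, C, hC⟩ := M.embedsFrom
  obtain ⟨C', hC'⟩ := M.embedsInto
  -- Lipschitz constant of the field into `Z`, times the Gronwall factor, times the length of the
  -- interval.
  set B : ℝ≥0 := K' * (Real.exp (K * T)).toNNReal * T.toNNReal with hB
  refine ⟨T, hT, 2 * (1 + C' * B ^ 2 * C), fun u₀ hu hρ => ?_, ?_⟩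
  · obtain ⟨y₀, hy₀, hy⟩ := hR u₀ hu hρ
    obtain ⟨y, hy0, hy'⟩ := hex y₀ hy₀
    exact ⟨_, M.isSolution hs0 hT hu (hy0 ▸ hy) fun t ht => (hy' t ht).2⟩
  · intro u₀ w₀ u w hu huρ hw hwρ hus hws t ht
    have h0 : (0:ℝ) ∈ Icc 0 T := ⟨le_rfl, hT.le⟩
    obtain ⟨x₀, hx₀, hx⟩ := hR u₀ hu huρ
    obtain ⟨x, hx0, hx'⟩ := hex x₀ hx₀
    obtain ⟨y₀, hy₀, hy⟩ := hR w₀ hw hwρ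
    obtain ⟨y, hy0, hy'⟩ := hex y₀ hy₀
    -- By uniqueness, arbitrary solutions may be replaced by the ones built from integral curves in
    -- `Y`.
    have hux := hus.eqOn hs hT (M.isSolution hs0 hT hu (hx0 ▸ hx) fun t ht => (hx' t ht).2) ht
    have hwy := hws.eqOn hs hT (M.isSolution hs0 hT hw (hy0 ▸ hy) fun t ht => (hy' t ht).2) ht
    have hlip := fun τ hτ => norm_sub_le_of_hasDerivWithinAt hK hx' hy' (t := τ) hτ
    -- the integral representation
    set p := fun t => projIcc 0 T hT.le t
    have hcont : ∀ z : ℝ → Y, (∀ t ∈ Icc 0 T, ‖z t‖ ≤ R + 1 ∧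
        HasDerivWithinAt z (M.k (M.F (z t))) (Icc 0 T) t) →
        Continuous (fun t => M.F (z (p t))) ∧
          z t = z 0 + M.k (∫ τ in (0:ℝ)..t, M.F (z (p τ))) := by
      intro z hz
      have hzc : ContinuousOn z (Icc 0 T) := fun t ht => (hz t ht).2.continuousWithinAt
      have hcc : Continuous fun t => M.F (z (p t)) := M.lipBdd.continuous.comp
        (hzc.comp_continuous (by fun_prop) fun t => (p t).2)
      refine ⟨hcc, eq_add_integral M.k hcc (fun t ht => ?_) ht⟩
      simp only [p, projIcc_of_mem _ ht]
      exact (hz t ht).2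
    obtain ⟨c1, e1⟩ := hcont x hx'
    obtain ⟨c2, e2⟩ := hcont y hy'
    set z := ∫ τ in (0:ℝ)..t, (M.F (x (p τ)) - M.F (y (p τ))) with hz
    have hzB : ‖z‖ ≤ B * ‖x 0 - y 0‖ := by
      have h1 : ∀ τ ∈ uIoc 0 t, ‖M.F (x (p τ)) - M.F (y (p τ))‖
          ≤ K' * (‖x 0 - y 0‖ * Real.exp (K * T)) := by
        intro τ _
        have hm := (p τ).2
        have h2 := hK'.dist_le_mul (x (p τ)) (by simpa using (hx' _ hm).1) (y (p τ))
          (by simpa using (hy' _ hm).1)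
        rw [dist_eq_norm, dist_eq_norm] at h2
        refine h2.trans ?_
        gcongr
        refine (hlip _ hm).trans ?_
        gcongr
        exact hm.2
      have h2 := intervalIntegral.norm_integral_le_of_norm_le_const h1
      refine h2.trans ?_
      rw [sub_zero, abs_of_nonneg ht.1, hB]
      push_cast
      rw [Real.coe_toNNReal _ hT.le, Real.coe_toNNReal _ (Real.exp_pos _).le]
      calc _ ≤ K' * (‖x 0 - y 0‖ * Real.exp (K * T)) * T := by gcongr; exact ht.2
        _ = _ := by ring
    have hdiff : u t - w t =ᵐ[mu L] (u₀ - w₀) + ext (M.i (M.k z)) := by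
      have h1 := hx0 ▸ hx
      have h2 := hy0 ▸ hy
      filter_upwards [h1, h2, ae_eq_of_eqOn hux, ae_eq_of_eqOn hwy] with a h1 h2 h3 h4
      rw [Pi.sub_apply, h3, h4, Pi.add_apply, Pi.sub_apply, ← h1, ← h2, e1, e2, hz,
        intervalIntegral.integral_sub (c1.intervalIntegrable _ _) (c2.intervalIntegrable _ _)]
      simp only [map_add, map_sub, ext_add, ext_sub]
      ring
    have hmz := memSobolev_congr hs0 (inc_ae _) (hC' z).1
    have hsz : sobSq L s (ext (M.i (M.k z))) ≤ C' * ‖z‖ₑ ^ 2 := by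
      rw [← sobSq_congr hs0 (inc_ae _)]; exact (hC' z).2
    have hxy : (inc ∘L M.i) (x 0 - y 0) =ᵐ[mu L] u₀ - w₀ := by
      have h1 := hx0 ▸ hx
      have h2 := hy0 ▸ hy
      refine (inc_ae (M.i (x 0 - y 0))).trans ?_
      filter_upwards [h1, h2] with a h1 h2
      rw [map_sub, ext_sub, h1, h2, Pi.sub_apply]
    have hd : ‖x 0 - y 0‖ₑ ^ 2 ≤ C * sobSq L s (u₀ - w₀) := by
      rw [← sobSq_congr hs0 hxy]
      exact hC _ (memSobolev_congr hs0 hxy.symm (hu.sub hs0 hw))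
    have hzB' : ‖z‖ₑ ≤ B * ‖x 0 - y 0‖ₑ := by
      simp only [enorm_eq_nnnorm]
      exact_mod_cast hzB
    rw [sobolevNorm_congr hs0 hdiff]
    -- Squares are compared, and the resulting constant, being at least `1`, is bounded by its own
    -- square.
    have key : sobolevNorm L s (u₀ - w₀ + ext (M.i (M.k z))) ^ 2
        ≤ ((2 * (1 + C' * B ^ 2 * C) : ℝ≥0) * sobolevNorm L s (u₀ - w₀)) ^ 2 := by
      rw [mul_pow, sobolevNorm_sq hs0, sobolevNorm_sq hs0]
      refine (sobSq_add_le hs0 (hu.sub hs0 hw) hmz).trans ?_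
      set S := sobSq L s (u₀ - w₀)
      calc 2 * S + 2 * sobSq L s (ext (M.i (M.k z)))
          ≤ 2 * S + 2 * (C' * (B ^ 2 * (C * S))) := by
            gcongr
            refine hsz.trans ?_
            gcongr
            refine (pow_le_pow_left' hzB' 2).trans ?_
            rw [mul_pow]
            gcongr
        _ = ((2 * (1 + C' * B ^ 2 * C) : ℝ≥0) : ℝ≥0∞) * S := by push_cast; ring
        _ ≤ _ := by
            gcongr
            rw [← ENNReal.coe_pow, ENNReal.coe_le_coe]
            have : (1 : ℝ≥0) ≤ 2 * (1 + C' * B ^ 2 * C) := by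
              rw [← NNReal.coe_le_coe]; push_cast
              nlinarith [show (0:ℝ) ≤ C' * B ^ 2 * C by positivity]
            exact le_self_pow₀ this (by norm_num)
    exact (ENNReal.pow_le_pow_left_iff (by norm_num)).1 key

end SolutionModel

/-- The model for `1/2 < s ≤ 1`. -/
def lowModel (α β : ℝ) {s : ℝ} (hs : 1 / 2 < s) (hs' : s ≤ 1) :
    SolutionModel L α β s (ContSpace L) (HOne L) where
  i := ContinuousLinearMap.id ℝ _
  k := prim
  F := fieldOne α β
  lipBdd := lipBdd_fieldOne α β
  i_k_F := fun y => prim_fieldOne α β y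
  embedsFrom := embedsFrom_inc hs
  embedsInto := embedsInto_hOne (by linarith) hs'

/-- The three models cover `(1/2,1]`, `(1,2]` and `(2,3]`: the curve lives in `C`, `H¹` or `H²`, and
its increments lie one order higher. -/
lemma exists_wellPosed (α β : ℝ) {s : ℝ} (hs : 1 / 2 < s) (hs' : s < 5 / 2) (ρ : ℝ≥0) :
    ∃ T : ℝ, 0 < T ∧ ∃ C : ℝ≥0,
      (∀ u₀ : ℝ → ℝ, MemSobolev L s u₀ → sobolevNorm L s u₀ ≤ ρ →
        ∃ u : ℝ → ℝ → ℝ, IsSolution L α β s T u₀ u) ∧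
      (∀ (u₀ w₀ : ℝ → ℝ) (u w : ℝ → ℝ → ℝ),
        MemSobolev L s u₀ → sobolevNorm L s u₀ ≤ ρ →
        MemSobolev L s w₀ → sobolevNorm L s w₀ ≤ ρ →
        IsSolution L α β s T u₀ u → IsSolution L α β s T w₀ w →
          ∀ t ∈ Icc 0 T, sobolevNorm L s (u t - w t) ≤ C * sobolevNorm L s (u₀ - w₀)) := by
  rcases le_or_gt s 1 with h1 | h1
  · exact (lowModel α β hs h1).wellPosed hs ρ
  rcases le_or_gt s 2 with h2 | h2
  · let M : SolutionModel L α β s (HOne L) (HTwo L) :=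
      { i := prim
        k := twoToOne
        F := fieldTwo α β
        lipBdd := lipBdd_fieldTwo α β
        i_k_F := fun y => by rw [twoToOne_fieldTwo, prim_fieldOne]
        embedsFrom := embedsFrom_hOne h1.le
        embedsInto := embedsInto_hTwo h1 h2 }
    exact M.wellPosed hs ρ
  · let M : SolutionModel L α β s (HTwo L) (HThree L) :=
      { i := prim ∘L twoToOne
        k := threeToTwo
        F := fieldThree α β
        lipBdd := lipBdd_fieldThree α β
        i_k_F := fun y => by
          rw [threeToTwo_fieldThree, ContinuousLinearMap.comp_apply, twoToOne_fieldTwo,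
            prim_fieldOne]
          rfl
        embedsFrom := embedsFrom_hTwo h2.le
        embedsInto := embedsInto_hThree h2 (by linarith) }
    exact M.wellPosed hs ρ

end

noncomputable section

/-! ### The energy and global solutions -/

variable {L : ℝ} [hL : Fact (0 < L)]

/-- The square of the norm of `H^1(0,L)`. -/
def energy (e : HOne L) : ℝ := ‖inc (prim e)‖ ^ 2 + ‖e.2‖ ^ 2

lemma energy_nonneg (e : HOne L) : 0 ≤ energy e := by unfold energy; positivity

lemma sobSq_one_prim (e : HOne L) : sobSq L 1 (ext (prim e)) = ENNReal.ofReal (energy e) := by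
  have h1 := (hasWeakDeriv_prim e).weakDeriv_ae
  have h2 := sobSq_add_one (L := L) le_rfl (ext (prim e))
  rw [zero_add, sobSq_of_lt_one le_rfl zero_lt_one, normSq_congr h1, normSq_eq_enorm_sq,
    ← normSq_congr (inc_ae (prim e)), normSq_eq_enorm_sq] at h2
  rw [h2, energy, ENNReal.ofReal_add (by positivity) (by positivity),
    ENNReal.ofReal_pow (norm_nonneg _), ENNReal.ofReal_pow (norm_nonneg _), ofReal_norm, ofReal_norm,
    gagliardoSq, if_pos rfl, add_zero]

lemma sobolevNorm_one_prim (e : HOne L) :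
    sobolevNorm L 1 (ext (prim e)) = ENNReal.ofReal (energy e) ^ (1 / 2 : ℝ) := by
  rw [sobolevNorm_eq zero_le_one, sobSq_one_prim]

/-- The energy dominates the norm of the pair `(u(0), u')`, through the two-sided embedding of the
model space at order `1`. -/
lemma exists_norm_le_of_energy_le (M : ℝ) : ∃ R : ℝ, ∀ e : HOne L, energy e ≤ M → ‖e‖ ≤ R := by
  obtain ⟨-, C, hC⟩ := embedsFrom_hOne (L := L) (le_refl 1)
  obtain ⟨C', hC'⟩ := embedsInto_hOne (L := L) zero_lt_one le_rfl
  refine ⟨√(C * M), fun e he => Real.le_sqrt_of_sq_le ?_⟩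
  have h1 := hC e (hC' e).1
  rw [hOne_apply, sobSq_congr zero_le_one (inc_ae _), sobSq_one_prim] at h1
  have h2 : ENNReal.ofReal (‖e‖ ^ 2) ≤ ENNReal.ofReal (C * energy e) := by
    rwa [ENNReal.ofReal_mul (NNReal.coe_nonneg C), ENNReal.ofReal_coe_nnreal, ENNReal.ofReal_pow (norm_nonneg _),
      ofReal_norm]
  have h3 := (ENNReal.ofReal_le_ofReal_iff (mul_nonneg C.2 (energy_nonneg e))).1 h2
  exact h3.trans (mul_le_mul_of_nonneg_left he C.2)

/-- Integration by parts for the energy. -/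
lemma inner_field (α β : ℝ) (e : HOne L) :
    inner ℝ (inc (prim e)) (inc (vMap α β (prim e)))
        + inner ℝ e.2 (inc (gMap α β (prim e) + flux (prim e)))
      = (β - 1 / 2) * ext (prim e) L ^ 2 - (α - 1 / 2) * ext (prim e) 0 ^ 2 := by
  obtain ⟨a, p⟩ := e
  set u := prim (a, p) with hu
  -- The three identities integrate `(u g)'`, `(u u)'` and `(u u²)'`. The cubic boundary terms are
  -- `-1/6` from `bdry` and `+1/6` from `∫ u' u²/2`, and cancel.
  have h1 := prim_pairing hu (gMap_eq α β u)
  have h2 := prim_pairing hu hu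
  have hsq : u * u = prim (a * a, mulL u p + mulL u p) := prim_mul a a p p
  have h3 := prim_pairing hu hsq
  have c1 := real_inner_comm p (inc (gMap α β u))
  have c2 := real_inner_comm p (inc u)
  have c3 := real_inner_comm p (inc (u * u))
  have c4 : inner ℝ (inc u) (mulL u p) = inner ℝ (inc (u * u)) p := by
    rw [← inner_mulL, mulL_inc]
  rw [inner_add_right, c4] at h3
  rw [gMap_zero, gMap_L, bdry, bdry] at h1
  rw [flux, map_add, map_add, map_smul, inner_add_right, inner_add_right, inner_smul_right]
  simp only [ext_mul] at h3
  linarith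

lemma hasDerivAt_energy {y : ℝ → HOne L} {y' : HOne L} {t : ℝ} (h : HasDerivAt y y' t) :
    HasDerivAt (fun t => energy (y t))
      (2 * (inner ℝ (inc (prim (y t))) (inc (prim y')) + inner ℝ (y t).2 y'.2)) t := by
  have h1 := ((inc ∘L prim (L := L)).hasFDerivAt.comp_hasDerivAt t h).norm_sq
  have h2 := ((ContinuousLinearMap.snd ℝ ℝ (LTwo L)).hasFDerivAt.comp_hasDerivAt t h).norm_sq
  rw [mul_add]
  exact h1.add h2

/-- `y` is a bounded integral curve in `H^1(0,L)`, for positive times. -/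
structure IsGlobalCurve (α β : ℝ) (y : ℝ → HOne L) : Prop where
  hasDerivAt : ∀ t, 0 ≤ t → HasDerivAt y (fieldOne α β (prim (y t))) t
  bounded : ∃ R, ∀ t, 0 ≤ t → ‖y t‖ ≤ R

/-- The scalar `c` is there for the truncated field, a multiple of the true one at each point. -/
lemma hasDerivAt_energy_smul (α β c : ℝ) {y : ℝ → HOne L} {t : ℝ}
    (h : HasDerivAt y (c • fieldOne α β (prim (y t))) t) :
    HasDerivAt (fun t => energy (y t))
      (2 * (c * ((β - 1 / 2) * ext (prim (y t)) L ^ 2 - (α - 1 / 2) * ext (prim (y t)) 0 ^ 2))) t := by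
  convert hasDerivAt_energy h using 2
  rw [← inner_field, map_smul, map_smul, prim_fieldOne, Prod.smul_snd, inner_smul_right,
    inner_smul_right, mul_add]
  rfl

/-- Truncation multiplies the field by a nonnegative scalar and so keeps the energy nonincreasing.
With `R` taken from the initial energy, the truncated curve stays for `t ≥ 0` where the truncation
is inactive; no continuation argument is needed. -/
lemma exists_isGlobalCurve {α β : ℝ} (hα : 1 / 2 < α) (hβ : β < 1 / 2) (e : HOne L) :
    ∃ y : ℝ → HOne L, y 0 = e ∧ IsGlobalCurve α β y := by
  obtain ⟨R, hR⟩ := exists_norm_le_of_energy_le (L := L) (energy e)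
  have hF : LipBdd fun e : HOne L => fieldOne α β (prim e) :=
    (lipBdd_fieldOne α β).comp (lipBdd_clm prim)
  obtain ⟨K, M, hK, hM⟩ := hF.cutoff R
  obtain ⟨y, hy0, hy⟩ := exists_global_solution hK hM e
  have hanti : Antitone fun t => energy (y t) := by
    have hd := fun t => hasDerivAt_energy_smul α β _ (hy t)
    refine antitone_of_deriv_nonpos (fun t => (hd t).differentiableAt) fun t => ?_
    rw [(hd t).deriv]
    have h1 : 0 ≤ max 0 (min 1 (R + 1 - ‖y t‖)) := le_max_left _ _
    have h2 : (β - 1 / 2) * ext (prim (y t)) L ^ 2 - (α - 1 / 2) * ext (prim (y t)) 0 ^ 2 ≤ 0 := by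
      nlinarith [sq_nonneg (ext (prim (y t)) L), sq_nonneg (ext (prim (y t)) 0)]
    nlinarith
  have hb : ∀ t, 0 ≤ t → ‖y t‖ ≤ R := fun t ht => hR _ (by
    have := hanti ht
    simpa only [hy0] using this)
  refine ⟨y, hy0, fun t ht => ?_, R, hb⟩
  have h := hy t
  rwa [cutoff_eq (hb t ht)] at h

namespace IsGlobalCurve

variable {α β : ℝ} {y : ℝ → HOne L}

lemma hasDerivAt_energy (hy : IsGlobalCurve α β y) {t : ℝ} (ht : 0 ≤ t) :
    HasDerivAt (fun t => energy (y t))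
      (2 * ((β - 1 / 2) * ext (prim (y t)) L ^ 2 - (α - 1 / 2) * ext (prim (y t)) 0 ^ 2)) t := by
  have := hasDerivAt_energy_smul α β 1 (by simpa using hy.hasDerivAt t ht)
  simpa using this

lemma antitoneOn_energy (hy : IsGlobalCurve α β y) (hα : 1 / 2 < α) (hβ : β < 1 / 2) :
    AntitoneOn (fun t => energy (y t)) (Ici 0) := by
  refine antitoneOn_of_deriv_nonpos (convex_Ici 0)
    (fun t ht => (hy.hasDerivAt_energy ht).continuousAt.continuousWithinAt)
    (fun t ht => (hy.hasDerivAt_energy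
      (interior_subset ht)).differentiableAt.differentiableWithinAt) fun t ht => ?_
  rw [(hy.hasDerivAt_energy (interior_subset ht)).deriv]
  nlinarith [sq_nonneg (ext (prim (y t)) L), sq_nonneg (ext (prim (y t)) 0)]

lemma antitoneOn_sobolevNorm (hy : IsGlobalCurve α β y) (hα : 1 / 2 < α) (hβ : β < 1 / 2) :
    AntitoneOn (fun t => sobolevNorm L 1 (ext (prim (y t)))) (Ici 0) := fun t ht t' ht' h => by
  simp only [sobolevNorm_one_prim]
  gcongr
  exact hy.antitoneOn_energy hα hβ ht ht' h

lemma hasDerivAt_prim (hy : IsGlobalCurve α β y) {t : ℝ} (ht : 0 ≤ t) :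
    HasDerivAt (fun t => prim (y t)) (vMap α β (prim (y t))) t := by
  have := prim.hasFDerivAt.comp_hasDerivAt t (hy.hasDerivAt t ht)
  rwa [prim_fieldOne] at this

lemma isSolution (hy : IsGlobalCurve α β y) {u₀ : ℝ → ℝ} (hu₀ : MemSobolev L 1 u₀)
    (h0 : ext (prim (y 0)) =ᵐ[mu L] u₀) {T : ℝ} (hT : 0 < T) :
    IsSolution L α β 1 T u₀ fun t => ext (prim (y t)) := by
  refine (lowModel (L := L) α β (s := 1) (by norm_num) le_rfl).isSolution zero_le_one hT hu₀
    (y := fun t => prim (y t)) h0 fun t ht => ?_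
  have := (hy.hasDerivAt_prim ht.1).hasDerivWithinAt (s := Icc 0 T)
  rwa [← prim_fieldOne] at this

end IsGlobalCurve

end

noncomputable section

/-! ### Asymptotic behaviour of functions of time -/

section Time

lemma continuousOn_Icc_of_hasDerivAt {h w : ℝ → ℝ} (hd : ∀ t, 0 ≤ t → HasDerivAt h (w t) t)
    {a b : ℝ} (ha : 0 ≤ a) : ContinuousOn h (Icc a b) := fun t ht =>
  (hd t (ha.trans ht.1)).continuousAt.continuousWithinAt

lemma sub_le_mul_of_hasDerivAt {h w : ℝ → ℝ} (hd : ∀ t, 0 ≤ t → HasDerivAt h (w t) t) {C a b : ℝ}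
    (ha : 0 ≤ a) (hab : a ≤ b) (hC : ∀ t ∈ Icc a b, w t ≤ C) : h b - h a ≤ C * (b - a) := by
  rcases hab.eq_or_lt with rfl | hab
  · simp
  obtain ⟨c, hc, hcd⟩ := exists_hasDerivAt_eq_slope h w hab
    (continuousOn_Icc_of_hasDerivAt hd ha) fun t ht => hd t (ha.trans ht.1.le)
  have h1 := hC c (Ioo_subset_Icc_self hc)
  rwa [hcd, div_le_iff₀ (by linarith)] at h1

/-- If `E' ≤ -c h²` with `h` Lipschitz and `E` bounded below, then `h → 0`. -/
lemma tendsto_zero_of_deriv_le {E E' h : ℝ → ℝ} {c m : ℝ} {K : ℝ≥0} (hc : 0 < c)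
    (hE : ∀ t, 0 ≤ t → HasDerivAt E (E' t) t) (hE' : ∀ t, 0 ≤ t → E' t ≤ -(c * h t ^ 2))
    (hm : ∀ t, 0 ≤ t → m ≤ E t) (hK : LipschitzOnWith K h (Ici 0)) : Tendsto h atTop (𝓝 0) := by
  have hanti : ∀ a b, 0 ≤ a → a ≤ b → E b ≤ E a := fun a b ha hab => by
    have := sub_le_mul_of_hasDerivAt hE (C := 0) ha hab fun t ht =>
      (hE' t (ha.trans ht.1)).trans (neg_nonpos.2 (by positivity))
    linarith
  rw [Metric.tendsto_atTop]
  intro ε hε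
  -- Over a time `δ` the function `h` varies by at most `ε/2`. So `|h t| ≥ ε` would cost `E` at
  -- least `r` on `[t, t+δ]`, below its infimum once `E` is within `r` of it.
  set δ := ε / (2 * (K + 1)) with hδ
  have hK0 : (0 : ℝ) ≤ K := K.2
  have hδ0 : 0 < δ := by positivity
  set r := c * (ε / 2) ^ 2 * δ with hr
  have hr0 : 0 < r := by positivity
  -- the infimum of `E` is almost attained
  set S := E '' Ici 0 with hS
  have hSb : BddBelow S := ⟨m, by rintro _ ⟨t, ht, rfl⟩; exact hm t ht⟩
  obtain ⟨_, ⟨t₀, ht₀, rfl⟩, hlt⟩ := exists_lt_of_csInf_lt (⟨E 0, 0, self_mem_Ici, rfl⟩ : S.Nonempty)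
    (show sInf S < sInf S + r by linarith)
  refine ⟨t₀, fun t ht => ?_⟩
  have ht0 : (0:ℝ) ≤ t := le_trans ht₀ ht
  rw [dist_zero_right, Real.norm_eq_abs]
  by_contra! hge
  have h1 : E (t + δ) - E t ≤ -(c * (ε / 2) ^ 2) * (t + δ - t) := by
    refine sub_le_mul_of_hasDerivAt hE ht0 (by linarith) fun τ hτ => ?_
    have hτ0 : 0 ≤ τ := ht0.trans hτ.1
    refine (hE' τ hτ0).trans (neg_le_neg ?_)
    have h2 := hK.dist_le_mul t ht0 τ hτ0
    rw [Real.dist_eq, Real.dist_eq] at h2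
    have h3 : |t - τ| ≤ δ := by rw [abs_sub_comm, abs_of_nonneg (by linarith [hτ.1])]; linarith [hτ.2]
    have h4 : K * δ ≤ ε / 2 := by
      rw [hδ, ← mul_div_assoc, div_le_div_iff₀ (by positivity) (by norm_num)]
      nlinarith
    have h5 : ε / 2 ≤ |h τ| := by
      have := abs_sub_abs_le_abs_sub (h t) (h τ)
      nlinarith
    have h6 : (ε / 2) ^ 2 ≤ h τ ^ 2 := by rw [← sq_abs (h τ)]; gcongr
    gcongr
  have h2 : sInf S ≤ E (t + δ) := csInf_le hSb ⟨_, by simp; linarith, rfl⟩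
  have h3 := hanti t₀ t ht₀ ht
  have h4 : -(c * (ε / 2) ^ 2) * (t + δ - t) = -r := by rw [hr]; ring
  linarith

/-- Barbalat's lemma: if `h → 0` and `h'` is Lipschitz, then `h' → 0`. -/
lemma tendsto_deriv_zero {h w : ℝ → ℝ} {K : ℝ≥0} (hd : ∀ t, 0 ≤ t → HasDerivAt h (w t) t)
    (hh : Tendsto h atTop (𝓝 0)) (hK : LipschitzOnWith K w (Ici 0)) : Tendsto w atTop (𝓝 0) := by
  rw [Metric.tendsto_atTop] at hh ⊢
  intro ε hε
  have hK0 : (0 : ℝ) ≤ K := K.2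
  set δ := ε / (2 * (K + 1)) with hδ
  have hδ0 : 0 < δ := by positivity
  -- This makes the slope of `h` over `[t, t+δ]` less than `ε/2`; it equals `w` at an intermediate
  -- point, from which `w t` differs by less than `ε/2`.
  obtain ⟨T, hT⟩ := hh (ε * δ / 4) (by positivity)
  refine ⟨max T 0, fun t ht => ?_⟩
  have ht0 : 0 ≤ t := (le_max_right _ _).trans ht
  have htT : T ≤ t := (le_max_left _ _).trans ht
  have h1 := hT t htT
  have h2 := hT (t + δ) (by linarith)
  obtain ⟨ξ, hξ, hξd⟩ := exists_hasDerivAt_eq_slope h w (show t < t + δ by linarith)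
    (continuousOn_Icc_of_hasDerivAt hd ht0) fun τ hτ => hd τ (ht0.trans hτ.1.le)
  have h3 := hK.dist_le_mul t ht0 ξ (ht0.trans hξ.1.le)
  rw [dist_zero_right, Real.norm_eq_abs] at *
  rw [Real.dist_eq, Real.dist_eq] at h3
  have h4 : |t - ξ| ≤ δ := by rw [abs_sub_comm, abs_of_nonneg (by linarith [hξ.1])]; linarith [hξ.2]
  have h5 : K * δ < ε / 2 := by
    rw [hδ, ← mul_div_assoc, div_lt_div_iff₀ (by positivity) (by norm_num)]
    nlinarith
  have h6 : |w ξ| < ε / 2 := by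
    rw [hξd, add_sub_cancel_left, abs_div, abs_of_pos hδ0, div_lt_iff₀ hδ0]
    have := abs_sub (h (t + δ)) (h t)
    linarith
  have h7 := abs_sub_abs_le_abs_sub (w t) (w ξ)
  nlinarith

/-- If `h` is small at some time of every long window, and `liminf h' ≥ 0`, then `h → 0`. -/
lemma tendsto_zero_of_windows {h w : ℝ → ℝ} (hd : ∀ t, 0 ≤ t → HasDerivAt h (w t) t)
    (hw : ∀ ε > 0, ∀ᶠ t in atTop, -ε ≤ w t)
    (hwin : ∀ η > 0, ∃ ℓ : ℝ, 0 < ℓ ∧ ∀ᶠ t in atTop, ∃ τ ∈ Icc t (t + ℓ), |h τ| ≤ η) :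
    Tendsto h atTop (𝓝 0) := by
  rw [Metric.tendsto_atTop]
  intro ε hε
  obtain ⟨ℓ, hℓ, hev⟩ := hwin (ε / 4) (by positivity)
  obtain ⟨T₁, hT₁⟩ := eventually_atTop.1 hev
  obtain ⟨T₂, hT₂⟩ := eventually_atTop.1 (hw (ε / (4 * ℓ)) (by positivity))
  have hdn : ∀ t, 0 ≤ t → HasDerivAt (fun t => -h t) (-w t) t := fun t ht => (hd t ht).neg
  refine ⟨max (max T₁ T₂) 0 + ℓ, fun t ht => ?_⟩
  have e1 := le_max_left T₁ T₂
  have e2 := le_max_right T₁ T₂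
  have e3 := le_max_left (max T₁ T₂) 0
  have e4 := le_max_right (max T₁ T₂) 0
  -- A good time `a` before `t` bounds `h t` from below and a good time `b` after `t` bounds it from
  -- above, so a one-sided bound on `w` suffices.
  obtain ⟨a, ha, hha⟩ := hT₁ (t - ℓ) (by linarith)
  obtain ⟨b, hb, hhb⟩ := hT₁ t (by linarith)
  have hℓε : ε / (4 * ℓ) * ℓ = ε / 4 := by field_simp
  have k1 := sub_le_mul_of_hasDerivAt hdn (C := ε / (4 * ℓ)) (a := a) (b := t)
    (by linarith [ha.1]) (by linarith [ha.2]) fun τ hτ => by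
      linarith [hT₂ τ (by linarith [hτ.1, ha.1])]
  have k2 := sub_le_mul_of_hasDerivAt hdn (C := ε / (4 * ℓ)) (a := t) (b := b)
    (by linarith) (by linarith [hb.1]) fun τ hτ => by
      linarith [hT₂ τ (by linarith [hτ.1])]
  have hpos : 0 ≤ ε / (4 * ℓ) := by positivity
  have k3 : ε / (4 * ℓ) * (t - a) ≤ ε / 4 := by
    rw [← hℓε]; gcongr; linarith [ha.1]
  have k4 : ε / (4 * ℓ) * (b - t) ≤ ε / 4 := by
    rw [← hℓε]; gcongr; linarith [hb.2]
  rw [abs_le] at hha hhb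
  rw [dist_zero_right, Real.norm_eq_abs, abs_lt]
  constructor <;> linarith [hha.1, hha.2, hhb.1, hhb.2]

/-- If `q ≤ B' + r` with `B` bounded and `r → 0`, then `q` is small at some time of every
long window. -/
lemma exists_small_of_le_deriv {B B' q r : ℝ → ℝ} {A : ℝ} (hB : ∀ t, 0 ≤ t → HasDerivAt B (B' t) t)
    (hA : ∀ t, 0 ≤ t → |B t| ≤ A) (hq : ∀ t, 0 ≤ t → q t ≤ B' t + r t)
    (hr : Tendsto r atTop (𝓝 0)) {η : ℝ} (hη : 0 < η) :
    ∃ ℓ : ℝ, 0 < ℓ ∧ ∀ᶠ t in atTop, ∃ τ ∈ Icc t (t + ℓ), q τ ≤ η := by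
  have hA0 : 0 ≤ A := (abs_nonneg _).trans (hA 0 le_rfl)
  -- If `q > η` throughout the window then `B' > η/2` there, and `B` would grow by `2A + 1/2`, more
  -- than `|B| ≤ A` allows.
  refine ⟨(4 * A + 1) / η, by positivity, ?_⟩
  filter_upwards [hr.eventually (gt_mem_nhds (show (0:ℝ) < η / 2 by positivity)) |> fun h =>
    (eventually_ge_atTop (0:ℝ)).and (eventually_forall_ge_atTop.2 h)] with t ⟨ht0, ht⟩
  by_contra! hcon
  set ℓ := (4 * A + 1) / η with hℓ
  have hℓ0 : 0 < ℓ := by positivity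
  have h1 := sub_le_mul_of_hasDerivAt (fun t ht => (hB t ht).neg) (C := -(η / 2)) (a := t)
    (b := t + ℓ) ht0 (by linarith) fun τ hτ => by
      have e1 := hcon τ hτ
      have e2 := hq τ (ht0.trans hτ.1)
      have e3 := ht τ hτ.1
      linarith
  have h2 := hA t ht0
  have h3 := hA (t + ℓ) (by linarith)
  have h4 : η * ℓ = 4 * A + 1 := by rw [hℓ]; field_simp
  rw [abs_le] at h2 h3
  simp only [Pi.neg_apply, neg_sub_neg] at h1
  nlinarith [h2.1, h2.2, h3.1, h3.2]

end Time

end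

noncomputable section

/-! ### Inequalities for the elliptic problem -/

variable {L : ℝ} [hL : Fact (0 < L)]

/-- The integral over `(0,L)`. -/
def integ : ContSpace L →L[ℝ] ℝ := evalAt L ∘L primC

lemma integ_apply (w : ContSpace L) : integ w = ∫ x in (0:ℝ)..L, ext w x := by
  change ext (primC w) L = _
  exact (ext_prim_inc_eqOn 0 w L_mem).trans (zero_add _)

lemma integ_eq_sub {w w' : ContSpace L} {a : ℝ} (h : w = prim (a, inc w')) :
    integ w' = ext w L - ext w 0 := by
  rw [h, ext_prim_zero, ext_prim_inc_eqOn a w' L_mem, integ_apply, add_sub_cancel_left]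

lemma integ_mono {u w : ContSpace L} (h : ∀ x ∈ Icc 0 L, ext u x ≤ ext w x) :
    integ u ≤ integ w := by
  rw [integ_apply, integ_apply]
  exact intervalIntegral.integral_mono_on hL.out.le ((continuous_ext u).intervalIntegrable _ _)
    ((continuous_ext w).intervalIntegrable _ _) h

lemma integ_mul (u w : ContSpace L) : integ (u * w) = inner ℝ (inc u) (inc w) := by
  rw [inner_inc_inc, integ_apply]; rfl

lemma integ_mul_self (u : ContSpace L) : integ (u * u) = ‖inc u‖ ^ 2 := by
  rw [integ_mul, real_inner_self_eq_norm_sq]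

/-- The weight `e^{-3x}` on `[0,L]`. -/
def expC : ContSpace L := restr (fun x => Real.exp (-3 * x)) (by fun_prop)

lemma ext_expC {x : ℝ} (hx : x ∈ Icc 0 L) : ext (expC (L := L)) x = Real.exp (-3 * x) :=
  ext_restr _ _ hx

lemma expC_eq : (expC : ContSpace L) = prim (1, inc ((-3 : ℝ) • expC)) := by
  have := prim_of_hasDerivAt (u := (expC : ContSpace L)) (p := (-3 : ℝ) • expC) fun x hx => by
    rw [ext_smul, ext_expC (Ioo_subset_Icc_self hx)]
    have h : HasDerivAt (fun x : ℝ => Real.exp (-3 * x)) (-3 * Real.exp (-3 * x)) x := by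
      have := ((hasDerivAt_id x).const_mul (-3)).exp
      simpa [mul_comm] using this
    refine h.congr_of_eventuallyEq ?_
    filter_upwards [Ioo_mem_nhds hx.1 hx.2] with y hy using ext_expC (Ioo_subset_Icc_self hy)
  rwa [ext_expC zero_mem, mul_zero, Real.exp_zero] at this

/-- The weight `e^{-3x} - e^{-3L}` on `[0,L]`. -/
def weight : ContSpace L := expC - Real.exp (-3 * L) • 1

lemma weight_eq : (weight : ContSpace L)
    = prim (1 - Real.exp (-3 * L), inc ((-3 : ℝ) • expC)) := by
  have h1 : (Real.exp (-3 * L) • 1 : ContSpace L) = prim (Real.exp (-3 * L), 0) := by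
    refine ext_injOn fun x hx => ?_
    rw [ext_prim _ hx, intervalIntegral_congr_ae (Lp.coeFn_zero _ _ _) zero_mem hx]
    simp
  rw [weight, h1]
  conv_lhs => rw [expC_eq]
  rw [← map_sub, Prod.mk_sub_mk, sub_zero]

lemma weight_zero : ext (weight (L := L)) 0 = 1 - Real.exp (-3 * L) := by
  rw [weight_eq, ext_prim_zero]

lemma weight_L : ext (weight (L := L)) L = 0 := by
  rw [weight, ext_sub, ext_smul, ext_one, ext_expC L_mem]; ring

/-- Integrate `(e^{-3x} g²)' = e^{-3x} (2 g v - 3 g²)` and use `2 g v ≤ g² + v²`. A rate `λ` gives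
the factor `λ - 1`; the estimate of `‖u_t‖` needs this above `1`, whence the choice `λ = 3`. -/
lemma two_mul_integ_le {g v : ContSpace L} {a : ℝ} (hg : g = prim (a, inc v)) :
    2 * integ (expC * (g * g)) ≤ integ (expC * (v * v)) + ext g 0 ^ 2 := by
  have h := integ_eq_sub (mul_eq_prim expC_eq (mul_eq_prim hg hg))
  have h1 : integ (expC * (g * v + g * v) + g * g * ((-3 : ℝ) • expC))
      ≤ integ (expC * (v * v) - (2 : ℝ) • (expC * (g * g))) := by
    refine integ_mono fun x hx => ?_
    simp only [ext_add, ext_mul, ext_sub, ext_smul, ext_expC hx]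
    have := Real.exp_pos (-3 * x)
    nlinarith [mul_nonneg this.le (sq_nonneg (ext v x - ext g x))]
  rw [h, map_sub, map_smul, smul_eq_mul] at h1
  simp only [ext_mul, ext_expC zero_mem, ext_expC L_mem, mul_zero, Real.exp_zero] at h1
  have := Real.exp_pos (-3 * L)
  nlinarith [mul_nonneg this.le (sq_nonneg (ext g L))]

/-- The weighted energy `∫ (e^{-3x} - e^{-3L}) (u²/2 + u³/6)`. -/
def weightedEnergy (u : ContSpace L) : ℝ :=
  integ (weight * ((1 / 2 : ℝ) • (u * u) + (1 / 6 : ℝ) • (u * u * u)))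

/-- The density `u²/2 + u³/6` is the antiderivative of the flux. -/
lemma hasDerivAt_weightedEnergy {X : ℝ → ContSpace L} {X' : ContSpace L} {t : ℝ}
    (h : HasDerivAt X X' t) :
    HasDerivAt (fun t => weightedEnergy (X t)) (integ (weight * (flux (X t) * X'))) t := by
  have h2 := h.fun_mul h
  have h3 := h2.fun_mul h
  have h4 := ((h2.const_smul (1 / 2 : ℝ)).fun_add (h3.const_smul (1 / 6 : ℝ))).const_mul weight
  have h5 := (integ (L := L)).hasFDerivAt.comp_hasDerivAt t h4
  have h6 : (weight : ContSpace L) * (flux (X t) * X') = weight *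
      ((1 / 2 : ℝ) • (X' * X t + X t * X')
        + (1 / 6 : ℝ) • ((X' * X t + X t * X') * X t + X t * X t * X')) := by
    refine ext_injOn fun x _ => ?_
    simp only [ext_mul, ext_add, ext_smul, ext_flux]
    ring
  rw [h6]
  exact h5

/-- The time derivative of the weighted energy controls `‖u_t‖²`, up to boundary terms. -/
lemma norm_sq_vMap_le (α β : ℝ) (u : ContSpace L) :
    3 / 4 * Real.exp (-3 * L) * ‖inc (vMap α β u)‖ ^ 2
      ≤ integ (weight * (flux u * vMap α β u))
        + (ext (gMap α β u) 0 ^ 2 + ext (vMap α β u) 0 ^ 2) := by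
  set v := vMap α β u with hv
  set g := gMap α β u with hg
  set f := flux u with hf
  have hgv : g = prim (bdry α (ext u 0), inc v) := gMap_eq α β u
  have hvg : v = prim (ext v 0, inc (g + f)) := vMap_eq α β u
  have h1 := two_mul_integ_le hgv
  have h2 := integ_eq_sub (mul_eq_prim weight_eq (mul_eq_prim hvg hvg))
  have h3 := integ_eq_sub (mul_eq_prim weight_eq (mul_eq_prim hgv hgv))
  simp only [ext_mul, weight_zero, weight_L, zero_mul, zero_sub] at h2 h3
  -- Subtract the integrals of `(weight g²)'` and `(weight v²)'`: the terms `g v` cancel, leaving `2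
  -- weight f v - 3 e^{-3x} (v² - g²)`. The bound for `g` then absorbs half of the `v²` term.
  have h4 : (2:ℝ) * integ (weight * (f * v)) - 3 * integ (expC * (v * v))
        + 3 * integ (expC * (g * g))
      = integ (weight * (v * (g + f) + v * (g + f)) + v * v * ((-3:ℝ) • expC))
        - integ (weight * (g * v + g * v) + g * g * ((-3:ℝ) • expC)) := by
    simp only [← smul_eq_mul (a := (2:ℝ)), ← smul_eq_mul (a := (3:ℝ)), ← map_smul, ← map_sub,
      ← map_add]
    congr 1
    refine ext_injOn fun x _ => ?_
    simp only [ext_mul, ext_add, ext_smul, ext_sub]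
    ring
  rw [h2, h3] at h4
  have h5 : Real.exp (-3 * L) * ‖inc v‖ ^ 2 ≤ integ (expC * (v * v)) := by
    rw [← integ_mul_self, ← smul_eq_mul, ← map_smul]
    refine integ_mono fun x hx => ?_
    simp only [ext_smul, ext_mul, ext_expC hx]
    exact mul_le_mul_of_nonneg_right (Real.exp_le_exp.2 (by linarith [hx.2])) (mul_self_nonneg _)
  have h6 := Real.exp_pos (-3 * L)
  have h7 : Real.exp (-3 * L) ≤ 1 := Real.exp_le_one_iff.2 (by linarith [hL.out])
  nlinarith [sq_nonneg (ext v 0), sq_nonneg (ext g 0),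
    mul_nonneg (sub_nonneg.2 h7) (sq_nonneg (ext g 0)), mul_nonneg h6.le (sq_nonneg (ext v 0))]

/-- The weighted inequality for `g' = v`, with `e^{-3x}` bounded between `e^{-3L}` and `1`. -/
lemma norm_sq_gMap_le (α β : ℝ) (u : ContSpace L) :
    2 * Real.exp (-3 * L) * ‖inc (gMap α β u)‖ ^ 2
      ≤ ‖inc (vMap α β u)‖ ^ 2 + ext (gMap α β u) 0 ^ 2 := by
  have h1 := two_mul_integ_le (gMap_eq α β u)
  set v := vMap α β u
  set g := gMap α β u
  have h2 : Real.exp (-3 * L) * ‖inc g‖ ^ 2 ≤ integ (expC * (g * g)) := by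
    rw [← integ_mul_self, ← smul_eq_mul, ← map_smul]
    refine integ_mono fun x hx => ?_
    simp only [ext_smul, ext_mul, ext_expC hx]
    exact mul_le_mul_of_nonneg_right (Real.exp_le_exp.2 (by linarith [hx.2])) (mul_self_nonneg _)
  have h3 : integ (expC * (v * v)) ≤ ‖inc v‖ ^ 2 := by
    rw [← integ_mul_self]
    refine integ_mono fun x hx => ?_
    simp only [ext_mul, ext_expC hx]
    exact mul_le_of_le_one_left (mul_self_nonneg _) (Real.exp_le_one_iff.2 (by linarith [hx.1]))
  linarith

/-- `|f(x)|² ≤ |f(0)|² + 2 ‖f‖ ‖f'‖`. -/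
lemma sq_ext_prim_le (a : ℝ) (p : LTwo L) {x : ℝ} (hx : x ∈ Icc 0 L) :
    ext (prim (a, p)) x ^ 2 ≤ a ^ 2 + 2 * (‖inc (prim (a, p))‖ * ‖p‖) := by
  set f := prim (a, p) with hf
  have h1 : f * f = prim (a * a, mulL f p + mulL f p) := prim_mul a a p p
  have h2 : ext f x ^ 2 = a ^ 2 + ∫ y in (0:ℝ)..x, 2 * (ext f y * p y) := by
    rw [pow_two, ← ext_mul, h1, ext_prim _ hx, pow_two]
    congr 1
    refine intervalIntegral_congr_ae ?_ zero_mem hx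
    filter_upwards [Lp.coeFn_add (mulL f p) (mulL f p), mulL_ae f p] with y h3 h4
    rw [h3, Pi.add_apply, h4]; ring
  rw [h2]
  have hm := memLp_ext_mul f p
  have h3 : ∫ y in (0:ℝ)..x, ext f y * p y ≤ ∫ y, |ext f y * p y| ∂(mu L) := by
    rw [intervalIntegral.integral_of_le hx.1, ← restrict_Ioo_eq_restrict_Ioc]
    refine (le_abs_self _).trans (abs_integral_le_integral_abs.trans ?_)
    exact setIntegral_mono_set (integrable_of_memLp hm).abs (ae_of_all _ fun _ => abs_nonneg _)
      (Ioo_subset_Ioo_right hx.2).eventuallyLE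
  have h4 : ∫ y, |ext f y * p y| ∂(mu L) = inner ℝ |inc f| |p| := by
    rw [L2.inner_def]
    refine integral_congr_ae ?_
    filter_upwards [inc_ae f, Lp.coeFn_abs (inc f), Lp.coeFn_abs p] with y h5 h6 h7
    rw [h6, h7, h5, abs_mul]
    simp [mul_comm]
  have h5 := real_inner_le_norm |inc f| |p|
  rw [norm_abs_eq_norm, norm_abs_eq_norm] at h5
  rw [intervalIntegral.integral_const_mul]
  linarith

/-- Pairing `f` with `v' = g + f` gives `‖f‖² = [f v] - ⟨f', v⟩ - ⟨f, g⟩`, and `f`, `f'` are bounded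
on bounded sets of `H¹`. The uniform bound follows from `f² ≤ f(0)² + 2 ‖f‖ ‖f'‖`. -/
lemma exists_norm_flux_le (α β R : ℝ) : ∃ A : ℝ, 0 ≤ A ∧ ∀ e : HOne L, ‖e‖ ≤ R →
    ‖inc (flux (prim e))‖ ^ 2 ≤ A * (|ext (vMap α β (prim e)) L| + |ext (vMap α β (prim e)) 0|
      + ‖inc (gMap α β (prim e))‖ + ‖inc (vMap α β (prim e))‖) ∧
    ‖flux (prim e)‖ ^ 2 ≤ ext (flux (prim e)) 0 ^ 2 + A * ‖inc (flux (prim e))‖ := by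
  have hp := lipBdd_clm (prim (L := L))
  have h2 : LipBdd fun e : HOne L => e.2 :=
    lipBdd_clm (ContinuousLinearMap.snd ℝ ℝ (LTwo L))
  obtain ⟨A₁, hA₁, h₁⟩ := (lipBdd_flux.comp hp).bounded R
  obtain ⟨A₂, hA₂, h₂⟩ := (h2.add (hp.bilin h2 mulL)).bounded R
  obtain ⟨A₃, hA₃, h₃⟩ := ((lipBdd_flux.comp hp).clm inc).bounded R
  refine ⟨A₁ + 2 * A₂ + A₃, by positivity, fun e he => ?_⟩
  have k1 := h₁ e he
  have k2 := h₂ e he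
  have k3 := h₃ e he
  set u := prim e with hu
  set f := flux u with hf
  set v := vMap α β u with hv
  set g := gMap α β u with hg
  set p := e.2 + mulL u e.2 with hp'
  have hfp : f = prim (e.1 + e.1 ^ 2 / 2, p) := flux_prim e.1 e.2
  have hvg : v = prim (ext v 0, inc (g + f)) := vMap_eq α β u
  constructor
  · have h := prim_pairing hfp hvg
    rw [map_add, inner_add_right, real_inner_self_eq_norm_sq] at h
    have i1 := abs_real_inner_le_norm (inc f) (inc g)
    have i2 := abs_real_inner_le_norm (inc v) p
    have i3 : |ext f L * ext v L| ≤ A₁ * |ext v L| := by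
      rw [abs_mul]; gcongr; exact (abs_ext_le _ _).trans k1
    have i4 : |ext f 0 * ext v 0| ≤ A₁ * |ext v 0| := by
      rw [abs_mul]; gcongr; exact (abs_ext_le _ _).trans k1
    have i5 : ‖inc f‖ * ‖inc g‖ ≤ A₃ * ‖inc g‖ := by gcongr
    have i6 : ‖inc v‖ * ‖p‖ ≤ A₂ * ‖inc v‖ := by rw [mul_comm]; gcongr
    have j1 := neg_abs_le (inner ℝ (inc f) (inc g))
    have j2 := neg_abs_le (inner ℝ (inc v) p)
    have j3 := le_abs_self (ext f L * ext v L)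
    have j4 := neg_abs_le (ext f 0 * ext v 0)
    have n1 := abs_nonneg (ext v L)
    have n2 := abs_nonneg (ext v 0)
    have n3 := norm_nonneg (inc g)
    have n4 := norm_nonneg (inc v)
    calc ‖inc f‖ ^ 2 ≤ A₁ * |ext v L| + A₁ * |ext v 0| + A₃ * ‖inc g‖ + A₂ * ‖inc v‖ := by linarith
      _ ≤ _ := by
        have m1 : A₁ ≤ A₁ + 2 * A₂ + A₃ := by linarith
        have m2 : A₂ ≤ A₁ + 2 * A₂ + A₃ := by linarith
        have m3 : A₃ ≤ A₁ + 2 * A₂ + A₃ := by linarith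
        rw [mul_add, mul_add, mul_add]
        gcongr
  · have h0 : ext f 0 = e.1 + e.1 ^ 2 / 2 := by rw [hfp, ext_prim_zero]
    set S := ext f 0 ^ 2 + (A₁ + 2 * A₂ + A₃) * ‖inc f‖ with hS
    have hS0 : 0 ≤ S := by positivity
    have : ‖f‖ ≤ √S := by
      refine norm_le_of_ext (Real.sqrt_nonneg _) fun x hx => Real.le_sqrt_of_sq_le ?_
      have h := sq_ext_prim_le (e.1 + e.1 ^ 2 / 2) p hx
      rw [← hfp, ← h0] at h
      rw [sq_abs]
      refine h.trans ?_
      rw [hS]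
      have : 2 * (‖inc f‖ * ‖p‖) ≤ (2 * A₂) * ‖inc f‖ := by
        have := mul_le_mul_of_nonneg_left k2 (norm_nonneg (inc f))
        linarith
      nlinarith [norm_nonneg (inc f), mul_nonneg hA₁ (norm_nonneg (inc f)),
        mul_nonneg hA₃ (norm_nonneg (inc f))]
    calc ‖f‖ ^ 2 ≤ √S ^ 2 := by gcongr
      _ = S := Real.sq_sqrt hS0

/-- The flux controls `u` if `u` does not take values near `-2`. -/
lemma norm_le_two_mul_flux {u : ContSpace L} (hf : ‖flux u‖ ≤ 1 / 4) (h0 : |ext u 0| ≤ 1 / 2) :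
    ‖u‖ ≤ 2 * ‖flux u‖ := by
  have hfx : ∀ x, |ext u x + ext u x ^ 2 / 2| ≤ ‖flux u‖ := fun x => by
    rw [← ext_flux]; exact abs_ext_le _ _
  have hpos : ∀ x ∈ Icc 0 L, -1 < ext u x := by
    intro x hx
    -- Starting from `|u(0)| ≤ 1/2`, a value at most `-1` would force the value `-1` somewhere,
    -- where the flux is `-1/2`. Above `-1` the factor `1 + u/2` is at least `1/2`.
    by_contra! hneg
    have hmem : (-1 : ℝ) ∈ ext u '' Icc 0 x :=
      intermediate_value_Icc' hx.1 (continuous_ext u).continuousOn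
        ⟨hneg, by linarith [neg_abs_le (ext u 0)]⟩
    obtain ⟨z, -, hz⟩ := hmem
    have := hfx z
    rw [hz] at this
    norm_num at this
    linarith
  refine norm_le_of_ext (by positivity) fun x hx => ?_
  have h1 := hfx x
  have h2 := hpos x hx
  have h3 : ext u x + ext u x ^ 2 / 2 = ext u x * (1 + ext u x / 2) := by ring
  rw [h3, abs_mul, abs_of_pos (show 0 < 1 + ext u x / 2 by linarith)] at h1
  nlinarith [abs_nonneg (ext u x)]

end

noncomputable section

/-! ### Decay of the `L²` norm

The dissipation of the energy gives `u(0), u(L) → 0`, and then `u_t(0), u_t(L) → 0`. The weighted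
energy `∫ (e^{-3x} - e^{-3L}) (u²/2 + u³/6)` is bounded, and up to boundary terms its time derivative
is at least a multiple of `‖u_t‖²`; so `u` is uniformly small at some time of every long window.
The moments `∫ u` and `∫ x u`, whose derivatives are `o(1)` and `½ ∫ u² + o(1)`, then tend to `0`, and
so does `∫ u²`. This argument does not need unique continuation. -/

variable {L : ℝ} [hL : Fact (0 < L)]

lemma lipBdd_weightedEnergy : LipBdd (weightedEnergy (L := L)) :=
  ((lipBdd_const weight).mul (((lipBdd_id.mul lipBdd_id).const_smul _).add
    (((lipBdd_id.mul lipBdd_id).mul lipBdd_id).const_smul _))).clm integ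

/-- The identity function on `[0,L]`. -/
def idC : ContSpace L := restr id continuousOn_id

lemma ext_idC {x : ℝ} (hx : x ∈ Icc 0 L) : ext (idC (L := L)) x = x := ext_restr _ _ hx

lemma idC_eq : (idC : ContSpace L) = prim (0, inc 1) := by
  have := prim_of_hasDerivAt (u := (idC : ContSpace L)) (p := 1) fun x hx => by
    refine (hasDerivAt_id x).congr_of_eventuallyEq ?_
    filter_upwards [Ioo_mem_nhds hx.1 hx.2] with y hy using ext_idC (Ioo_subset_Icc_self hy)
  rwa [ext_idC zero_mem] at this

lemma integ_vMap (α β : ℝ) (u : ContSpace L) :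
    integ (vMap α β u) = ext (gMap α β u) L - ext (gMap α β u) 0 := integ_eq_sub (gMap_eq α β u)

/-- By parts, `∫ x g' = L g(L) - ∫ g`, and `∫ g = [v] - ∫ f`. The quadratic part of the flux is what
makes `∫ u²` appear. -/
lemma integ_idC_mul_vMap (α β : ℝ) (u : ContSpace L) :
    integ (idC * vMap α β u) = L * ext (gMap α β u) L - ext (vMap α β u) L + ext (vMap α β u) 0
      + integ u + 1 / 2 * ‖inc u‖ ^ 2 := by
  have h1 := integ_eq_sub (mul_eq_prim idC_eq (gMap_eq α β u))
  have h2 := integ_eq_sub (vMap_eq α β u)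
  rw [ext_mul, ext_mul, ext_idC L_mem, ext_idC zero_mem, mul_one, map_add] at h1
  rw [map_add, flux, map_add, map_smul, integ_mul_self, smul_eq_mul] at h2
  linarith

lemma tendsto_zero_of_sq_le {ι : Type*} {l : Filter ι} {a b : ι → ℝ} (h : ∀ᶠ i in l, a i ^ 2 ≤ b i)
    (hb : Tendsto b l (𝓝 0)) : Tendsto a l (𝓝 0) := by
  have h1 : Tendsto (fun i => a i ^ 2) l (𝓝 0) :=
    tendsto_of_tendsto_of_tendsto_of_le_of_le' tendsto_const_nhds hb
      (Eventually.of_forall fun i => sq_nonneg _) h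
  have h2 := (Real.continuous_sqrt.tendsto 0).comp h1
  rw [Real.sqrt_zero] at h2
  rw [tendsto_zero_iff_abs_tendsto_zero]
  exact h2.congr fun i => Real.sqrt_sq_eq_abs _

namespace IsGlobalCurve

variable {α β : ℝ} {y : ℝ → HOne L}

/-- A bounded curve has bounded speed, so quantities that are Lipschitz on bounded sets are
Lipschitz in time, as Barbalat-type arguments require. -/
lemma lipschitzOnWith (hy : IsGlobalCurve α β y) {W : Type*} [NormedAddCommGroup W]
    {F : HOne L → W} (hF : LipBdd F) : ∃ K : ℝ≥0, LipschitzOnWith K (fun t => F (y t)) (Ici 0) := by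
  obtain ⟨R, hR⟩ := hy.bounded
  obtain ⟨M, hM, hb⟩ := ((lipBdd_fieldOne α β).comp (lipBdd_clm (prim (L := L)))).bounded R
  have h1 : LipschitzOnWith M.toNNReal y (Ici 0) := by
    refine (convex_Ici 0).lipschitzOnWith_of_nnnorm_hasDerivWithin_le
      (fun t ht => (hy.hasDerivAt t ht).hasDerivWithinAt) fun t ht => ?_
    rw [← NNReal.coe_le_coe, coe_nnnorm, Real.coe_toNNReal _ hM]
    exact hb _ (hR t ht)
  obtain ⟨K, hK⟩ := hF.lipschitzOnWith R
  exact ⟨_, hK.comp h1 fun t ht => by simpa using hR t ht⟩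

lemma lipBdd_ext_prim (x : ℝ) : LipBdd fun e : HOne L => ext (prim e) x := (lipBdd_clm prim).eval x

/-- The energy is bounded below and decreases at rate at least `(2α - 1) u(0)²`. -/
lemma tendsto_ext_zero (hy : IsGlobalCurve α β y) (hα : 1 / 2 < α) (hβ : β < 1 / 2) :
    Tendsto (fun t => ext (prim (y t)) 0) atTop (𝓝 0) := by
  obtain ⟨K, hK⟩ := hy.lipschitzOnWith (lipBdd_ext_prim 0)
  refine tendsto_zero_of_deriv_le (c := 2 * α - 1) (m := 0) (by linarith)
    (fun t ht => hy.hasDerivAt_energy ht) (fun t ht => ?_) (fun t ht => energy_nonneg _) hK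
  nlinarith [sq_nonneg (ext (prim (y t)) L)]

lemma tendsto_ext_L (hy : IsGlobalCurve α β y) (hα : 1 / 2 < α) (hβ : β < 1 / 2) :
    Tendsto (fun t => ext (prim (y t)) L) atTop (𝓝 0) := by
  obtain ⟨K, hK⟩ := hy.lipschitzOnWith (lipBdd_ext_prim L)
  refine tendsto_zero_of_deriv_le (c := 1 - 2 * β) (m := 0) (by linarith)
    (fun t ht => hy.hasDerivAt_energy ht) (fun t ht => ?_) (fun t ht => energy_nonneg _) hK
  nlinarith [sq_nonneg (ext (prim (y t)) 0)]

lemma hasDerivAt_clm (hy : IsGlobalCurve α β y) (T : ContSpace L →L[ℝ] ℝ) {t : ℝ} (ht : 0 ≤ t) :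
    HasDerivAt (fun t => T (prim (y t))) (T (vMap α β (prim (y t)))) t :=
  T.hasFDerivAt.comp_hasDerivAt t (hy.hasDerivAt_prim ht)

/-- Barbalat's lemma: the derivative of `T u` in time is `T (u_t)`, which is Lipschitz in time. -/
lemma tendsto_vMap (hy : IsGlobalCurve α β y) (T : ContSpace L →L[ℝ] ℝ)
    (h : Tendsto (fun t => T (prim (y t))) atTop (𝓝 0)) :
    Tendsto (fun t => T (vMap α β (prim (y t)))) atTop (𝓝 0) := by
  obtain ⟨K, hK⟩ := hy.lipschitzOnWith
    (((lipBdd_vMap (L := L) α β).comp (lipBdd_clm prim)).clm T)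
  exact tendsto_deriv_zero (fun t ht => hy.hasDerivAt_clm T ht) h hK

omit hL in
lemma tendsto_bdry {α : ℝ} {h : ℝ → ℝ} (hh : Tendsto h atTop (𝓝 0)) :
    Tendsto (fun t => bdry α (h t)) atTop (𝓝 0) := by
  have h1 : Continuous (bdry α) := by unfold bdry; fun_prop
  have h2 := (h1.tendsto 0).comp hh
  have h3 : bdry α 0 = 0 := by simp [bdry]
  rwa [h3] at h2

/-- The solution is uniformly small at some time of every long window. -/
lemma exists_small (hy : IsGlobalCurve α β y) (hα : 1 / 2 < α) (hβ : β < 1 / 2) {η : ℝ}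
    (hη : 0 < η) :
    ∃ ℓ : ℝ, 0 < ℓ ∧ ∀ᶠ t in atTop, ∃ τ ∈ Icc t (t + ℓ), ‖prim (y τ)‖ ≤ η := by
  obtain ⟨R, hR⟩ := hy.bounded
  have hu0 := hy.tendsto_ext_zero hα hβ
  have huL := hy.tendsto_ext_L hα hβ
  have hv0 := hy.tendsto_vMap (evalAt 0) hu0
  have hvL := hy.tendsto_vMap (evalAt L) huL
  simp only [evalAt_apply] at hv0 hvL
  have hg0 := tendsto_bdry (α := α) hu0
  simp only [← gMap_zero α β] at hg0
  -- the filter of large times at which `u_t` is small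
  set q : ℝ → ℝ := fun t => ‖inc (vMap α β (prim (y t)))‖ ^ 2 with hq
  set l : Filter ℝ := atTop ⊓ comap q (𝓝 0) with hl
  have hle : l ≤ atTop := inf_le_left
  have hql : Tendsto q l (𝓝 0) := tendsto_comap.mono_left inf_le_right
  have hpos : ∀ᶠ t in l, 0 ≤ t := hle (eventually_ge_atTop 0)
  obtain ⟨A, hA, hflux⟩ := exists_norm_flux_le (L := L) α β R
  have hvl : Tendsto (fun t => ‖inc (vMap α β (prim (y t)))‖) l (𝓝 0) :=
    tendsto_zero_of_sq_le (Eventually.of_forall fun _ => le_rfl) hql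
  have hgl : Tendsto (fun t => ‖inc (gMap α β (prim (y t)))‖) l (𝓝 0) := by
    refine tendsto_zero_of_sq_le (b := fun t => (2 * Real.exp (-3 * L))⁻¹ *
      (q t + ext (gMap α β (prim (y t))) 0 ^ 2)) (Eventually.of_forall fun t => ?_) ?_
    · rw [le_inv_mul_iff₀ (by positivity)]
      exact norm_sq_gMap_le α β _
    · simpa using (hql.add ((hg0.mono_left hle).pow 2)).const_mul ((2 * Real.exp (-3 * L))⁻¹)
  have hfl : Tendsto (fun t => ‖inc (flux (prim (y t)))‖) l (𝓝 0) := by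
    refine tendsto_zero_of_sq_le (hpos.mono fun t ht => (hflux (y t) (hR t ht)).1) ?_
    simpa using ((((hvL.mono_left hle).abs.add (hv0.mono_left hle).abs).add hgl).add hvl).const_mul A
  have hfs : Tendsto (fun t => ‖flux (prim (y t))‖) l (𝓝 0) := by
    refine tendsto_zero_of_sq_le (hpos.mono fun t ht => (hflux (y t) (hR t ht)).2) ?_
    have h1 : Tendsto (fun t => ext (flux (prim (y t))) 0) l (𝓝 0) := by
      simp only [ext_flux]
      simpa using (hu0.mono_left hle).add (((hu0.mono_left hle).pow 2).div_const 2)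
    simpa using (h1.pow 2).add (hfl.const_mul A)
  have hul : ∀ᶠ t in l, ‖prim (y t)‖ ≤ η := by
    filter_upwards [hfs.eventually (gt_mem_nhds (show (0:ℝ) < min (1 / 4) (η / 2) by positivity)),
      (hu0.mono_left hle).abs.eventually (gt_mem_nhds (show |(0:ℝ)| < 1 / 2 by norm_num))]
      with t h1 h2
    have h3 := norm_le_two_mul_flux (h1.le.trans (min_le_left _ _)) h2.le
    linarith [h1.le.trans (min_le_right _ _)]
  -- Unfolding the filter gives a threshold `ε`: at every large time with `q < ε` the solution is at
  -- most `η` in size.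
  obtain ⟨S, hS, S', hS', hSS⟩ := mem_inf_iff_superset.1 hul
  obtain ⟨U, hU, hUS⟩ := mem_comap.1 hS'
  obtain ⟨ε, hε, hεU⟩ := Metric.mem_nhds_iff.1 hU
  obtain ⟨A', hA', hB⟩ := ((lipBdd_weightedEnergy (L := L)).comp (lipBdd_clm prim)).bounded R
  have hr : Tendsto (fun t => ext (gMap α β (prim (y t))) 0 ^ 2 + ext (vMap α β (prim (y t))) 0 ^ 2)
      atTop (𝓝 0) := by simpa using (hg0.pow 2).add (hv0.pow 2)
  -- The weighted energy is bounded along the curve, so `q` falls to `ε/2` in every long window.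
  obtain ⟨ℓ, hℓ, hev⟩ := exists_small_of_le_deriv
    (q := fun t => 3 / 4 * Real.exp (-3 * L) * q t)
    (fun t ht => hasDerivAt_weightedEnergy (hy.hasDerivAt_prim ht))
    (fun t ht => hB (y t) (hR t ht)) (fun t ht => norm_sq_vMap_le α β (prim (y t))) hr
    (show 0 < 3 / 4 * Real.exp (-3 * L) * (ε / 2) by positivity)
  refine ⟨ℓ, hℓ, ?_⟩
  filter_upwards [hev, eventually_forall_ge_atTop.2 hS] with t ⟨τ, hτ, hqτ⟩ hSt
  refine ⟨τ, hτ, hSS ⟨hSt τ hτ.1, hUS (hεU ?_)⟩⟩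
  have h1 := le_of_mul_le_mul_left hqτ (by positivity)
  have h2 : 0 ≤ q τ := sq_nonneg _
  rw [Metric.mem_ball, dist_zero_right, Real.norm_eq_abs, abs_of_nonneg h2]
  linarith

lemma exists_small_clm (hy : IsGlobalCurve α β y) (hα : 1 / 2 < α) (hβ : β < 1 / 2)
    (T : ContSpace L →L[ℝ] ℝ) {η : ℝ} (hη : 0 < η) :
    ∃ ℓ : ℝ, 0 < ℓ ∧ ∀ᶠ t in atTop, ∃ τ ∈ Icc t (t + ℓ), |T (prim (y τ))| ≤ η := by
  obtain ⟨ℓ, hℓ, hev⟩ := hy.exists_small hα hβ (show 0 < η / (‖T‖ + 1) by positivity)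
  refine ⟨ℓ, hℓ, hev.mono fun t ⟨τ, hτ, h⟩ => ⟨τ, hτ, ?_⟩⟩
  refine (T.le_opNorm _).trans ?_
  rw [le_div_iff₀ (by positivity)] at h
  nlinarith [norm_nonneg (prim (y τ))]

/-- Its derivative is `g(L) - g(0)`, which tends to `0`, and the moment is small in every long
window. -/
lemma tendsto_integ (hy : IsGlobalCurve α β y) (hα : 1 / 2 < α) (hβ : β < 1 / 2) :
    Tendsto (fun t => integ (prim (y t))) atTop (𝓝 0) := by
  refine tendsto_zero_of_windows (fun t ht => hy.hasDerivAt_clm integ ht) (fun ε hε => ?_)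
    fun η hη => hy.exists_small_clm hα hβ integ hη
  have hg0 := tendsto_bdry (α := α) (hy.tendsto_ext_zero hα hβ)
  have hgL := tendsto_bdry (α := β) (hy.tendsto_ext_L hα hβ)
  have h := hgL.sub hg0
  simp only [← gMap_zero α β, ← gMap_L α β, ← integ_vMap, sub_zero] at h
  exact (h.eventually (lt_mem_nhds (show -ε < 0 by linarith))).mono fun t ht => ht.le

/-- The `L²` norm of the solution tends to zero. -/
lemma tendsto_norm_inc (hy : IsGlobalCurve α β y) (hα : 1 / 2 < α) (hβ : β < 1 / 2) :
    Tendsto (fun t => ‖inc (prim (y t))‖) atTop (𝓝 0) := by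
  have hu0 := hy.tendsto_ext_zero hα hβ
  have huL := hy.tendsto_ext_L hα hβ
  have hv0 := hy.tendsto_vMap (evalAt 0) hu0
  have hvL := hy.tendsto_vMap (evalAt L) huL
  have hgL := tendsto_bdry (α := β) huL
  have h := (((hgL.const_mul L).sub hvL).add hv0).add (hy.tendsto_integ hα hβ)
  simp only [← gMap_L α β, evalAt_apply, mul_zero, sub_zero, add_zero] at h
  let T : ContSpace L →L[ℝ] ℝ := integ ∘L ContinuousLinearMap.mul ℝ (ContSpace L) idC
  have hT : ∀ u, T u = integ (idC * u) := fun u => rfl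
  have hP : Tendsto (fun t => T (prim (y t))) atTop (𝓝 0) := by
    -- Only a lower bound on the derivative of `∫ x u` is available, since its term `½ ∫ u²` has a
    -- sign but is not yet known to be small.
    refine tendsto_zero_of_windows (fun t ht => hy.hasDerivAt_clm T ht) (fun ε hε => ?_)
      fun η hη => hy.exists_small_clm hα hβ T hη
    filter_upwards [h.eventually (lt_mem_nhds (show -ε < 0 by linarith))] with t ht
    rw [hT, integ_idC_mul_vMap]
    linarith [sq_nonneg ‖inc (prim (y t))‖]
  -- The whole derivative of `∫ x u` tends to zero by Barbalat's lemma; removing the `o(1)` terms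
  -- isolates `½ ∫ u²`.
  have hP' := (hy.tendsto_vMap T hP).sub h
  simp only [hT, integ_idC_mul_vMap, add_sub_cancel_left, sub_zero] at hP'
  refine tendsto_zero_of_sq_le (b := fun t => 2 * (1 / 2 * ‖inc (prim (y t))‖ ^ 2))
    (Eventually.of_forall fun t => le_of_eq (by ring)) ?_
  simpa only [mul_zero] using hP'.const_mul 2

end IsGlobalCurve

end

noncomputable section

/-! ### Weak convergence in `H^1(0,L)` -/

variable {L : ℝ} [hL : Fact (0 < L)]

/-- An element orthogonal to the range is orthogonal to all test functions, hence zero. -/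
lemma denseRange_hOne : DenseRange (hOne : HOne L → LTwo L) := by
  have h : (LinearMap.range (hOne : HOne L →L[ℝ] LTwo L).toLinearMap).topologicalClosure = ⊤ := by
    rw [Submodule.topologicalClosure_eq_top_iff, eq_bot_iff]
    intro q hq
    have hz : q =ᵐ[mu L] (0 : ℝ → ℝ) := by
      refine ae_eq_zero_of_test (memLp_coe q) fun φ hφ => ?_
      have h1 := prim_of_hasDerivAt (u := (restr φ hφ.1.continuous.continuousOn : ContSpace L))
        (p := restr (deriv φ) hφ.continuous_deriv.continuousOn) fun x hx => by
          rw [ext_restr _ _ (Ioo_subset_Icc_self hx)]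
          refine ((hφ.1.differentiable (by norm_num)) x).hasDerivAt.congr_of_eventuallyEq ?_
          filter_upwards [Ioo_mem_nhds hx.1 hx.2] with z hz
            using ext_restr _ _ (Ioo_subset_Icc_self hz)
      have h2 : inner ℝ (inc (restr φ hφ.1.continuous.continuousOn : ContSpace L)) q = 0 := by
        rw [h1]
        exact hq _ ⟨_, rfl⟩
      rw [inner_inc_left] at h2
      rw [← h2]
      refine setIntegral_congr_fun measurableSet_Ioo fun x hx => ?_
      simp only [ext_restr _ _ (Ioo_subset_Icc_self hx), mul_comm]
    rw [Submodule.mem_bot, Lp.eq_zero_iff_ae_eq_zero]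
    exact hz
  intro q
  have : q ∈ (LinearMap.range (hOne : HOne L →L[ℝ] LTwo L).toLinearMap).topologicalClosure :=
    h ▸ Submodule.mem_top
  exact this

/-- Weak convergence may be tested on a dense set. -/
lemma tendsto_inner_of_dense {ι : Type*} {l : Filter ι} {p : ι → LTwo L} {R : ℝ}
    (hp : ∀ᶠ i in l, ‖p i‖ ≤ R) (h : ∀ e : HOne L, Tendsto (fun i => inner ℝ (p i) (hOne e)) l (𝓝 0))
    (q : LTwo L) : Tendsto (fun i => inner ℝ (p i) q) l (𝓝 0) := by
  rw [Metric.tendsto_nhds]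
  intro ε hε
  obtain ⟨e, he⟩ := denseRange_hOne.exists_dist_lt q (show 0 < ε / (2 * (|R| + 1)) by positivity)
  filter_upwards [hp, Metric.tendsto_nhds.1 (h e) (ε / 2) (by positivity)] with i h1 h2
  rw [dist_zero_right, Real.norm_eq_abs] at *
  rw [dist_eq_norm] at he
  have h3 : inner ℝ (p i) q = inner ℝ (p i) (hOne e) + inner ℝ (p i) (q - hOne e) := by
    rw [inner_sub_right]; ring
  have h4 := abs_real_inner_le_norm (p i) (q - hOne e)
  have h5 : ‖p i‖ * ‖q - hOne e‖ ≤ ε / 2 := by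
    calc _ ≤ (|R| + 1) * (ε / (2 * (|R| + 1))) := by
          gcongr
          linarith [le_abs_self R]
      _ = ε / 2 := by field_simp
  rw [h3]
  linarith [abs_add_le (inner ℝ (p i) (hOne e)) (inner ℝ (p i) (q - hOne e))]

/-- Against an `H¹` function, `u_x` can be integrated by parts into boundary values and an `L²`
pairing of `u`, all tending to zero. Boundedness of `u_x` in `L²` and density extend this to all of
`L²`. -/
lemma IsGlobalCurve.weaklyTendstoZeroH1 {α β : ℝ} {y : ℝ → HOne L} (hy : IsGlobalCurve α β y)
    (hα : 1 / 2 < α) (hβ : β < 1 / 2) : WeaklyTendstoZeroH1 L fun t => ext (prim (y t)) := by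
  intro ψ hψ
  have hψ' : MemSobolev L (0 + 1) ψ := by rwa [zero_add]
  obtain ⟨h1, -, h2⟩ := (memSobolev_add_one le_rfl ψ).1 hψ'
  have h3 := h2.memLp
  have hn := hy.tendsto_norm_inc hα hβ
  have hinc : ∀ q : LTwo L, Tendsto (fun t => inner ℝ (inc (prim (y t))) q) atTop (𝓝 0) := fun q =>
    squeeze_zero_norm (fun t => norm_inner_le_norm _ _) (by simpa using hn.mul_const ‖q‖)
  have e1 : ∀ t, ∫ x in Ioo 0 L, ext (prim (y t)) x * ψ x
      = inner ℝ (inc (prim (y t))) (h1.toLp ψ) := fun t => by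
    rw [inner_inc_left]
    refine integral_congr_ae ?_
    filter_upwards [h1.coeFn_toLp] with x hx
    rw [hx]
  have e2 : ∀ t, ∫ x in Ioo 0 L, weakDeriv L (ext (prim (y t))) x * weakDeriv L ψ x
      = inner ℝ (y t).2 (h3.toLp _) := fun t => by
    rw [L2.inner_def]
    refine integral_congr_ae ?_
    filter_upwards [h3.coeFn_toLp, (hasWeakDeriv_prim (y t)).weakDeriv_ae] with x hx hx'
    rw [hx, hx']
    simp [mul_comm]
  simp only [e1, e2]
  obtain ⟨R, hR⟩ := hy.bounded
  have hp : ∀ᶠ t in atTop, ‖(y t).2‖ ≤ R := by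
    filter_upwards [eventually_ge_atTop 0] with t ht using (norm_snd_le (y t)).trans (hR t ht)
  have hlim := tendsto_inner_of_dense hp (fun e => ?_) (h3.toLp _)
  · simpa using (hinc (h1.toLp ψ)).add hlim
  have e3 : ∀ t, inner ℝ (y t).2 (hOne e) = ext (prim (y t)) L * ext (prim e) L
      - ext (prim (y t)) 0 * ext (prim e) 0 - inner ℝ (inc (prim (y t))) e.2 := fun t => by
    have := prim_pairing (u := prim (y t)) (w := prim e) (a := (y t).1) (p := (y t).2)
      (b := e.1) (q := e.2) rfl rfl
    rw [this, hOne_apply, real_inner_comm]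
    ring
  simp only [e3]
  simpa using (((hy.tendsto_ext_L hα hβ).mul_const (ext (prim e) L)).sub
    ((hy.tendsto_ext_zero hα hβ).mul_const (ext (prim e) 0))).sub (hinc e.2)

/-! ### Strong convergence in `H^s(0,L)`, `s < 1` -/

omit hL in
-- For `|r| ≤ δ` the stronger kernel gains `δ^{2(τ-σ)}`; for `|r| > δ` the kernel is bounded. The
-- hypothesis at `r = 0` excludes a nonzero numerator over `0`.
lemma gagliardo_integrand_le {σ τ δ : ℝ} (hσ : 0 < σ) (hστ : σ < τ) (hδ : 0 < δ) (d r : ℝ)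
    (hd : r = 0 → d = 0) :
    ‖d‖ₑ ^ 2 / ENNReal.ofReal (|r| ^ (1 + 2 * σ))
      ≤ ENNReal.ofReal (δ ^ (2 * (τ - σ))) * (‖d‖ₑ ^ 2 / ENNReal.ofReal (|r| ^ (1 + 2 * τ)))
        + ENNReal.ofReal (δ ^ (-(1 + 2 * σ))) * ‖d‖ₑ ^ 2 := by
  rcases eq_or_ne r 0 with h0 | h0
  · simp [hd h0]
  have hr : 0 < |r| := abs_pos.2 h0
  simp only [div_eq_mul_inv]
  rw [← ENNReal.ofReal_inv_of_pos (by positivity), ← ENNReal.ofReal_inv_of_pos (by positivity),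
    ← Real.rpow_neg hr.le, ← Real.rpow_neg hr.le, mul_left_comm,
    ← ENNReal.ofReal_mul (by positivity), mul_comm (ENNReal.ofReal _) (‖d‖ₑ ^ 2), ← mul_add,
    ← ENNReal.ofReal_add (by positivity) (by positivity)]
  gcongr
  rcases le_or_gt |r| δ with h | h
  · have h1 : |r| ^ (-(1 + 2 * σ)) = |r| ^ (2 * (τ - σ)) * |r| ^ (-(1 + 2 * τ)) := by
      rw [← Real.rpow_add hr]; congr 1; ring
    rw [h1]
    have h2 : |r| ^ (2 * (τ - σ)) ≤ δ ^ (2 * (τ - σ)) :=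
      Real.rpow_le_rpow hr.le h (by linarith)
    have h3 : 0 ≤ δ ^ (-(1 + 2 * σ)) := by positivity
    have := mul_le_mul_of_nonneg_right h2 (show 0 ≤ |r| ^ (-(1 + 2 * τ)) by positivity)
    linarith
  · have h1 : |r| ^ (-(1 + 2 * σ)) ≤ δ ^ (-(1 + 2 * σ)) :=
      Real.rpow_le_rpow_of_nonpos hδ h.le (by linarith)
    have h2 : 0 ≤ δ ^ (2 * (τ - σ)) * |r| ^ (-(1 + 2 * τ)) := by positivity
    linarith

omit hL in
lemma lintegral_sq_sub_le {f : ℝ → ℝ} (hf : Measurable f) :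
    ∫⁻ x in Ioo 0 L, ∫⁻ y in Ioo 0 L, ‖f x - f y‖ₑ ^ 2 ≤ ENNReal.ofReal (4 * L) * normSq L f := by
  have hvol : mu L univ = ENNReal.ofReal L := by simp
  have hF : Measurable fun x => ‖f x‖ₑ ^ 2 := hf.enorm.pow_const 2
  have hsq : ∀ x y, ‖f x - f y‖ₑ ^ 2 ≤ 2 * ‖f x‖ₑ ^ 2 + 2 * ‖f y‖ₑ ^ 2 := fun x y => by
    have := enorm_add_mul_sq_le (f x) (f y) (-1)
    simpa [sub_eq_add_neg] using this
  have h1 : ∀ x, ∫⁻ y in Ioo 0 L, ‖f x - f y‖ₑ ^ 2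
      ≤ 2 * ENNReal.ofReal L * ‖f x‖ₑ ^ 2 + 2 * normSq L f := fun x => by
    refine (lintegral_mono (hsq x)).trans (le_of_eq ?_)
    rw [lintegral_add_left measurable_const, lintegral_const, hvol, lintegral_const_mul _ hF, normSq]
    ring
  refine (lintegral_mono h1).trans (le_of_eq ?_)
  rw [lintegral_add_left (hF.const_mul _), lintegral_const, hvol, lintegral_const_mul _ hF, ← normSq,
    ENNReal.ofReal_mul (by norm_num), ENNReal.ofReal_ofNat]
  ring

omit hL in
/-- Interpolation between `L²` and `H^τ`. -/
lemma gagliardoSq_interpolate {σ τ δ : ℝ} (hσ : 0 < σ) (hστ : σ < τ) (hδ : 0 < δ)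
    {f : ℝ → ℝ} (hf : Measurable f) :
    gagliardoSq L σ f ≤ ENNReal.ofReal (δ ^ (2 * (τ - σ))) * gagliardoSq L τ f
      + ENNReal.ofReal (δ ^ (-(1 + 2 * σ))) * (ENNReal.ofReal (4 * L) * normSq L f) := by
  rw [gagliardoSq, gagliardoSq, if_neg hσ.ne', if_neg (hσ.trans hστ).ne']
  have hm := measurable_gagliardo_integrand hf τ
  have hmi : Measurable fun x => ∫⁻ y in Ioo 0 L,
      ‖f x - f y‖ₑ ^ 2 / ENNReal.ofReal (|x - y| ^ (1 + 2 * τ)) :=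
    hm.lintegral_prod_right'
  refine le_trans ?_ (add_le_add_right (mul_le_mul_right (lintegral_sq_sub_le hf) _) _)
  refine lintegral_add_le_of_measurable ENNReal.ofReal_ne_top ENNReal.ofReal_ne_top hmi fun x => ?_
  have hmx : Measurable fun y => ‖f x - f y‖ₑ ^ 2 / ENNReal.ofReal (|x - y| ^ (1 + 2 * τ)) :=
    Measurable.comp (f := Prod.mk x) hm measurable_prodMk_left
  refine lintegral_add_le_of_measurable ENNReal.ofReal_ne_top ENNReal.ofReal_ne_top hmx fun y => ?_
  refine gagliardo_integrand_le hσ hστ hδ _ (x - y) fun h => ?_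
  rw [sub_eq_zero.1 h, sub_self]

lemma tendsto_enorm_zero {ι V : Type*} [NormedAddCommGroup V] {l : Filter ι} {z : ι → V}
    (h : Tendsto (fun i => ‖z i‖) l (𝓝 0)) : Tendsto (fun i => ‖z i‖ₑ) l (𝓝 0) := by
  have := ENNReal.tendsto_ofReal h
  simpa only [ofReal_norm, ENNReal.ofReal_zero] using this

lemma tendsto_normSq {ι : Type*} {l : Filter ι} {u : ι → ContSpace L}
    (h : Tendsto (fun i => ‖inc (u i)‖) l (𝓝 0)) :
    Tendsto (fun i => normSq L (ext (u i))) l (𝓝 0) := by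
  refine (tendsto_sq_zero (tendsto_enorm_zero h)).congr fun i => ?_
  rw [← normSq_eq_enorm_sq, normSq_congr (inc_ae _)]

/-- Take `τ` between `σ` and `1`; the seminorm of order `τ` is bounded by the `H¹` bound. First `δ`
is fixed to make the near-diagonal part small, then the `L²` decay handles the rest. -/
lemma tendsto_gagliardoSq {ι : Type*} {l : Filter ι} {e : ι → HOne L} {R : ℝ≥0}
    (hR : ∀ᶠ i in l, ‖e i‖ ≤ R) (h : Tendsto (fun i => ‖inc (prim (e i))‖) l (𝓝 0)) {σ : ℝ}
    (hσ : 0 < σ) (hσ1 : σ < 1) : Tendsto (fun i => gagliardoSq L σ (ext (prim (e i)))) l (𝓝 0) := by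
  obtain ⟨τ, hστ, hτ1⟩ := exists_between hσ1
  have hτ := hσ.trans hστ
  have hK := lintegral_kernel_lt_top hτ1 L
  set G := (∫⁻ w in Ioo (-L) L, kernel τ w) ^ 2 * (R : ℝ≥0∞) ^ 2 with hG
  have hGtop : G ≠ ∞ := ENNReal.mul_ne_top (ENNReal.pow_ne_top hK.ne)
    (ENNReal.pow_ne_top ENNReal.coe_ne_top)
  have hgag : ∀ᶠ i in l, gagliardoSq L τ (ext (prim (e i))) ≤ G := by
    filter_upwards [hR] with i hi
    refine (gagliardoSq_prim_le hτ (e i)).trans ?_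
    rw [hG]
    gcongr
    refine (enorm_snd_le _).trans ?_
    rw [enorm_eq_nnnorm]
    exact_mod_cast hi
  rw [ENNReal.tendsto_nhds_zero]
  intro ε hε
  have hε2 : 0 < ε / 2 := ENNReal.half_pos hε.ne'
  have hδ : Tendsto (fun δ : ℝ => ENNReal.ofReal (δ ^ (2 * (τ - σ))) * G) (𝓝[>] 0) (𝓝 0) := by
    have h1 : Tendsto (fun δ : ℝ => δ ^ (2 * (τ - σ))) (𝓝[>] 0) (𝓝 0) := by
      have h2 := (Real.continuous_rpow_const (q := 2 * (τ - σ)) (by linarith)).tendsto 0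
      rw [Real.zero_rpow (by linarith)] at h2
      exact h2.mono_left nhdsWithin_le_nhds
    have h3 := ENNReal.Tendsto.mul_const (ENNReal.tendsto_ofReal h1) (Or.inr hGtop)
    simpa using h3
  obtain ⟨δ, hδ1, hδ0⟩ := ((ENNReal.tendsto_nhds_zero.1 hδ _ hε2).and self_mem_nhdsWithin).exists
  have hn := ENNReal.Tendsto.const_mul (a := ENNReal.ofReal (δ ^ (-(1 + 2 * σ))))
    (ENNReal.Tendsto.const_mul (a := ENNReal.ofReal (4 * L)) (tendsto_normSq h)
      (Or.inr ENNReal.ofReal_ne_top)) (Or.inr ENNReal.ofReal_ne_top)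
  rw [mul_zero, mul_zero] at hn
  filter_upwards [hgag, ENNReal.tendsto_nhds_zero.1 hn _ hε2] with i h1 h2
  refine (gagliardoSq_interpolate hσ hστ hδ0 (continuous_ext _).measurable).trans ?_
  rw [← ENNReal.add_halves ε]
  exact add_le_add ((by gcongr : _ ≤ _).trans hδ1) h2

omit hL in
lemma enorm_integral_mul_le (p : LTwo L) {φ : ℝ → ℝ} (hφ : MemLp φ 2 (mu L)) :
    ‖∫ x in Ioo 0 L, p x * φ x‖ₑ ^ 2 ≤ ‖p‖ₑ ^ 2 * normSq L φ := by
  have h1 : ∫ x in Ioo 0 L, p x * φ x = inner ℝ p (hφ.toLp φ) := by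
    rw [L2.inner_def]
    refine integral_congr_ae ?_
    filter_upwards [hφ.coeFn_toLp] with x hx
    rw [hx]
    simp [mul_comm]
  rw [h1, ← normSq_congr hφ.coeFn_toLp, normSq_eq_enorm_sq, ← mul_pow]
  gcongr
  simp only [enorm_eq_nnnorm]
  exact_mod_cast norm_inner_le_norm (𝕜 := ℝ) p (hφ.toLp φ)

/-- By Cauchy-Schwarz, since admissible test functions have `L²` norm at most `1`. -/
lemma sobolevNorm_neg_le {s : ℝ} (hs : s < 0) (u : ContSpace L) :
    sobolevNorm L s (ext u) ≤ ‖inc u‖ₑ := by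
  rw [sobolevNorm, if_neg (not_le.2 hs)]
  refine iSup₂_le fun φ hφ => ?_
  have hm : MemLp φ 2 (mu L) := (hφ.1.1.continuous.memLp_of_hasCompactSupport hφ.1.2.1).restrict _
  have h1 : normSq L φ ≤ 1 := by
    refine (normSq_le_sobSq (s := -s) (by linarith) φ).trans ?_
    rw [← sobolevNorm_sq (by linarith), sobolevNorm, if_pos (by linarith)]
    exact pow_le_one₀ zero_le hφ.2
  have h2 : ∫ x in Ioo 0 L, ext u x * φ x = ∫ x in Ioo 0 L, inc u x * φ x := by
    refine integral_congr_ae ?_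
    filter_upwards [inc_ae u] with x hx
    rw [hx]
  rw [h2]
  refine (ENNReal.pow_le_pow_left_iff (n := 2) (by norm_num)).1 ?_
  refine (enorm_integral_mul_le _ hm).trans (mul_le_of_le_one_right zero_le h1)

lemma IsGlobalCurve.tendsto_sobolevNorm {α β : ℝ} {y : ℝ → HOne L} (hy : IsGlobalCurve α β y)
    (hα : 1 / 2 < α) (hβ : β < 1 / 2) {s : ℝ} (hs : s < 1) :
    Tendsto (fun t => sobolevNorm L s (ext (prim (y t)))) atTop (𝓝 0) := by
  have hn := hy.tendsto_norm_inc hα hβ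
  rcases lt_or_ge s 0 with hs0 | hs0
  · exact tendsto_of_tendsto_of_tendsto_of_le_of_le tendsto_const_nhds (tendsto_enorm_zero hn)
      (fun _ => zero_le) fun t => sobolevNorm_neg_le hs0 _
  refine tendsto_zero_of_sq ?_
  simp only [sobolevNorm_sq hs0, sobSq_of_lt_one hs0 hs]
  rcases hs0.eq_or_lt with rfl | hs0
  · simpa [gagliardoSq] using tendsto_normSq hn
  obtain ⟨R, hR⟩ := hy.bounded
  have hR' : ∀ᶠ t in atTop, ‖y t‖ ≤ R.toNNReal := by
    filter_upwards [eventually_ge_atTop 0] with t ht using (hR t ht).trans (Real.le_coe_toNNReal R)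
  simpa using (tendsto_normSq hn).add (tendsto_gagliardoSq hR' hn hs0 hs)

end

end BBM

/-! ### Assembly: well-posedness, global solutions and decay -/

theorem mainTheorem3 (L α β : ℝ) (hL : 0 < L) (hα : 1 / 2 < α) (hβ : β < 1 / 2) :
    -- local well-posedness in `H^s(0,L)`: existence, uniqueness, Lipschitz dependence on the data
    (∀ s : ℝ, 1 / 2 < s → s < 5 / 2 →
      (∀ T : ℝ, 0 < T → ∀ (u₀ : ℝ → ℝ) (u w : ℝ → ℝ → ℝ),
        BBM.IsSolution L α β s T u₀ u → BBM.IsSolution L α β s T u₀ w →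
          ∀ t ∈ Icc 0 T, EqOn (u t) (w t) (Icc 0 L)) ∧
      (∀ ρ : ℝ≥0, ∃ T : ℝ, 0 < T ∧ ∃ C : ℝ≥0,
        (∀ u₀ : ℝ → ℝ, BBM.MemSobolev L s u₀ → BBM.sobolevNorm L s u₀ ≤ ρ →
          ∃ u : ℝ → ℝ → ℝ, BBM.IsSolution L α β s T u₀ u) ∧
        (∀ (u₀ w₀ : ℝ → ℝ) (u w : ℝ → ℝ → ℝ),
          BBM.MemSobolev L s u₀ → BBM.sobolevNorm L s u₀ ≤ ρ →
          BBM.MemSobolev L s w₀ → BBM.sobolevNorm L s w₀ ≤ ρ →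
          BBM.IsSolution L α β s T u₀ u → BBM.IsSolution L α β s T w₀ w →
            ∀ t ∈ Icc 0 T,
              BBM.sobolevNorm L s (u t - w t) ≤ C * BBM.sobolevNorm L s (u₀ - w₀)))) ∧
    -- global solutions in `H^1(0,L)`, and their asymptotic behaviour
    (∀ u₀ : ℝ → ℝ, BBM.MemSobolev L 1 u₀ →
      ∃ u : ℝ → ℝ → ℝ, (∀ T : ℝ, 0 < T → BBM.IsSolution L α β 1 T u₀ u) ∧
        AntitoneOn (fun t => BBM.sobolevNorm L 1 (u t)) (Ici 0) ∧
        (BBM.UCPConjecture →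
          BBM.WeaklyTendstoZeroH1 L u ∧
          ∀ s : ℝ, s < 1 → Tendsto (fun t => BBM.sobolevNorm L s (u t)) atTop (𝓝 0))) := by
  have : Fact (0 < L) := ⟨hL⟩
  refine ⟨fun s hs hs' => ⟨fun T hT u₀ u w hu hw t ht => hu.eqOn hs hT hw ht,
    BBM.exists_wellPosed α β hs hs'⟩, fun u₀ hu₀ => ?_⟩
  -- The initial datum is encoded by its value at `0` and its weak derivative.
  obtain ⟨e, he⟩ := (BBM.embedsFrom_hOne (L := L) le_rfl).1 u₀ hu₀
  obtain ⟨y, hy0, hy⟩ := BBM.exists_isGlobalCurve hα hβ e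
  refine ⟨fun t => BBM.ext (BBM.prim (y t)), fun T hT => hy.isSolution hu₀ ?_ hT,
    hy.antitoneOn_sobolevNorm hα hβ, fun _ => ⟨hy.weaklyTendstoZeroH1 hα hβ,
      fun s hs => hy.tendsto_sobolevNorm hα hβ hs⟩⟩
  rw [hy0]
  exact (BBM.inc_ae _).symm.trans he
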